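/- Let $c,q>0$ and $\kappa>-1$, and let $\varrho:\mathbb{R}\to[0,\infty)$ be an even function which is positive and continuous on $(-c,c)$, vanishes outside $(-c,c)$, and satisfies $\lim_{x\uparrow c}\varrho(x)/|c-x|^{\kappa}=q$. On a probability space $(\Omega,\mathcal F,\mathbb P)$ let $F=(F(x))_{x\in\mathbb{Z}}$ and $B=(B(i))_{i\in\mathbb{Z}}$ be two mutually independent families of i.i.d. random variables, where $F(x)$ has density $\varrho$ and $\mathbb P(B(i)=1)=\mathbb P(B(i)=-1)=1/2$. For $n\in\mathbb{N}$ and an integer $k$ with $|k|\le n$ let \[ A^*(B,F;n,k)=\min_{\gamma}\ \sum_{i=1}^n B(i)F(\gamma(i)), \] where the minimum is over all lazy walks $\gamma:\{0,\dots,n\}\to\mathbb{Z}$ with $\gamma(0)=0$, $\gamma(n)=k$ and $|\gamma(i+1)-\gamma(i)|\le 1$ for $0\le i<n$. Let $[\cdot]$ denote the integer part, rounding towards $0$. The shape function of the model is the deterministic function $\Lambda$ on $[-1,1]$ such that, almost surely, for all $\alpha\in[-1,1]$ simultaneously, \[ \frac{A^*(B,F;n,[\alpha n])}{n}\longrightarrow-\Lambda(\alpha)\qquad(n\to\infty).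 \] **Theorem.** Suppose that $\kappa>0$. Then the shape function $\Lambda$ exists (it is then unique), and it has flat edges near $0$: there is $\alpha_0\in(0,1)$ such that \[ \Lambda(\alpha)=c-K|\alpha|\quad\text{for all }\alpha\in[-\alpha_0,\alpha_0],\qquad\text{where } K=\frac{c-\Lambda(\alpha_0)}{\alpha_0}. \] -/

import Mathlib

open MeasureTheory ProbabilityTheory Filter Topology

/-- `ϱ` is an even function, positive and continuous on `(-c, c)` and zero outside `(-c, c)`, which
behaves like `q * |c - x| ^ κ` as `x` approaches the edge `c` of its support from inside
(hence, being even, like `q * |c + x| ^ κ` near `-c`). -/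
structure IsEdgeDensity (ϱ : ℝ → ℝ) (c κ q : ℝ) : Prop where
  c_pos : 0 < c
  q_pos : 0 < q
  neg_one_lt : -1 < κ
  even : ∀ x, ϱ (-x) = ϱ x
  pos : ∀ x ∈ Set.Ioo (-c) c, 0 < ϱ x
  continuousOn : ContinuousOn ϱ (Set.Ioo (-c) c)
  eq_zero : ∀ x, x ∉ Set.Ioo (-c) c → ϱ x = 0
  edge : Tendsto (fun x => ϱ x / |c - x| ^ κ) (𝓝[<] c) (𝓝 q)

/-- The random environment: `F = (F x)` and `B = (B i)`, `x, i ∈ ℤ`, are two mutually independent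
families of i.i.d. random variables, each `F x` has density `ϱ` with respect to Lebesgue measure,
and each `B i` takes the values `1` and `-1` with probability `1/2` each. -/
structure IsEnvironment {Ω : Type*} [MeasurableSpace Ω] (μ : Measure Ω)
    (B F : ℤ → Ω → ℝ) (ϱ : ℝ → ℝ) : Prop where
  measurable_F : ∀ x, Measurable (F x)
  measurable_B : ∀ i, Measurable (B i)
  law_F : ∀ x, μ.map (F x) = volume.withDensity (fun y => ENNReal.ofReal (ϱ y))
  law_B_one : ∀ i, μ {ω | B i ω = 1} = 1 / 2
  law_B_neg_one : ∀ i, μ {ω | B i ω = -1} = 1 / 2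
  indep_F : iIndepFun F μ
  indep_B : iIndepFun B μ
  indep_F_B : IndepFun (fun ω x => F x ω) (fun ω i => B i ω) μ

/-- `γ`, restricted to times `0, …, n`, is a lazy walk on `ℤ` from `0` at time `0` to `k` at
time `n`. The values of `γ` after time `n` play no role. -/
def IsLazyWalk (n : ℕ) (k : ℤ) (γ : ℕ → ℤ) : Prop :=
  γ 0 = 0 ∧ (∀ i < n, |γ (i + 1) - γ i| ≤ 1) ∧ γ n = k

/-- The action `∑_{i=1}^n b(i) f(γ(i))` of the path `γ` in the environment `b(i) f(x)`. -/
def action (b f : ℤ → ℝ) (n : ℕ) (γ : ℕ → ℤ) : ℝ :=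
  ∑ i ∈ Finset.Icc 1 n, b (i : ℤ) * f (γ i)

/-- The smallest action among lazy walks from `0` to `k` of length `n`. For `|k| ≤ n` the infimum
is a minimum, see `isLeast_minAction`. -/
noncomputable def minAction (b f : ℤ → ℝ) (n : ℕ) (k : ℤ) : ℝ :=
  sInf (action b f n '' {γ | IsLazyWalk n k γ})

theorem isLeast_minAction (b f : ℤ → ℝ) (n : ℕ) (k : ℤ) (hk : |k| ≤ n) :
    IsLeast (action b f n '' {γ | IsLazyWalk n k γ}) (minAction b f n k) := by
  have hne : (action b f n '' {γ | IsLazyWalk n k γ}).Nonempty := by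
    refine Set.Nonempty.image _ ⟨fun i => max (-(i : ℤ)) (min (i : ℤ) k), ?_, ?_, ?_⟩
    · simp
    · intro i _
      have := abs_le.1 hk
      rw [abs_le]
      push_cast
      omega
    · have := abs_le.1 hk
      change max (-(n : ℤ)) (min (n : ℤ) k) = k
      omega
  have hfin : (action b f n '' {γ | IsLazyWalk n k γ}).Finite := by
    have hbox : (Set.univ.pi fun _ : Fin (n + 1) => Set.Icc (-(n : ℤ)) n).Finite :=
      Set.Finite.pi fun _ => Set.finite_Icc _ _
    refine (hbox.image fun g : Fin (n + 1) → ℤ =>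
      action b f n (fun i => g (Fin.ofNat (n + 1) i))).subset ?_
    rintro _ ⟨γ, ⟨h0, h1, _⟩, rfl⟩
    refine ⟨fun i => γ i, ?_, ?_⟩
    · have hb : ∀ j : ℕ, j ≤ n → |γ j| ≤ j := by
        intro j
        induction j with
        | zero => simp [h0]
        | succ j ih =>
          intro hj
          have h2 := abs_le.1 (h1 j (by omega))
          have h3 := abs_le.1 (ih (by omega))
          rw [abs_le]
          push_cast
          omega
      intro i _
      have h2 := abs_le.1 (hb i (by omega))
      have h3 : (i : ℕ) ≤ n := by omega
      change -(n : ℤ) ≤ γ i ∧ γ i ≤ n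
      constructor <;> omega
    · refine Finset.sum_congr rfl fun i hi => ?_
      have h2 : i % (n + 1) = i := Nat.mod_eq_of_lt (by have := (Finset.mem_Icc.1 hi).2; omega)
      simp [h2]
  exact ⟨hne.csInf_mem hfin, fun _ ha => csInf_le hfin.bddBelow ha⟩

/-- The integer part of a real number, rounding towards zero. -/
noncomputable def intPart (x : ℝ) : ℤ :=
  if 0 ≤ x then ⌊x⌋ else -⌊-x⌋

/-- The deterministic function `Λ`, considered on `[-1, 1]` only, is the shape function: almost
surely, for all slopes `α ∈ [-1, 1]` simultaneously, the smallest action of lazy walks from `0` to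
`[α n]` of length `n` is asymptotic to `-Λ(α) n`. This determines `Λ` on `[-1, 1]`. -/
def IsShapeFunction {Ω : Type*} [MeasurableSpace Ω] (μ : Measure Ω)
    (B F : ℤ → Ω → ℝ) (Λ : ℝ → ℝ) : Prop :=
  ∀ᵐ ω ∂μ, ∀ α ∈ Set.Icc (-1 : ℝ) 1,
    Tendsto (fun n : ℕ =>
      minAction (fun i => B i ω) (fun x => F x ω) n (intPart (α * n)) / n) atTop (𝓝 (-Λ α))

theorem IsShapeFunction.eqOn {Ω : Type*} [MeasurableSpace Ω] {μ : Measure Ω}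
    [IsProbabilityMeasure μ] {B F : ℤ → Ω → ℝ} {Λ₁ Λ₂ : ℝ → ℝ}
    (h₁ : IsShapeFunction μ B F Λ₁) (h₂ : IsShapeFunction μ B F Λ₂) :
    Set.EqOn Λ₁ Λ₂ (Set.Icc (-1) 1) := by
  obtain ⟨ω, hω₁, hω₂⟩ := (h₁.and h₂).exists
  intro α hα
  exact neg_injective (tendsto_nhds_unique (hω₁ α hα) (hω₂ α hα))

/-! Adding `c` to every term turns the action into a cost with summands `c + b(i) f(x)` in `[0,
2c]`, whose growth rate is `h = c - Λ`. Oscillating across an almost perfect edge, with `f` near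
`-c` at one end and near `c` at the other, is almost free. Hence `h 0 = 0`, and waiting near the
origin before leaving shows that `h β / β` is nondecreasing in `β > 0`. The claim is that this
quotient is constant for small `β`: beyond a fixed multiple `C` of the distance, additional time no
longer lowers the cost to leading order.

The reason is a competition between two exponents. In an interval whose edges all have deficit `2c -
|f x - f (x+1)|` at least `e`, every sign change costs a walk at least `e`, so waiting for a time
`t` costs about `e t`. By the behaviour of the density at `±c`, the deficit has a finite moment of
order `-p` with `p = 2 + κ` (`IsEdgeDensity.integrable_edge`), so among `L` edges the smallest
deficit is typically at least of order `L ^ (-1/p)`. Waiting for a time of order `L` then costs `L ^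
(1 - 1/p)`, while the freedom to choose when to move gains only a fluctuation of order `√L log L`.
Since `p > 2`, waiting loses on all large scales.

To make this precise, `f` is frozen and the signs are averaged. A walk through an interval is cut at
its first and last visit to the midpoint. The cutting times depend on the signs, but sub-Gaussian
concentration and a union bound (`exists_signMean_le_add`) replace them by deterministic times at
the price `fluct` (`exists_meanCost_split`). Induction over dyadic scales (`WaitBound.glue`,
`exists_waitBound`), with summable relative errors, shows that time beyond `K` times the length plus
the sum of the deficits to the power `-p` does not reduce the mean cost. By Markov's inequality this
threshold is at most `C * 2 ^ j` with probability at least `1/2`, on an event that involves `F`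
alone, so that averaging over signs respects it.

If `h β < β C h(1/C)` for some `0 < β < 1/C`, then almost surely the cost of reaching `2 ^ j` in
time `2 ^ j / β` would eventually lie below the costs for all times up to `C * 2 ^ j` by a multiple
of `2 ^ j`, contradicting the averaged inequality (`IsEnvShape.exists_eq_mul`). Thus `α₀ = 1/C`
works. Existence of `h` comes from a subadditive ergodic theorem along nonzero rational slopes and a
sandwich argument for the other directions. -/

/-! ### Lazy walks and least costs -/

/-- `γ`, restricted to times `s, …, t`, is a lazy walk from `x` to `y` inside `I`. -/
def IsPath (I : Set ℤ) (s t : ℕ) (x y : ℤ) (γ : ℕ → ℤ) : Prop :=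
  γ s = x ∧ γ t = y ∧ (∀ i, s ≤ i → i < t → |γ (i + 1) - γ i| ≤ 1) ∧
    ∀ i, s ≤ i → i ≤ t → γ i ∈ I

/-- The cost of a path during the time interval `(s, t]`. -/
def pathCost (w : ℕ → ℤ → ℝ) (s t : ℕ) (γ : ℕ → ℤ) : ℝ :=
  ∑ i ∈ Finset.Ioc s t, w i (γ i)

/-- The least cost of a lazy walk from `(s, x)` to `(t, y)` inside `I`. -/
noncomputable def minCost (w : ℕ → ℤ → ℝ) (I : Set ℤ) (s t : ℕ) (x y : ℤ) : ℝ :=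
  sInf (pathCost w s t '' {γ | IsPath I s t x y γ})

section Paths

variable {w w' : ℕ → ℤ → ℝ} {I I₁ I₂ : Set ℤ} {s t u : ℕ} {x y z : ℤ} {γ γ' : ℕ → ℤ} {D : ℝ}

theorem IsPath.mono (h : IsPath I₁ s t x y γ) (hI : I₁ ⊆ I) : IsPath I s t x y γ :=
  ⟨h.1, h.2.1, h.2.2.1, fun i h1 h2 => hI (h.2.2.2 i h1 h2)⟩

theorem IsPath.abs_sub_le (h : IsPath I s t x y γ) {i : ℕ} (hs : s ≤ i) (ht : i ≤ t) :
    |γ i - x| ≤ i - s := by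
  induction i, hs using Nat.le_induction with
  | base => simp [h.1]
  | succ i hi ih =>
    have h1 := abs_le.1 (ih (by omega))
    have h2 := abs_le.1 (h.2.2.1 i hi (by omega))
    rw [abs_le]
    push_cast
    constructor <;> omega

theorem IsPath.trans (h₁ : IsPath I s t x y γ) (h₂ : IsPath I t u y z γ') (hst : s ≤ t)
    (htu : t ≤ u) : IsPath I s u x z fun i => if i ≤ t then γ i else γ' i := by
  refine ⟨by simp [hst, h₁.1], ?_, fun i h1 h2 => ?_, fun i h1 h2 => ?_⟩
  · by_cases h : u ≤ t
    · obtain rfl : u = t := le_antisymm h htu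
      simp [h₁.2.1, ← h₂.2.1, h₂.1]
    · simp [h, h₂.2.1]
  · rcases lt_trichotomy i t with h | h | h
    · simpa [h.le, Nat.succ_le_of_lt h] using h₁.2.2.1 i h1 h
    · subst h
      have := h₂.2.2.1 i le_rfl h2
      rw [h₂.1] at this
      simpa [h₁.2.1] using this
    · simpa [not_le.2 h, not_le.2 (Nat.lt_succ_of_lt h)] using h₂.2.2.1 i h.le h2
  · by_cases h : i ≤ t
    · simpa [h] using h₁.2.2.2 i h1 h
    · simpa [h] using h₂.2.2.2 i (by omega) h2

theorem IsPath.restrict (h : IsPath I s t x y γ) {s' t' : ℕ} (hs : s ≤ s') (ht : t' ≤ t)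
    (hI : ∀ i, s' ≤ i → i ≤ t' → γ i ∈ I₁) : IsPath I₁ s' t' (γ s') (γ t') γ :=
  ⟨rfl, rfl, fun i h1 h2 => h.2.2.1 i (by omega) (by omega), hI⟩

theorem pathCost_add (hst : s ≤ t) (htu : t ≤ u) :
    pathCost w s t γ + pathCost w t u γ = pathCost w s u γ :=
  Finset.sum_Ioc_consecutive (fun i => w i (γ i)) hst htu

theorem pathCost_nonneg (hw : ∀ i x, 0 ≤ w i x) : 0 ≤ pathCost w s t γ :=
  Finset.sum_nonneg fun i _ => hw i _

theorem pathCost_le (hw : ∀ i x, w i x ≤ D) (hst : s ≤ t) : pathCost w s t γ ≤ D * (t - s) := by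
  refine (Finset.sum_le_card_nsmul _ _ D fun i _ => hw i _).trans (le_of_eq ?_)
  rw [Nat.card_Ioc, nsmul_eq_mul, Nat.cast_sub hst, mul_comm]

theorem pathCost_congr (h : ∀ i, s < i → i ≤ t → w i (γ i) = w' i (γ' i)) :
    pathCost w s t γ = pathCost w' s t γ' :=
  Finset.sum_congr rfl fun i hi => h i (Finset.mem_Ioc.1 hi).1 (Finset.mem_Ioc.1 hi).2

theorem bddBelow_pathCost (hw : ∀ i x, 0 ≤ w i x) :
    BddBelow (pathCost w s t '' {γ | IsPath I s t x y γ}) :=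
  ⟨0, by rintro _ ⟨γ, -, rfl⟩; exact pathCost_nonneg hw⟩

theorem minCost_nonneg (hw : ∀ i x, 0 ≤ w i x) : 0 ≤ minCost w I s t x y :=
  Real.sInf_nonneg (by rintro _ ⟨γ, -, rfl⟩; exact pathCost_nonneg hw)

theorem minCost_le (hw : ∀ i x, 0 ≤ w i x) (h : IsPath I s t x y γ) :
    minCost w I s t x y ≤ pathCost w s t γ :=
  csInf_le (bddBelow_pathCost hw) ⟨γ, h, rfl⟩

theorem le_minCost (h : IsPath I s t x y γ) {a : ℝ}
    (ha : ∀ γ, IsPath I s t x y γ → a ≤ pathCost w s t γ) : a ≤ minCost w I s t x y :=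
  le_csInf ⟨_, γ, h, rfl⟩ (by rintro _ ⟨γ, hγ, rfl⟩; exact ha γ hγ)

theorem minCost_le_mul (hw : ∀ i x, 0 ≤ w i x) (hw' : ∀ i x, w i x ≤ D)
    (h : IsPath I s t x y γ) (hst : s ≤ t) : minCost w I s t x y ≤ D * (t - s) :=
  (minCost_le hw h).trans (pathCost_le hw' hst)

theorem minCost_triangle (hw : ∀ i x, 0 ≤ w i x) (hst : s ≤ t) (htu : t ≤ u)
    (h₁ : IsPath I₁ s t x y γ) (h₂ : IsPath I₂ t u y z γ') (hI₁ : I₁ ⊆ I) (hI₂ : I₂ ⊆ I) :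
    minCost w I s u x z ≤ minCost w I₁ s t x y + minCost w I₂ t u y z := by
  rw [← sub_le_iff_le_add]
  refine le_minCost h₁ fun γ₁ hγ₁ => ?_
  rw [sub_le_iff_le_add, ← sub_le_iff_le_add']
  refine le_minCost h₂ fun γ₂ hγ₂ => ?_
  rw [sub_le_iff_le_add']
  refine (minCost_le hw ((hγ₁.mono hI₁).trans (hγ₂.mono hI₂) hst htu)).trans (le_of_eq ?_)
  rw [← pathCost_add hst htu]
  congr 1
  · exact pathCost_congr fun i _ h => by simp [h]
  · exact pathCost_congr fun i h _ => by simp [not_le.2 h]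

theorem minCost_congr (h : ∀ i, s < i → i ≤ t → w i = w' i) :
    minCost w I s t x y = minCost w' I s t x y := by
  unfold minCost
  congr 1
  refine Set.image_congr fun γ _ => pathCost_congr fun i h1 h2 => by rw [h i h1 h2]

theorem pathCost_shift (r : ℕ) (k : ℤ) :
    pathCost (fun i x => w (i + r) (x + k)) s t γ =
      pathCost w (s + r) (t + r) fun i => γ (i - r) + k := by
  unfold pathCost
  rw [← Finset.map_add_right_Ioc, Finset.sum_map]
  simp

theorem minCost_shift (r : ℕ) (k : ℤ) (hI : ∀ x, x + k ∈ I ↔ x ∈ I₁) :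
    minCost (fun i x => w (i + r) (x + k)) I₁ s t x y =
      minCost w I (s + r) (t + r) (x + k) (y + k) := by
  unfold minCost
  congr 1
  ext a
  constructor
  · rintro ⟨γ, ⟨h1, h2, h3, h4⟩, rfl⟩
    refine ⟨fun i => γ (i - r) + k, ⟨by simp [h1], by simp [h2], fun i hi hi' => ?_,
      fun i hi hi' => ?_⟩, (pathCost_shift r k).symm⟩
    · have := h3 (i - r) (by omega) (by omega)
      rw [show i - r + 1 = i + 1 - r by omega] at this
      simpa using this
    · exact (hI _).2 (h4 _ (by omega) (by omega))
  · rintro ⟨γ, ⟨h1, h2, h3, h4⟩, rfl⟩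
    refine ⟨fun i => γ (i + r) - k, ⟨by simp [h1], by simp [h2], fun i hi hi' => ?_,
      fun i hi hi' => ?_⟩, ?_⟩
    · have := h3 (i + r) (by omega) (by omega)
      rw [show i + r + 1 = i + 1 + r by omega] at this
      simpa using this
    · rw [← hI]
      simpa using h4 (i + r) (by omega) (by omega)
    · rw [pathCost_shift]
      exact pathCost_congr fun i hi hi' => by
        rw [Nat.sub_add_cancel (by omega), sub_add_cancel]

theorem pathCost_le_pathCost_add (j : ℕ) (hD : ∀ x, w j x ≤ w' j x + D)
    (h : ∀ i ∈ Finset.Ioc s t, i ≠ j → w i = w' i) :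
    pathCost w s t γ ≤ pathCost w' s t γ + if j ∈ Finset.Ioc s t then D else 0 := by
  unfold pathCost
  rw [← Finset.sum_ite_eq (Finset.Ioc s t) j fun _ => D, ← Finset.sum_add_distrib]
  refine Finset.sum_le_sum fun i hi' => ?_
  by_cases hi : i = j
  · subst hi; simpa using hD _
  · simp [h i hi' hi, Ne.symm hi]

theorem minCost_le_minCost_add (hw : ∀ i x, 0 ≤ w i x) (j : ℕ)
    (hD : ∀ x, w j x ≤ w' j x + D) (h : ∀ i ∈ Finset.Ioc s t, i ≠ j → w i = w' i)
    (hγ : IsPath I s t x y γ) :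
    minCost w I s t x y ≤ minCost w' I s t x y + if j ∈ Finset.Ioc s t then D else 0 := by
  rw [← sub_le_iff_le_add]
  refine le_minCost hγ fun γ' hγ' => ?_
  rw [sub_le_iff_le_add]
  exact (minCost_le hw hγ').trans (pathCost_le_pathCost_add j hD h)

theorem isPath_univ (h : |y - x| ≤ (t : ℤ) - s) :
    ∃ γ, IsPath Set.univ s t x y γ := by
  refine ⟨fun i => x + max (-((i : ℤ) - s)) (min ((i : ℤ) - s) (y - x)), ?_, ?_, fun i _ _ => ?_,
    fun _ _ _ => trivial⟩
  · simp
  · have := abs_le.1 h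
    change x + max (-((t : ℤ) - s)) (min ((t : ℤ) - s) (y - x)) = y
    omega
  · rw [abs_le]
    push_cast
    constructor <;> omega

theorem isPath_Icc {a b : ℤ} (hab : a ≤ b) (h : b - a ≤ (t : ℤ) - s) :
    ∃ γ, IsPath (Set.Icc a b) s t a b γ := by
  refine ⟨fun i => a + min ((i : ℤ) - s) (b - a), ?_, ?_, fun i _ _ => ?_, fun i _ _ => ?_⟩
  · simp [hab]
  · change a + min ((t : ℤ) - s) (b - a) = b
    omega
  · rw [abs_le]
    push_cast
    constructor <;> omega
  · change a ≤ a + min ((i : ℤ) - s) (b - a) ∧ a + min ((i : ℤ) - s) (b - a) ≤ b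
    constructor <;> omega

/-- The first time at which a path reaches a level above its starting point. -/
theorem IsPath.exists_first_hit (h : IsPath I s t x y γ) (hst : s ≤ t) {m : ℤ} (hx : x ≤ m)
    (hy : m ≤ y) : ∃ τ, s ≤ τ ∧ τ ≤ t ∧ γ τ = m ∧ ∀ i, s ≤ i → i ≤ τ → γ i ≤ m := by
  classical
  have hex : ∃ i, s ≤ i ∧ m ≤ γ i := ⟨t, hst, by rw [h.2.1]; exact hy⟩
  have h1 := Nat.find_spec hex
  have h2 : ∀ i, s ≤ i → i < Nat.find hex → γ i < m := fun i hi hi' => by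
    have := Nat.find_min hex hi'
    simp only [not_and, not_le] at this
    exact this hi
  have ht : Nat.find hex ≤ t := Nat.find_min' hex ⟨hst, by rw [h.2.1]; exact hy⟩
  have hm : γ (Nat.find hex) = m := by
    refine le_antisymm ?_ h1.2
    rcases h1.1.eq_or_lt with h3 | h3
    · rw [← h3, h.1]; exact hx
    · have h4 := h2 (Nat.find hex - 1) (by omega) (by omega)
      have h5 := abs_le.1 (h.2.2.1 (Nat.find hex - 1) (by omega) (by omega))
      rw [Nat.sub_add_cancel (by omega)] at h5
      omega
  refine ⟨Nat.find hex, h1.1, ht, hm, fun i hi hi' => ?_⟩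
  rcases hi'.eq_or_lt with h3 | h3
  · rw [h3, hm]
  · exact (h2 i hi h3).le

/-- The last time at which a path leaves a level below its end point. -/
theorem IsPath.exists_last_exit (h : IsPath I s t x y γ) (hst : s ≤ t) {m : ℤ} (hx : x ≤ m)
    (hy : m ≤ y) : ∃ τ, s ≤ τ ∧ τ ≤ t ∧ γ τ = m ∧ ∀ i, τ ≤ i → i ≤ t → m ≤ γ i := by
  -- Reversing time and reflecting space turns the last exit into a first hit.
  have hrev : IsPath Set.univ 0 (t - s) (-y) (-x) fun i => -γ (t - i) := by
    refine ⟨by simp [h.2.1], ?_, fun i _ hi => ?_, fun _ _ _ => trivial⟩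
    · change -γ (t - (t - s)) = -x
      rw [Nat.sub_sub_self hst, h.1]
    · have := h.2.2.1 (t - (i + 1)) (by omega) (by omega)
      rw [show t - (i + 1) + 1 = t - i by omega] at this
      rw [show -γ (t - (i + 1)) - -γ (t - i) = γ (t - i) - γ (t - (i + 1)) by ring]
      exact this
  obtain ⟨τ, -, h2, h3, h4⟩ := hrev.exists_first_hit (Nat.zero_le _) (neg_le_neg hy) (neg_le_neg hx)
  refine ⟨t - τ, by omega, by omega, by simpa using h3, fun i hi hi' => ?_⟩
  have := h4 (t - i) (Nat.zero_le _) (by omega)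
  rw [Nat.sub_sub_self hi'] at this
  omega

end Paths

/-! ### Concentration for functions of independent signs -/

/-- The mean of a function of independent uniform signs. -/
noncomputable def signMean {ι : Type*} [Fintype ι] [DecidableEq ι] (f : (ι → ℤˣ) → ℝ) : ℝ :=
  (∑ σ, f σ) / 2 ^ Fintype.card ι

section SignMean

variable {ι κ : Type*} [Fintype ι] [DecidableEq ι] [Fintype κ] [DecidableEq κ]
  {f g : (ι → ℤˣ) → ℝ}

theorem card_signs : (Fintype.card (ι → ℤˣ) : ℝ) = 2 ^ Fintype.card ι := by
  simp [Fintype.card_units_int]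

theorem signMean_const (a : ℝ) : signMean (fun _ : ι → ℤˣ => a) = a := by
  unfold signMean
  rw [Finset.sum_const, Finset.card_univ, nsmul_eq_mul, card_signs]
  field_simp

theorem signMean_add (f g : (ι → ℤˣ) → ℝ) :
    signMean (fun σ => f σ + g σ) = signMean f + signMean g := by
  simp only [signMean, Finset.sum_add_distrib, add_div]

theorem signMean_sub (f g : (ι → ℤˣ) → ℝ) :
    signMean (fun σ => f σ - g σ) = signMean f - signMean g := by
  simp only [signMean, Finset.sum_sub_distrib, sub_div]

theorem signMean_const_mul (a : ℝ) (f : (ι → ℤˣ) → ℝ) :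
    signMean (fun σ => a * f σ) = a * signMean f := by
  simp only [signMean, ← Finset.mul_sum, mul_div_assoc]

theorem signMean_sum {α : Type*} (s : Finset α) (f : α → (ι → ℤˣ) → ℝ) :
    signMean (fun σ => ∑ k ∈ s, f k σ) = ∑ k ∈ s, signMean (f k) := by
  simp only [signMean]
  rw [Finset.sum_comm, Finset.sum_div]

theorem signMean_mono (h : ∀ σ, f σ ≤ g σ) : signMean f ≤ signMean g :=
  div_le_div_of_nonneg_right (Finset.sum_le_sum fun σ _ => h σ) (by positivity)

theorem signMean_equiv (e : (ι → ℤˣ) ≃ (κ → ℤˣ)) (f : (κ → ℤˣ) → ℝ) :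
    signMean (fun σ => f (e σ)) = signMean f := by
  unfold signMean
  rw [Equiv.sum_comp e f, ← card_signs, ← card_signs, Fintype.card_congr e]

theorem signMean_succ {n : ℕ} (f : (Fin (n + 1) → ℤˣ) → ℝ) :
    signMean f =
      signMean fun σ => (f (Fin.cons 1 σ : Fin (n + 1) → ℤˣ) +
        f (Fin.cons (-1) σ : Fin (n + 1) → ℤˣ)) / 2 := by
  unfold signMean
  rw [← Equiv.sum_comp (Fin.consEquiv fun _ => ℤˣ), Fintype.sum_prod_type_right]
  simp only [Fintype.card_fin, pow_succ]
  rw [← Finset.sum_div, div_div, mul_comm (2 : ℝ)]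
  congr 1
  refine Finset.sum_congr rfl fun σ _ => ?_
  rw [show (Finset.univ : Finset ℤˣ) = {1, -1} from rfl, Finset.sum_pair (by decide)]
  rfl

/-- This is the Azuma–Hoeffding argument: averaging over the first sign keeps the differences in the
other coordinates bounded. The first coordinate contributes `cosh y ≤ exp (y ^ 2 / 2)` with `|y| ≤
|r| D 0 / 2`, whence the constant `1/8`. -/
theorem signMean_exp_le_fin {n : ℕ} (f : (Fin n → ℤˣ) → ℝ) (D : Fin n → ℝ)
    (hD : ∀ σ i, |f (Function.update σ i (-σ i)) - f σ| ≤ D i) (r : ℝ) :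
    signMean (fun σ => Real.exp (r * (signMean f - f σ))) ≤
      Real.exp (r ^ 2 / 8 * ∑ i, D i ^ 2) := by
  induction n with
  | zero =>
    refine le_of_eq ?_
    have h : ∀ σ, signMean f = f σ := fun σ => by
      rw [Subsingleton.elim σ default]
      rw [signMean, Fintype.sum_subsingleton _ default]
      simp
    simp [← h, signMean_const]
  | succ n ih =>
    set f₁ : (Fin n → ℤˣ) → ℝ := fun σ => f (Fin.cons 1 σ : Fin (n + 1) → ℤˣ) with hf₁
    set f₂ : (Fin n → ℤˣ) → ℝ := fun σ => f (Fin.cons (-1) σ : Fin (n + 1) → ℤˣ) with hf₂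
    have key := ih (fun σ => (f₁ σ + f₂ σ) / 2) (fun i => D i.succ) (fun σ i => by
      have h1 := hD (Fin.cons 1 σ) i.succ
      have h2 := hD (Fin.cons (-1) σ) i.succ
      rw [Fin.cons_succ, ← Fin.cons_update] at h1 h2
      have h1' := abs_le.1 h1
      have h2' := abs_le.1 h2
      simp only [hf₁, hf₂]
      rw [abs_le]
      constructor <;> linarith)
    have hm : signMean (fun σ => (f₁ σ + f₂ σ) / 2) = signMean f := (signMean_succ f).symm
    rw [hm] at key
    rw [signMean_succ, Fin.sum_univ_succ, mul_add, Real.exp_add]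
    refine le_trans ?_ (mul_le_mul_of_nonneg_left key (Real.exp_pos _).le)
    rw [← signMean_const_mul]
    refine signMean_mono fun σ => ?_
    have hd : |r * ((f₂ σ - f₁ σ) / 2)| ≤ |r| * (D 0 / 2) := by
      have h1 := hD (Fin.cons 1 σ) 0
      rw [Fin.cons_zero, Fin.update_cons_zero] at h1
      rw [abs_mul, abs_div, abs_two]
      have : |f₂ σ - f₁ σ| ≤ D 0 := h1
      gcongr
    have hcosh : Real.cosh (r * ((f₂ σ - f₁ σ) / 2)) ≤ Real.exp (r ^ 2 / 8 * D 0 ^ 2) := by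
      refine (Real.cosh_le_exp_half_sq _).trans (Real.exp_le_exp.2 ?_)
      have := pow_le_pow_left₀ (abs_nonneg _) hd 2
      rw [sq_abs, mul_pow |r|, sq_abs] at this
      nlinarith
    rw [mul_comm (Real.exp _)]
    refine le_trans (le_of_eq ?_) (mul_le_mul_of_nonneg_left hcosh (Real.exp_pos _).le)
    rw [Real.cosh_eq, mul_div_assoc', mul_add, ← Real.exp_add, ← Real.exp_add]
    congr 2
    · congr 1; simp only [hf₁]; ring
    · congr 1; simp only [hf₂]; ring

/-- A function of independent signs with bounded differences is sub-Gaussian. -/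
theorem signMean_exp_le (f : (ι → ℤˣ) → ℝ) (D : ι → ℝ)
    (hD : ∀ σ i, |f (Function.update σ i (-σ i)) - f σ| ≤ D i) (r : ℝ) :
    signMean (fun σ => Real.exp (r * (signMean f - f σ))) ≤
      Real.exp (r ^ 2 / 8 * ∑ i, D i ^ 2) := by
  let e := Fintype.equivFin ι
  let E : (Fin (Fintype.card ι) → ℤˣ) ≃ (ι → ℤˣ) := e.symm.arrowCongr (Equiv.refl _)
  have hE : ∀ σ i, E σ i = σ (e i) := fun _ _ => rfl
  have key := signMean_exp_le_fin (fun σ => f (E σ)) (fun i => D (e.symm i)) (fun σ i => by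
    have h := hD (E σ) (e.symm i)
    rw [hE, Equiv.apply_symm_apply] at h
    convert h using 4
    ext j
    rw [hE]
    by_cases hj : j = e.symm i
    · subst hj; simp
    · rw [Function.update_of_ne hj, Function.update_of_ne (by rintro rfl; simp at hj), hE]) r
  rw [signMean_equiv E f] at key
  rw [← signMean_equiv E, ← Equiv.sum_comp e.symm]
  exact key

/-- If `X` is bounded below by the pointwise minimum of a finite family of functions of independent
signs with bounded differences, then its mean is almost at least the smallest of their means. -/
theorem exists_signMean_le_add {α : Type*} {K : Finset α} (hK : K.Nonempty)
    (X : (ι → ℤˣ) → ℝ) (Y : α → (ι → ℤˣ) → ℝ) (hX : ∀ σ, ∃ k ∈ K, Y k σ ≤ X σ) (V : ℝ)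
    (D : α → ι → ℝ) (hV : ∀ k ∈ K, ∑ i, D k i ^ 2 ≤ V)
    (hD : ∀ k ∈ K, ∀ σ i, |Y k (Function.update σ i (-σ i)) - Y k σ| ≤ D k i)
    {r : ℝ} (hr : 0 < r) :
    ∃ k ∈ K, signMean (Y k) ≤ signMean X + (Real.log K.card / r + r * V / 8) := by
  obtain ⟨k₀, hk₀, hmin⟩ := K.exists_min_image (fun k => signMean (Y k)) hK
  refine ⟨k₀, hk₀, ?_⟩
  -- Jensen's inequality for the exponential, from its tangent line at the mean.
  have hjensen : Real.exp (r * (signMean (Y k₀) - signMean X)) ≤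
      signMean fun σ => Real.exp (r * (signMean (Y k₀) - X σ)) := by
    have h1 : ∀ σ, Real.exp (r * (signMean (Y k₀) - signMean X)) *
        (1 + r * (signMean X - X σ)) ≤ Real.exp (r * (signMean (Y k₀) - X σ)) := fun σ => by
      rw [show r * (signMean (Y k₀) - X σ) =
        r * (signMean (Y k₀) - signMean X) + r * (signMean X - X σ) by ring, Real.exp_add]
      refine mul_le_mul_of_nonneg_left ?_ (Real.exp_pos _).le
      linarith [Real.add_one_le_exp (r * (signMean X - X σ))]
    refine le_trans (le_of_eq ?_) (signMean_mono h1)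
    rw [signMean_const_mul, signMean_add, signMean_const_mul, signMean_sub, signMean_const,
      signMean_const]
    ring
  -- Union bound: the exponential at the minimum is at most the sum over `K`, and `k₀` has the
  -- smallest mean.
  have hsum : (signMean fun σ => Real.exp (r * (signMean (Y k₀) - X σ))) ≤
      K.card * Real.exp (r ^ 2 / 8 * V) := by
    calc (signMean fun σ => Real.exp (r * (signMean (Y k₀) - X σ)))
        ≤ signMean fun σ => ∑ k ∈ K, Real.exp (r * (signMean (Y k) - Y k σ)) := by
          refine signMean_mono fun σ => ?_
          obtain ⟨k, hk, h⟩ := hX σ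
          refine le_trans (Real.exp_le_exp.2 ?_) (Finset.single_le_sum
            (f := fun k => Real.exp (r * (signMean (Y k) - Y k σ)))
            (fun k _ => (Real.exp_pos _).le) hk)
          have := hmin k hk
          gcongr
      _ = ∑ k ∈ K, signMean fun σ => Real.exp (r * (signMean (Y k) - Y k σ)) := signMean_sum _ _
      _ ≤ ∑ k ∈ K, Real.exp (r ^ 2 / 8 * V) := by
          refine Finset.sum_le_sum fun k hk => (signMean_exp_le _ _ (hD k hk) r).trans ?_
          have := hV k hk
          gcongr
      _ = K.card * Real.exp (r ^ 2 / 8 * V) := by rw [Finset.sum_const, nsmul_eq_mul]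
  have hcard : (0 : ℝ) < K.card := by exact_mod_cast hK.card_pos
  have h := hjensen.trans hsum
  rw [← Real.exp_log hcard, ← Real.exp_add, Real.exp_le_exp] at h
  have h2 : signMean (Y k₀) - signMean X ≤ (Real.log K.card + r ^ 2 / 8 * V) / r := by
    rw [le_div_iff₀ hr]; linarith
  rw [add_div] at h2
  have h3 : r ^ 2 / 8 * V / r = r * V / 8 := by field_simp
  linarith

end SignMean

/-! ### Truncated weights and periodic signs -/

/-- The cost `c + b(i) f(x)` of being at `x` at time `i`, truncated to `[0, 2c]`. -/
noncomputable def weight (c : ℝ) (b f : ℤ → ℝ) (i : ℕ) (x : ℤ) : ℝ :=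
  max 0 (min (2 * c) (c + b i * f x))

section Weight

variable {c : ℝ} {b f : ℤ → ℝ}

theorem weight_nonneg (i : ℕ) (x : ℤ) : 0 ≤ weight c b f i x := le_max_left _ _

theorem weight_le (hc : 0 ≤ c) (i : ℕ) (x : ℤ) : weight c b f i x ≤ 2 * c :=
  max_le (by linarith) (min_le_left _ _)

/-- The truncation is inactive for almost every environment. It is there so that the bounds `0` and
`2c` hold for all environments. -/
theorem weight_eq {i : ℕ} {x : ℤ} (h : |b i * f x| ≤ c) : weight c b f i x = c + b i * f x := by
  have := abs_le.1 h
  rw [weight, min_eq_right (by linarith), max_eq_right (by linarith)]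

end Weight

/-- A periodic sequence of signs. -/
def signEnv {N : ℕ} (σ : ZMod N → ℤˣ) (i : ℤ) : ℝ := ((σ (i : ZMod N) : ℤ) : ℝ)

theorem abs_signEnv {N : ℕ} (σ : ZMod N → ℤˣ) (i : ℤ) : |signEnv σ i| = 1 := by
  rcases Int.units_eq_one_or (σ (i : ZMod N)) with h | h <;> simp [signEnv, h]

/-- `Y` depends only on the signs at times in `(s, t]`, and each of them affects it by at most
`L`. -/
def SignLip {N : ℕ} (Y : (ZMod N → ℤˣ) → ℝ) (s t : ℕ) (L : ℝ) : Prop :=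
  ∀ j σ σ', (∀ i ∈ Finset.Ioc s t, i ≠ j → σ (i : ZMod N) = σ' i) →
    Y σ ≤ Y σ' + if j ∈ Finset.Ioc s t then L else 0

section SignLip

variable {N : ℕ} {Y Y₁ Y₂ : (ZMod N → ℤˣ) → ℝ} {s t u : ℕ} {L : ℝ}

theorem SignLip.add (h₁ : SignLip Y₁ s t L) (h₂ : SignLip Y₂ t u L) (hst : s ≤ t) (htu : t ≤ u) :
    SignLip (fun σ => Y₁ σ + Y₂ σ) s u L := by
  intro j σ σ' h
  have h3 := h₁ j σ σ' fun i hi => h i (by simp only [Finset.mem_Ioc] at hi ⊢; omega)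
  have h4 := h₂ j σ σ' fun i hi => h i (by simp only [Finset.mem_Ioc] at hi ⊢; omega)
  simp only [Finset.mem_Ioc] at h3 h4 ⊢
  split_ifs at h3 h4 ⊢ <;> first | omega | linarith

theorem SignLip.const_mul {e : ℝ} (h : SignLip Y s t 1) (he : 0 ≤ e) (heL : e ≤ L) :
    SignLip (fun σ => e * Y σ) s t L := by
  intro j σ σ' hσ
  have h1 := mul_le_mul_of_nonneg_left (h j σ σ' hσ) he
  simp only
  split_ifs at h1 ⊢ <;> linarith

/-- Since `t ≤ N`, the times `1, …, t` are distinct modulo `N`, so each coordinate of `σ` is the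
sign at no more than one of them, and at most `t` coordinates matter. -/
theorem SignLip.exists_bound [NeZero N] (hY : SignLip Y 0 t L) (ht : t ≤ N) :
    ∃ D : ZMod N → ℝ, ∑ i, D i ^ 2 ≤ t * L ^ 2 ∧
      ∀ σ i, |Y (Function.update σ i (-σ i)) - Y σ| ≤ D i := by
  classical
  refine ⟨fun i => if i ∈ (Finset.Ioc 0 t).image (fun j : ℕ => (j : ZMod N)) then L else 0, ?_,
    fun σ i => ?_⟩
  · simp only [ite_pow, ne_eq, OfNat.ofNat_ne_zero, not_false_eq_true, zero_pow]
    rw [Finset.sum_ite_mem, Finset.univ_inter, Finset.sum_const, nsmul_eq_mul]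
    gcongr
    exact Finset.card_image_le.trans (by simp)
  · have key : ∀ σ σ' : ZMod N → ℤˣ, (∀ k, k ≠ i → σ k = σ' k) → Y σ ≤ Y σ' +
        if i ∈ (Finset.Ioc 0 t).image (fun j : ℕ => (j : ZMod N)) then L else 0 := by
      intro σ σ' h
      by_cases hi : i ∈ (Finset.Ioc 0 t).image (fun j : ℕ => (j : ZMod N))
      · obtain ⟨j, hj, rfl⟩ := Finset.mem_image.1 hi
        rw [if_pos hi]
        have h2 := hY j σ σ' fun k hk hkj => h _ fun hk' => hkj (by
          have h3 := (Nat.modEq_iff_dvd.1 ((ZMod.natCast_eq_natCast_iff k j N).1 hk'))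
          simp only [Finset.mem_Ioc] at hj hk
          have h4 := Int.eq_zero_of_abs_lt_dvd h3 (by rw [abs_lt]; constructor <;> omega)
          omega)
        rwa [if_pos hj] at h2
      · rw [if_neg hi]
        have h1 := hY 0 σ σ' fun k hk _ => h _ fun hk' => hi (Finset.mem_image.2 ⟨k, hk, hk'⟩)
        simpa using h1
    rw [abs_sub_le_iff]
    constructor
    · have := key (Function.update σ i (-σ i)) σ fun k hk => Function.update_of_ne hk _ _
      linarith
    · have := key σ (Function.update σ i (-σ i)) fun k hk => (Function.update_of_ne hk _ _).symm
      linarith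

end SignLip

section SignMean

variable {ι : Type*} [Fintype ι] [DecidableEq ι]

/-- Flipping the sign at `i` preserves the mean and negates the product. -/
theorem signMean_mul_eq_zero {i j : ι} (hij : i ≠ j) :
    signMean (fun σ : ι → ℤˣ => ((σ i : ℤ) : ℝ) * ((σ j : ℤ) : ℝ)) = 0 := by
  have h := signMean_equiv (Equiv.mulLeft (Pi.mulSingle i (-1) : ι → ℤˣ))
    fun σ : ι → ℤˣ => ((σ i : ℤ) : ℝ) * ((σ j : ℤ) : ℝ)
  have h2 : signMean (fun σ : ι → ℤˣ => (-1) * (((σ i : ℤ) : ℝ) * ((σ j : ℤ) : ℝ))) =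
      signMean fun σ : ι → ℤˣ => ((σ i : ℤ) : ℝ) * ((σ j : ℤ) : ℝ) := by
    rw [← h]
    congr 1
    ext σ
    simp [Pi.mulSingle_eq_of_ne hij.symm]
  rw [signMean_const_mul] at h2
  linarith

end SignMean

/-! ### The price of waiting -/

/-- A quarter of the number of sign changes, counted twice, during `(s, t]`. -/
noncomputable def signChanges (b : ℤ → ℝ) (s t : ℕ) : ℝ :=
  ∑ i ∈ Finset.Ico (s + 1) t, (1 - b i * b (i + 1)) / 4

section Changes

variable {N : ℕ} {c e : ℝ} {f : ℤ → ℝ} {s t : ℕ}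

theorem signMean_signChanges [NeZero N] (hN : 1 < N) (s t : ℕ) :
    ((t : ℝ) - s - 1) / 4 ≤ signMean fun σ : ZMod N → ℤˣ => signChanges (signEnv σ) s t := by
  have h : ∀ i : ℕ, signMean (fun σ : ZMod N → ℤˣ => (1 - signEnv σ i * signEnv σ (i + 1)) / 4) =
      1 / 4 := fun i => by
    have h1 : ((i : ℤ) : ZMod N) ≠ ((i + 1 : ℤ) : ZMod N) := by
      have : Fact (1 < N) := ⟨hN⟩
      push_cast
      simp
    have h2 := signMean_mul_eq_zero h1
    have h3 : ∀ σ : ZMod N → ℤˣ, (1 - signEnv σ i * signEnv σ (i + 1)) / 4 =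
        1 / 4 - 1 / 4 * (signEnv σ i * signEnv σ (i + 1)) := fun σ => by ring
    simp only [h3]
    rw [signMean_sub, signMean_const, signMean_const_mul]
    unfold signEnv
    rw [h2]
    ring
  unfold signChanges
  rw [signMean_sum, Finset.sum_congr rfl fun i _ => h i, Finset.sum_const, Nat.card_Ico,
    nsmul_eq_mul]
  have : (t : ℝ) ≤ (t - (s + 1) : ℕ) + (s + 1) := by
    exact_mod_cast (by omega : t ≤ (t - (s + 1)) + (s + 1))
  linarith

/-- One sign enters at most two consecutive summands, each taking the values `0` and `1/2`. -/
theorem signLip_signChanges :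
    SignLip (N := N) (fun σ => signChanges (signEnv σ) s t) s t 1 := by
  intro j σ σ' h
  simp only [signChanges]
  have hb : ∀ (σ : ZMod N → ℤˣ) (i : ℤ), signEnv σ i = 1 ∨ signEnv σ i = -1 := fun σ i => by
    rcases Int.units_eq_one_or (σ (i : ZMod N)) with h | h <;> simp [signEnv, h]
  have hagree : ∀ i ∈ Finset.Ioc s t, i ≠ j → signEnv σ i = signEnv σ' i := fun i hi hij => by
    have := h i hi hij
    simp [signEnv, this]
  have h1 : ∀ i ∈ Finset.Ico (s + 1) t, (1 - signEnv σ i * signEnv σ (i + 1)) / 4 ≤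
      (1 - signEnv σ' i * signEnv σ' (i + 1)) / 4 +
        ((if j = i then 1 / 2 else 0) + if j = i + 1 then 1 / 2 else 0) := by
    intro i hi
    simp only [Finset.mem_Ico] at hi
    have h2 := hagree i (by simp; omega)
    have h3 := hagree (i + 1) (by simp; omega)
    push_cast at h3
    by_cases h4 : j = i
    · rw [if_pos h4]
      rcases hb σ i with h5 | h5 <;> rcases hb σ (i + 1) with h6 | h6 <;>
        rcases hb σ' i with h7 | h7 <;> rcases hb σ' (i + 1) with h8 | h8 <;>
        rw [h5, h6, h7, h8] <;> split_ifs <;> norm_num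
    · by_cases h4' : j = i + 1
      · rw [if_pos h4', if_neg h4]
        rcases hb σ i with h5 | h5 <;> rcases hb σ (i + 1) with h6 | h6 <;>
          rcases hb σ' i with h7 | h7 <;> rcases hb σ' (i + 1) with h8 | h8 <;>
          rw [h5, h6, h7, h8] <;> norm_num
      · rw [h2 (Ne.symm h4), h3 (Ne.symm h4'), if_neg h4, if_neg h4']
        simp
  refine (Finset.sum_le_sum h1).trans ?_
  rw [Finset.sum_add_distrib, Finset.sum_add_distrib, Finset.sum_ite_eq]
  refine add_le_add_right ?_ _
  have h5 : ∑ i ∈ Finset.Ico (s + 1) t, (if j = i + 1 then (1 / 2 : ℝ) else 0) =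
      if j ∈ Finset.Ico (s + 2) (t + 1) then 1 / 2 else 0 := by
    rw [← Finset.sum_ite_eq (Finset.Ico (s + 2) (t + 1)) j fun _ => (1 / 2 : ℝ),
      ← Finset.sum_Ico_add' _ (s + 1) t 1]
  rw [h5]
  simp only [Finset.mem_Ico, Finset.mem_Ioc]
  split_ifs <;> first | omega | linarith

/-- A path which waits inside an interval pays whenever the sign changes. -/
theorem mul_signChanges_le_pathCost {a b : ℤ} {x y : ℤ} {γ : ℕ → ℤ} (σ : ZMod N → ℤˣ)
    (hf : ∀ x, |f x| ≤ c) (he : ∀ x, a ≤ x → x < b → e ≤ 2 * c - |f x - f (x + 1)|)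
    (he' : e ≤ 2 * c) (hγ : IsPath (Set.Icc a b) s t x y γ) :
    e * signChanges (signEnv σ) s t ≤ pathCost (weight c (signEnv σ) f) s t γ := by
  set w := weight c (signEnv σ) f with hw
  have hwn : ∀ i x, 0 ≤ w i x := fun i x => weight_nonneg i x
  have hwe : ∀ (i : ℕ) x, w i x = c + signEnv σ i * f x := fun i x => by
    refine weight_eq ?_
    rw [abs_mul, abs_signEnv, one_mul]
    exact hf x
  -- If the sign changes, the two costs add up to `2c ± (f x - f y)`, where `x` and `y` coincide or
  -- span an edge, hence to at least `e`. If it does not, the left side vanishes. Each time lies in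
  -- at most two such pairs, which accounts for the factor `2`.
  have hpair : ∀ i ∈ Finset.Ico (s + 1) t,
      2 * (e * ((1 - signEnv σ i * signEnv σ (i + 1)) / 4)) ≤
        w i (γ i) + w (i + 1) (γ (i + 1)) := by
    intro i hi
    simp only [Finset.mem_Ico] at hi
    have h1 := hγ.2.2.1 i (by omega) hi.2
    have h2 := hγ.2.2.2 i (by omega) hi.2.le
    have h3 := hγ.2.2.2 (i + 1) (by omega) hi.2
    rw [Set.mem_Icc] at h2 h3
    have hsum := add_nonneg (hwn i (γ i)) (hwn (i + 1) (γ (i + 1)))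
    have hedge : e ≤ 2 * c - |f (γ i) - f (γ (i + 1))| := by
      rw [abs_le] at h1
      rcases (by omega : γ (i + 1) = γ i ∨ γ (i + 1) = γ i + 1 ∨ γ i = γ (i + 1) + 1) with
        h | h | h
      · simpa [h] using he'
      · rw [h]; exact he _ h2.1 (by omega)
      · rw [h, abs_sub_comm]; exact he _ h3.1 (by omega)
    have h5 : ∀ i : ℤ, signEnv σ i = 1 ∨ signEnv σ i = -1 := fun i => by
      rcases Int.units_eq_one_or (σ (i : ZMod N)) with h | h <;> simp [signEnv, h]
    have habs := abs_le.1 (le_sub_comm.1 hedge)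
    rw [hwe, hwe] at hsum ⊢
    push_cast at hsum ⊢
    rcases h5 i with h6 | h6 <;> rcases h5 (i + 1) with h7 | h7 <;> rw [h6, h7] at hsum ⊢ <;>
      linarith
  have h6 := Finset.sum_le_sum hpair
  rw [← Finset.mul_sum, ← Finset.mul_sum, Finset.sum_add_distrib] at h6
  have h7 : ∑ i ∈ Finset.Ico (s + 1) t, w i (γ i) ≤ pathCost w s t γ := by
    refine Finset.sum_le_sum_of_subset_of_nonneg (fun i hi => ?_) fun i _ _ => hwn i _
    simp only [Finset.mem_Ico, Finset.mem_Ioc] at hi ⊢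
    omega
  have h8 : ∑ i ∈ Finset.Ico (s + 1) t, w (i + 1) (γ (i + 1)) ≤ pathCost w s t γ := by
    rw [Finset.sum_Ico_add' (fun i => w i (γ i))]
    refine Finset.sum_le_sum_of_subset_of_nonneg (fun i hi => ?_) fun i _ _ => hwn i _
    simp only [Finset.mem_Ico, Finset.mem_Ioc] at hi ⊢
    omega
  unfold signChanges
  linarith

end Changes

/-! ### Mean costs and the splitting of walks -/

/-- The fluctuation term in the comparison of means of minimal costs. -/
noncomputable def fluct (c : ℝ) (t : ℕ) : ℝ :=
  √t * (2 * Real.log (t + 1) + c ^ 2 / 2)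

/-- The mean over the signs of the least cost of a walk from `a` to `b` inside `[a, b]` during a
time `u`. -/
noncomputable def meanCost (N : ℕ) [NeZero N] (c : ℝ) (f : ℤ → ℝ) (a b : ℤ) (u : ℕ) : ℝ :=
  signMean fun σ : ZMod N → ℤˣ => minCost (weight c (signEnv σ) f) (Set.Icc a b) 0 u a b

section MeanCost

variable {N : ℕ} {c e : ℝ} {f : ℤ → ℝ} {s t : ℕ} {I : Set ℤ} {x y : ℤ} {γ : ℕ → ℤ}

theorem signLip_minCost (hc : 0 ≤ c) (hγ : IsPath I s t x y γ) :
    SignLip (N := N) (fun σ => minCost (weight c (signEnv σ) f) I s t x y) s t (2 * c) := by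
  intro j σ σ' h
  refine minCost_le_minCost_add weight_nonneg j (fun x => ?_) (fun i hi hij => ?_) hγ
  · linarith [weight_le (b := signEnv σ) (f := f) hc j x,
      weight_nonneg (c := c) (b := signEnv σ') (f := f) j x]
  · ext x
    have := h i hi hij
    simp [weight, signEnv, this]

/-- This is `exists_signMean_le_add` with `r = 1/√t`, at most `(t + 1) ^ 2` candidates and `V = t
(2c) ^ 2`, which produces the two terms of `fluct`. -/
theorem SignLip.exists_signMean_le [NeZero N] {K : Finset (ℕ × ℕ)} (hK : K.Nonempty)
    (hKt : ∀ k ∈ K, k.1 ≤ t ∧ k.2 ≤ t) (X : (ZMod N → ℤˣ) → ℝ)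
    (Y : ℕ × ℕ → (ZMod N → ℤˣ) → ℝ) (hX : ∀ σ, ∃ k ∈ K, Y k σ ≤ X σ)
    (hY : ∀ k ∈ K, SignLip (Y k) 0 t (2 * c)) (ht : 0 < t) (htN : t ≤ N) :
    ∃ k ∈ K, signMean (Y k) ≤ signMean X + fluct c t := by
  have hD : ∀ k, ∃ D : ZMod N → ℝ, k ∈ K → ∑ i, D i ^ 2 ≤ t * (2 * c) ^ 2 ∧
      ∀ σ i, |Y k (Function.update σ i (-σ i)) - Y k σ| ≤ D i := fun k => by
    by_cases hk : k ∈ K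
    · obtain ⟨D, hD⟩ := (hY k hk).exists_bound htN
      exact ⟨D, fun _ => hD⟩
    · exact ⟨0, fun h => absurd h hk⟩
  choose D hD using hD
  have ht' : (0 : ℝ) < √t := Real.sqrt_pos.2 (by exact_mod_cast ht)
  obtain ⟨k, hk, h⟩ := exists_signMean_le_add hK X Y hX (t * (2 * c) ^ 2) D
    (fun k hk => (hD k hk).1) (fun k hk => (hD k hk).2) (inv_pos.2 ht')
  refine ⟨k, hk, h.trans (add_le_add_right ?_ _)⟩
  have hcard : (K.card : ℝ) ≤ ((t : ℝ) + 1) ^ 2 := by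
    have : K ⊆ Finset.range (t + 1) ×ˢ Finset.range (t + 1) := fun k hk => by
      have := hKt k hk
      simp only [Finset.mem_product, Finset.mem_range]
      omega
    have := Finset.card_le_card this
    rw [Finset.card_product, Finset.card_range, ← sq] at this
    exact_mod_cast this
  have hlog : Real.log K.card ≤ 2 * Real.log (t + 1) := by
    have h1 : (0 : ℝ) < K.card := by exact_mod_cast hK.card_pos
    refine (Real.log_le_log h1 hcard).trans (le_of_eq ?_)
    rw [Real.log_pow]
    norm_num
  have h2 : (√t)⁻¹ * (t * (2 * c) ^ 2) / 8 = √t * (c ^ 2 / 2) := by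
    have : (t : ℝ) = √t * √t := (Real.mul_self_sqrt (by positivity)).symm
    field_simp
    nlinarith
  rw [h2, div_inv_eq_mul, fluct, mul_add, mul_comm]
  gcongr

variable [NeZero N]

/-- Periodic signs make a time shift a rotation of `ZMod N`, which preserves the mean. -/
theorem meanCost_shift (a b : ℤ) (s u : ℕ) :
    signMean (fun σ : ZMod N → ℤˣ =>
      minCost (weight c (signEnv σ) f) (Set.Icc a b) s (s + u) a b) = meanCost N c f a b u := by
  rw [meanCost, ← signMean_equiv (Equiv.arrowCongr (Equiv.addRight (s : ZMod N))
    (Equiv.refl ℤˣ))]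
  congr 1
  ext σ
  have h := minCost_shift (w := weight c (signEnv ((Equiv.arrowCongr (Equiv.addRight (s : ZMod N))
    (Equiv.refl ℤˣ)) σ)) f) (I := Set.Icc a b) (I₁ := Set.Icc a b)
    (s := 0) (t := u) (x := a) (y := b) s 0 (by simp)
  simp only [add_zero, zero_add] at h
  rw [add_comm s u, ← h]
  congr 1
  ext i x
  simp [weight, signEnv]

theorem meanCost_le (hc : 0 ≤ c) {a b : ℤ} (hab : a ≤ b) {u : ℕ} (hu : b - a ≤ u) :
    meanCost N c f a b u ≤ 2 * c * u := by
  obtain ⟨γ, hγ⟩ := isPath_Icc (s := 0) (t := u) hab (by simpa using hu)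
  rw [← signMean_const (ι := ZMod N) (2 * c * u)]
  refine signMean_mono fun σ => ?_
  simpa using minCost_le_mul weight_nonneg (weight_le hc) hγ (Nat.zero_le u)

theorem meanCost_add_le {a m b : ℤ} (ham : a ≤ m) (hmb : m ≤ b) {u v : ℕ} (hu : m - a ≤ u)
    (hv : b - m ≤ v) :
    meanCost N c f a b (u + v) ≤ meanCost N c f a m u + meanCost N c f m b v := by
  rw [← meanCost_shift m b u v, meanCost, meanCost, ← signMean_add]
  refine signMean_mono fun σ => ?_
  obtain ⟨γ, hγ⟩ := isPath_Icc (s := 0) (t := u) ham (by simpa using hu)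
  obtain ⟨γ', hγ'⟩ := isPath_Icc (s := u) (t := u + v) hmb (by push_cast; linarith)
  exact minCost_triangle weight_nonneg (Nat.zero_le _) (Nat.le_add_right _ _) hγ hγ'
    (Set.Icc_subset_Icc_right hmb) (Set.Icc_subset_Icc_left ham)

/-- Splitting a walk at the first and the last visit to an intermediate point. -/
theorem exists_meanCost_split (hN : 1 < N) (hc : 0 ≤ c) (hf : ∀ x, |f x| ≤ c) {a m b : ℤ}
    (ham : a ≤ m) (hmb : m ≤ b) (he0 : 0 ≤ e)
    (he : ∀ x, a ≤ x → x < b → e ≤ 2 * c - |f x - f (x + 1)|) (he' : e ≤ 2 * c)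
    (ht : 0 < t) (htN : t ≤ N) (hab : b - a ≤ t) :
    ∃ u v : ℕ, u + v ≤ t ∧ m - a ≤ u ∧ b - m ≤ v ∧
      meanCost N c f a m u + meanCost N c f m b v + e * (((t : ℝ) - u - v - 1) / 4) ≤
        meanCost N c f a b t + fluct c t := by
  classical
  -- The possible pairs of first and last visit to `m`, each leaving enough time for the two
  -- crossings.
  set K : Finset (ℕ × ℕ) := (Finset.range (t + 1) ×ˢ Finset.range (t + 1)).filter fun k =>
    k.1 ≤ k.2 ∧ m - a ≤ k.1 ∧ b - m ≤ (t : ℤ) - k.2 with hKdef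
  have hKmem : ∀ k : ℕ × ℕ, k ∈ K ↔ k.1 ≤ k.2 ∧ k.2 ≤ t ∧ m - a ≤ k.1 ∧ b - m ≤ (t : ℤ) - k.2 := by
    intro k
    simp only [hKdef, Finset.mem_filter, Finset.mem_product, Finset.mem_range]
    omega
  have hKne : K.Nonempty :=
    ⟨((m - a).toNat, (m - a).toNat), by rw [hKmem]; simp only; omega⟩
  set Y : ℕ × ℕ → (ZMod N → ℤˣ) → ℝ := fun k σ =>
    minCost (weight c (signEnv σ) f) (Set.Icc a m) 0 k.1 a m +
      e * signChanges (signEnv σ) k.1 k.2 +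
      minCost (weight c (signEnv σ) f) (Set.Icc m b) k.2 t m b with hY
  have hX : ∀ σ, ∃ k ∈ K, Y k σ ≤ minCost (weight c (signEnv σ) f) (Set.Icc a b) 0 t a b := by
    intro σ
    by_contra! hcon
    obtain ⟨γ₀, hγ₀⟩ := isPath_Icc (s := 0) (t := t) (ham.trans hmb) (by simpa using hab)
    have hlt : minCost (weight c (signEnv σ) f) (Set.Icc a b) 0 t a b < 
        K.inf' hKne fun k => Y k σ := by
      rw [Finset.lt_inf'_iff]
      exact hcon
    -- It suffices to bound the cost of every walk below by the minimum of `Y` over `K`, so no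
    -- optimal walk has to be chosen. Here `p` is the first hit of `m` and `q` the last exit from
    -- it.
    refine absurd (le_minCost hγ₀ fun γ hγ => ?_) (not_le.2 hlt)
    obtain ⟨p, -, hp2, hp3, hp4⟩ := hγ.exists_first_hit (Nat.zero_le _) ham hmb
    obtain ⟨q, hq1, hq2, hq3, hq4⟩ := (hγ.restrict (Nat.zero_le p) le_rfl
      fun i hi hi' => hγ.2.2.2 i (by omega) hi').exists_last_exit hp2 hp3.le
      (by rw [hγ.2.1]; exact hmb)
    have hγ1 : IsPath (Set.Icc a m) 0 p a m γ := by
      have := hγ.restrict (I₁ := Set.Icc a m) le_rfl hp2 fun i hi hi' =>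
        ⟨(hγ.2.2.2 i hi (hi'.trans hp2)).1, hp4 i hi hi'⟩
      rwa [hγ.1, hp3] at this
    have hγ2 : IsPath (Set.Icc a b) p q m m γ := by
      have := hγ.restrict (I₁ := Set.Icc a b) (Nat.zero_le p) hq2 fun i _ hi' =>
        hγ.2.2.2 i (Nat.zero_le _) (hi'.trans hq2)
      rwa [hp3, hq3] at this
    have hγ3 : IsPath (Set.Icc m b) q t m b γ := by
      have := hγ.restrict (I₁ := Set.Icc m b) (Nat.zero_le q) le_rfl fun i hi hi' =>
        ⟨hq4 i hi hi', (hγ.2.2.2 i (Nat.zero_le _) hi').2⟩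
      rwa [hq3, hγ.2.1] at this
    have hkK : (p, q) ∈ K := by
      rw [hKmem]
      have h1 := abs_le.1 (hγ1.abs_sub_le (Nat.zero_le p) le_rfl)
      have h3 := abs_le.1 (hγ3.abs_sub_le hq2 le_rfl)
      rw [hγ1.2.1] at h1
      rw [hγ3.2.1] at h3
      simp only at h1 h3 ⊢
      omega
    refine (Finset.inf'_le (fun k => Y k σ) hkK).trans ?_
    rw [← pathCost_add (Nat.zero_le q) hq2, ← pathCost_add (Nat.zero_le p) hq1]
    exact add_le_add (add_le_add (minCost_le weight_nonneg hγ1)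
      (mul_signChanges_le_pathCost σ hf he he' hγ2)) (minCost_le weight_nonneg hγ3)
  have hYL : ∀ k ∈ K, SignLip (Y k) 0 t (2 * c) := by
    intro k hk
    rw [hKmem] at hk
    obtain ⟨γ₁, hγ₁⟩ := isPath_Icc (s := 0) (t := k.1) ham (by simpa using hk.2.2.1)
    obtain ⟨γ₂, hγ₂⟩ := isPath_Icc (s := k.2) (t := t) hmb hk.2.2.2
    exact ((signLip_minCost hc hγ₁).add (signLip_signChanges.const_mul he0 he') (Nat.zero_le _)
      hk.1).add (signLip_minCost hc hγ₂) (Nat.zero_le _) hk.2.1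
  obtain ⟨k, hk, h⟩ := SignLip.exists_signMean_le (c := c) (t := t) (N := N) (K := K)
    hKne
    (fun k hk => by rw [hKmem] at hk; omega)
    (fun σ => minCost (weight c (signEnv σ) f) (Set.Icc a b) 0 t a b) Y hX hYL ht htN
  rw [hKmem] at hk
  refine ⟨k.1, t - k.2, by omega, hk.2.2.1, by have := hk.2.2.2; omega, ?_⟩
  refine le_trans ?_ h
  simp only [hY]
  rw [signMean_add, signMean_add, signMean_const_mul]
  have h1 := meanCost_shift (N := N) (c := c) (f := f) m b k.2 (t - k.2)
  rw [Nat.add_sub_cancel' hk.2.1] at h1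
  rw [h1]
  have h2 := mul_le_mul_of_nonneg_left (signMean_signChanges hN k.1 k.2) he0
  have h3 : ((t - k.2 : ℕ) : ℝ) = t - k.2 := Nat.cast_sub hk.2.1
  rw [h3, show (t : ℝ) - k.1 - (t - k.2) - 1 = k.2 - k.1 - 1 by ring]
  have h4 : meanCost N c f a m k.1 = signMean fun σ : ZMod N → ℤˣ =>
    minCost (weight c (signEnv σ) f) (Set.Icc a m) 0 k.1 a m := rfl
  linarith

/-- The part of an unconstrained walk from `0` to `k` between its last visit to `0` and its first
visit to `k`. -/
theorem exists_meanCost_le_signMean_minCost (hc : 0 ≤ c) {k : ℤ} (hk : 0 ≤ k) (ht : 0 < t)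
    (htN : t ≤ N) (hkt : k ≤ t) :
    ∃ u : ℕ, k ≤ u ∧ u ≤ t ∧ meanCost N c f 0 k u ≤
      signMean (fun σ : ZMod N → ℤˣ => minCost (weight c (signEnv σ) f) Set.univ 0 t 0 k) +
        fluct c t := by
  classical
  set K : Finset (ℕ × ℕ) := (Finset.range (t + 1) ×ˢ Finset.range (t + 1)).filter fun j =>
    k ≤ (j.2 : ℤ) - j.1 with hKdef
  have hKmem : ∀ j : ℕ × ℕ, j ∈ K ↔ j.1 ≤ t ∧ j.2 ≤ t ∧ k ≤ (j.2 : ℤ) - j.1 := by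
    intro j
    simp only [hKdef, Finset.mem_filter, Finset.mem_product, Finset.mem_range]
    omega
  have hKne : K.Nonempty := ⟨(0, t), by rw [hKmem]; simpa using hkt⟩
  set Y : ℕ × ℕ → (ZMod N → ℤˣ) → ℝ := fun j σ =>
    minCost (weight c (signEnv σ) f) (Set.Icc 0 k) j.1 j.2 0 k with hY
  have hX : ∀ σ, ∃ j ∈ K, Y j σ ≤
      minCost (weight c (signEnv σ) f) Set.univ 0 t 0 k := by
    intro σ
    by_contra! hcon
    obtain ⟨γ₀, hγ₀⟩ := isPath_univ (s := 0) (t := t) (x := 0) (y := k)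
      (by simpa [abs_of_nonneg hk] using hkt)
    have hlt : minCost (weight c (signEnv σ) f) Set.univ 0 t 0 k < K.inf' hKne fun j => Y j σ := by
      rw [Finset.lt_inf'_iff]
      exact hcon
    refine absurd (le_minCost hγ₀ fun γ hγ => ?_) (not_le.2 hlt)
    -- Between the last visit to `0` before `q` and the time `q` itself, the walk stays in `[0, k]`.
    -- The rest of its cost is nonnegative and is dropped.
    obtain ⟨q, -, hq2, hq3, hq4⟩ := hγ.exists_first_hit (Nat.zero_le _) hk le_rfl
    have hγq := hγ.restrict (I₁ := Set.univ) le_rfl hq2 fun _ _ _ => trivial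
    rw [hγ.1, hq3] at hγq
    obtain ⟨p, -, hp2, hp3, hp4⟩ := hγq.exists_last_exit (Nat.zero_le _) le_rfl hk
    have hγ1 : IsPath (Set.Icc 0 k) p q 0 k γ := by
      have := hγ.restrict (I₁ := Set.Icc 0 k) (Nat.zero_le p) hq2 fun i hi hi' =>
        ⟨hp4 i hi hi', hq4 i (Nat.zero_le _) hi'⟩
      rwa [hp3, hq3] at this
    have hkK : (p, q) ∈ K := by
      rw [hKmem]
      have h1 := abs_le.1 (hγ1.abs_sub_le hp2 le_rfl)
      rw [hγ1.2.1] at h1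
      simp only at h1 ⊢
      omega
    refine (Finset.inf'_le (fun j => Y j σ) hkK).trans ((minCost_le weight_nonneg hγ1).trans ?_)
    refine Finset.sum_le_sum_of_subset_of_nonneg (fun i hi => ?_) fun i _ _ => weight_nonneg i _
    simp only [Finset.mem_Ioc] at hi ⊢
    omega
  have hYL : ∀ k ∈ K, SignLip (Y k) 0 t (2 * c) := by
    intro j hj
    rw [hKmem] at hj
    obtain ⟨γ₁, hγ₁⟩ := isPath_Icc (s := j.1) (t := j.2) hk (by simpa using hj.2.2)
    intro i σ σ' hσ
    refine (signLip_minCost hc hγ₁ i σ σ' fun l hl => hσ l ?_).trans (add_le_add_right ?_ _)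
    · simp only [Finset.mem_Ioc] at hl ⊢
      omega
    · simp only [Finset.mem_Ioc]
      split_ifs <;> first | omega | linarith
  obtain ⟨j, hj, h⟩ := SignLip.exists_signMean_le (c := c) (t := t) (N := N) hKne
    (fun j hj => by rw [hKmem] at hj; omega)
    (fun σ => minCost (weight c (signEnv σ) f) Set.univ 0 t 0 k) Y hX hYL ht htN
  rw [hKmem] at hj
  refine ⟨j.2 - j.1, by omega, by omega, ?_⟩
  have h1 := meanCost_shift (N := N) (c := c) (f := f) 0 k j.1 (j.2 - j.1)
  rw [Nat.add_sub_cancel' (by omega)] at h1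
  rwa [← h1]

end MeanCost

/-! ### Power inequalities -/

section Analysis

theorem exists_fluct_le (c : ℝ) {q : ℝ} (hq : 1 / 2 < q) :
    ∃ C > 0, ∀ t : ℕ, 0 < t → fluct c t ≤ C * (t : ℝ) ^ q := by
  set ε := q - 1 / 2 with hε
  have hε0 : 0 < ε := by linarith
  refine ⟨2 * (2 ^ ε / ε) + c ^ 2 / 2, by positivity, fun t ht => ?_⟩
  have ht1 : (1 : ℝ) ≤ t := by exact_mod_cast ht
  have h1 : Real.log (t + 1) ≤ 2 ^ ε / ε * (t : ℝ) ^ ε := by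
    refine (Real.log_le_rpow_div (by positivity) hε0).trans ?_
    rw [div_mul_eq_mul_div, ← Real.mul_rpow (by norm_num) (by positivity)]
    gcongr
    linarith
  have h2 : (1 : ℝ) ≤ (t : ℝ) ^ ε := Real.one_le_rpow ht1 hε0.le
  have h3 : (t : ℝ) ^ q = √t * (t : ℝ) ^ ε := by
    rw [Real.sqrt_eq_rpow, ← Real.rpow_add (by positivity)]
    congr 1
    rw [hε]
    ring
  rw [fluct, h3, mul_left_comm]
  refine mul_le_mul_of_nonneg_left ?_ (Real.sqrt_nonneg _)
  have := mul_le_mul_of_nonneg_left h2 (by positivity : 0 ≤ c ^ 2 / 2)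
  linarith

/-- A form of Young's inequality: either the linear term dominates, or `t < (C / y) ^ p`. It trades
a fluctuation for a small linear waiting cost and a constant. -/
theorem mul_rpow_le_add {C y t p : ℝ} (hC : 0 < C) (hy : 0 < y) (ht : 0 < t) (hp : 1 < p) :
    C * t ^ (1 - 1 / p) ≤ y * t + C ^ p * y ^ (1 - p) := by
  have hp0 : 0 < p := by linarith
  by_cases h : C * t ^ (1 - 1 / p) ≤ y * t
  · have : 0 < C ^ p * y ^ (1 - p) := by positivity
    linarith
  · push Not at h
    have h1 : t = t ^ (1 - 1 / p) * t ^ (1 / p) := by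
      rw [← Real.rpow_add ht]
      simp
    have hT : 0 < t ^ (1 - 1 / p) := by positivity
    have h2 : t ^ (1 / p) < C / y := by
      rw [lt_div_iff₀ hy]
      nlinarith
    have h3 : t < (C / y) ^ p := by
      have := Real.rpow_lt_rpow (by positivity) h2 hp0
      rwa [← Real.rpow_mul ht.le, one_div_mul_cancel hp0.ne', Real.rpow_one] at this
    have h4 : t ^ (1 - 1 / p) ≤ (C / y) ^ (p - 1) := by
      have hq : 0 ≤ 1 - 1 / p := by
        rw [sub_nonneg, div_le_one hp0]; exact hp.le
      refine (Real.rpow_le_rpow ht.le h3.le hq).trans (le_of_eq ?_)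
      rw [← Real.rpow_mul (by positivity)]
      congr 1
      field_simp
    have h5 : C * (C / y) ^ (p - 1) = C ^ p * y ^ (1 - p) := by
      rw [Real.div_rpow hC.le hy.le, show 1 - p = -(p - 1) by ring, Real.rpow_neg hy.le,
        Real.rpow_sub_one hC.ne' p]
      field_simp
    have h6 : C * t ^ (1 - 1 / p) ≤ C ^ p * y ^ (1 - p) := by
      rw [← h5]
      gcongr
    have : 0 < y * t := by positivity
    linarith

/-- For `x` a length, the exponent `r < 1` yields the decaying factor `x ^ (r - 1)`, which makes the
errors summable over the scales. -/
theorem rpow_le_mul_add {S x r : ℝ} (hS : 0 ≤ S) (hx : 0 < x) (hr : 0 < r) (hr1 : r < 1) :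
    S ^ r ≤ x ^ (r - 1) * (S + x) := by
  by_cases h : x ≤ S
  · have hS' : 0 < S := hx.trans_le h
    have h1 : S ^ r = S ^ (r - 1) * S := by
      rw [← Real.rpow_add_one hS'.ne']; ring_nf
    rw [h1, mul_add]
    have h2 : S ^ (r - 1) ≤ x ^ (r - 1) :=
      Real.rpow_le_rpow_of_nonpos hx h (by linarith)
    have h3 : 0 ≤ x ^ (r - 1) * x := by positivity
    nlinarith
  · push Not at h
    have h1 : x ^ r = x ^ (r - 1) * x := by
      rw [← Real.rpow_add_one hx.ne']; ring_nf
    have h2 : S ^ r ≤ x ^ r := Real.rpow_le_rpow hS h.le hr.le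
    have h3 : 0 ≤ x ^ (r - 1) * S := by positivity
    nlinarith

end Analysis

/-! ### The multiscale estimate -/

/-- Up to a duration of about `U / θ`, the mean cost of a walk through `[a, b]` is not reduced by
additional time, and each additional unit of time costs at least `θ e`. -/
def WaitBound (N : ℕ) [NeZero N] (c : ℝ) (f : ℤ → ℝ) (a b : ℤ) (e θ U : ℝ) : Prop :=
  ∀ u : ℕ, b - a ≤ u → u ≤ N → ∃ u' : ℕ, b - a ≤ u' ∧ u' ≤ u ∧ θ * u' ≤ U ∧
    meanCost N c f a b u' + e * max (θ * u - U) 0 ≤ meanCost N c f a b u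

/-- The sum over the edges in `[a, b]` of a negative power of their deficits. -/
noncomputable def edgeSum (c p : ℝ) (f : ℤ → ℝ) (a b : ℤ) : ℝ :=
  ∑ x ∈ Finset.Ico a b, (2 * c - |f x - f (x + 1)|) ^ (-p)

section WaitBound

variable {N : ℕ} [NeZero N] {c e e₁ e₂ θ θ' U U₁ U₂ p : ℝ} {f : ℤ → ℝ} {a m b : ℤ}

/-- Walks through both halves are shortened separately and concatenated. The time spent around `m`
costs `e / 4 ≥ θ e` per unit up to one unit of time, whence the `1/4` in `hU`. The decrease from `θ`
to `θ'` absorbs the linear part of the fluctuation, and `R` absorbs the constant part. -/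
theorem WaitBound.glue (h₁ : WaitBound N c f a m e₁ θ U₁) (h₂ : WaitBound N c f m b e₂ θ U₂)
    (hN : 1 < N) (hc : 0 ≤ c) (hf : ∀ x, |f x| ≤ c) (ham : a < m) (hmb : m ≤ b) (he0 : 0 ≤ e)
    (he : ∀ x, a ≤ x → x < b → e ≤ 2 * c - |f x - f (x + 1)|) (he' : e ≤ 2 * c)
    (he₁ : e ≤ e₁) (he₂ : e ≤ e₂) (hθ' : θ' ≤ θ) (hθ : θ ≤ 1 / 4) {R : ℝ}
    (hR : ∀ t : ℕ, 0 < t → fluct c t ≤ (θ - θ') * e * t + e * R) (hR0 : 0 ≤ R)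
    (hU : U₁ + U₂ + 1 / 4 + R ≤ U) : WaitBound N c f a b e θ' U := by
  intro u hu huN
  by_cases hθu : θ' * u ≤ U
  · exact ⟨u, hu, le_rfl, hθu, by rw [max_eq_right (by linarith)]; simp⟩
  push Not at hθu
  have hu0 : 0 < u := by omega
  obtain ⟨v₁, v₂, hv, hv₁, hv₂, hcost⟩ :=
    exists_meanCost_split hN hc hf ham.le hmb he0 he he' hu0 huN hu
  obtain ⟨w₁, hw₁, hwv₁, hwU₁, hc₁⟩ := h₁ v₁ hv₁ (by omega)
  obtain ⟨w₂, hw₂, hwv₂, hwU₂, hc₂⟩ := h₂ v₂ hv₂ (by omega)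
  refine ⟨w₁ + w₂, by push_cast; linarith, by omega, ?_, ?_⟩
  · have : θ' * ((w₁ : ℝ) + w₂) ≤ θ * (w₁ + w₂) := by gcongr
    push_cast
    linarith
  · rw [max_eq_left (by linarith)]
    have h3 := meanCost_add_le (N := N) (c := c) (f := f) ham.le hmb hw₁ hw₂
    have h4 : e * (θ * v₁ - U₁) ≤ e₁ * max (θ * v₁ - U₁) 0 :=
      (mul_le_mul_of_nonneg_left (le_max_left _ _) he0).trans
        (mul_le_mul_of_nonneg_right he₁ (le_max_right _ _))
    have h5 : e * (θ * v₂ - U₂) ≤ e₂ * max (θ * v₂ - U₂) 0 :=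
      (mul_le_mul_of_nonneg_left (le_max_left _ _) he0).trans
        (mul_le_mul_of_nonneg_right he₂ (le_max_right _ _))
    have h6 := hR u hu0
    have h7 : 0 ≤ (u : ℝ) - v₁ - v₂ := by
      have : ((v₁ + v₂ : ℕ) : ℝ) ≤ u := by exact_mod_cast hv
      push_cast at this
      linarith
    have h8 : e * (θ * (u - v₁ - v₂)) ≤ e * ((u - v₁ - v₂) / 4) := by
      refine mul_le_mul_of_nonneg_left ?_ he0
      nlinarith
    have h9 := mul_le_mul_of_nonneg_left hU he0
    linarith

/-- A single step costs at most `2c`, whereas a longer stay pays for the sign changes at rate `e /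
4`. So `u' = 1` works once `u` is large. -/
theorem waitBound_edge (hN : 1 < N) (hc : 0 ≤ c) (hf : ∀ x, |f x| ≤ c)
    (he : e ≤ 2 * c - |f a - f (a + 1)|) (he0 : 0 < e) (hU : 1 / 4 + 2 * c / e ≤ U) :
    WaitBound N c f a (a + 1) e (1 / 4) U := by
  intro u hu huN
  by_cases hθu : 1 / 4 * (u : ℝ) ≤ U
  · exact ⟨u, hu, le_rfl, hθu, by rw [max_eq_right (by linarith)]; simp⟩
  push Not at hθu
  have hce : 0 ≤ 2 * c / e := by positivity
  refine ⟨1, by simp, by omega, by push_cast; linarith, ?_⟩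
  rw [max_eq_left (by linarith)]
  have h1 := meanCost_le (N := N) (f := f) hc (a := a) (b := a + 1) (u := 1) (by omega) (by simp)
  have h2 : e * (((u : ℝ) - 0 - 1) / 4) ≤ meanCost N c f a (a + 1) u := by
    have h3 := mul_le_mul_of_nonneg_left (signMean_signChanges hN 0 u) he0.le
    rw [Nat.cast_zero] at h3
    refine h3.trans ?_
    rw [← signMean_const_mul]
    refine signMean_mono fun σ => ?_
    obtain ⟨γ, hγ⟩ := isPath_Icc (a := a) (b := a + 1) (s := 0) (t := u) (by omega)
      (by simpa using hu)
    refine le_minCost hγ fun γ hγ => mul_signChanges_le_pathCost σ hf (fun x hx hx' => ?_) ?_ hγ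
    · obtain rfl : x = a := by omega
      exact he
    · linarith [abs_nonneg (f a - f (a + 1))]
  have h4 := mul_le_mul_of_nonneg_left hU he0.le
  rw [mul_add, mul_div_cancel₀ _ he0.ne'] at h4
  push_cast at h1
  linarith

theorem edgeSum_add (ham : a ≤ m) (hmb : m ≤ b) :
    edgeSum c p f a m + edgeSum c p f m b = edgeSum c p f a b := by
  unfold edgeSum
  rw [← Finset.Ico_union_Ico_eq_Ico ham hmb,
    Finset.sum_union (Finset.Ico_disjoint_Ico_consecutive a m b)]

theorem edge_pos (hf : ∀ x, |f x| < c) (x y : ℤ) : 0 < 2 * c - |f x - f y| := by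
  linarith [abs_sub (f x) (f y), hf x, hf y]

theorem edgeSum_pos (hf : ∀ x, |f x| < c) (hab : a < b) : 0 < edgeSum c p f a b :=
  Finset.sum_pos (fun x _ => Real.rpow_pos_of_pos (edge_pos hf _ _) _) ⟨a, by simpa using hab⟩

theorem edgeSum_nonneg (hf : ∀ x, |f x| < c) (a b : ℤ) : 0 ≤ edgeSum c p f a b :=
  Finset.sum_nonneg fun _ _ => (Real.rpow_pos_of_pos (edge_pos hf _ _) _).le

/-- A single summand is at most the whole sum. The sum thus controls the smallest deficit, and
unlike the latter it is additive over intervals and has a computable mean. -/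
theorem edgeSum_rpow_le (hf : ∀ x, |f x| < c) (hp : 0 < p) {x : ℤ} (hx : a ≤ x) (hx' : x < b) :
    edgeSum c p f a b ^ (-1 / p) ≤ 2 * c - |f x - f (x + 1)| := by
  have h1 := edge_pos hf x (x + 1)
  have h2 : (2 * c - |f x - f (x + 1)|) ^ (-p) ≤ edgeSum c p f a b :=
    Finset.single_le_sum (f := fun x => (2 * c - |f x - f (x + 1)|) ^ (-p))
      (fun _ _ => (Real.rpow_pos_of_pos (edge_pos hf _ _) _).le) (Finset.mem_Ico.2 ⟨hx, hx'⟩)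
  refine (Real.rpow_le_rpow_of_nonpos (Real.rpow_pos_of_pos h1 _) h2
    (div_nonpos_of_nonpos_of_nonneg (by norm_num) hp.le)).trans (le_of_eq ?_)
  rw [← Real.rpow_mul h1.le, show -p * (-1 / p) = 1 by field_simp, Real.rpow_one]

/-- The multiscale estimate: uniformly in the environment, the duration in `WaitBound` for a dyadic
interval is at most linear in its length and the sum over its edges. -/
theorem exists_waitBound (hc : 0 < c) (hp : 2 < p) :
    ∃ K > 0, ∃ θ : ℕ → ℝ, (∀ j, 1 / 8 ≤ θ j) ∧ ∃ A : ℕ → ℝ, (∀ j, A j ≤ K) ∧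
      ∀ f : ℤ → ℝ, (∀ x, |f x| < c) → ∀ (N : ℕ) [NeZero N], 1 < N → ∀ (j : ℕ) (a : ℤ),
        WaitBound N c f a (a + 2 ^ j) (edgeSum c p f a (a + 2 ^ j) ^ (-1 / p)) (θ j)
          (A j * (2 ^ j + edgeSum c p f a (a + 2 ^ j))) := by
  have hp0 : 0 < p := by linarith
  -- An exponent strictly between `2` and `p`: `2 < p₁` bounds the fluctuation by `t ^ (1 - 1 /
  -- p₁)`, and `p₁ < p` leaves the decay rate `v` per scale.
  set p₁ := (2 + p) / 2 with hp₁
  have hp₁2 : 2 < p₁ := by linarith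
  have hp₁p : p₁ < p := by linarith
  set r := p₁ / p with hr
  have hr0 : 0 < r := by positivity
  have hr1 : r < 1 := (div_lt_one hp0).2 hp₁p
  set v : ℝ := 2 ^ (r - 1) with hv
  have hv0 : 0 < v := by positivity
  have hv1 : v < 1 := Real.rpow_lt_one_of_one_lt_of_neg (by norm_num) (by linarith)
  have hv2 : 1 / 2 ≤ v := by
    rw [show (1 / 2 : ℝ) = 2 ^ (-1 : ℝ) by rw [Real.rpow_neg_one]; norm_num]
    exact Real.rpow_le_rpow_of_exponent_le (by norm_num) (by linarith)
  -- The differences of `θ` decay like `ρ ^ j`, so the fluctuation constants grow like `(ρ ^ (1 -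
  -- p₁)) ^ j`. This `ρ` makes the growth use up only half of the decay `v ^ j`, leaving `α ^ j`
  -- with `α = √v`.
  set ρ : ℝ := v ^ (1 / (2 * (p₁ - 1))) with hρ
  have hρ0 : 0 < ρ := by positivity
  have hρ1 : ρ < 1 := Real.rpow_lt_one hv0.le hv1 (by
    have : 0 < p₁ - 1 := by linarith
    positivity)
  set α : ℝ := v ^ (1 / 2 : ℝ) with hα
  have hα0 : 0 < α := by positivity
  have hα1 : α < 1 := Real.rpow_lt_one hv0.le hv1 (by norm_num)
  have hαv : ρ ^ (1 - p₁) * v = α := by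
    rw [hρ, hα, ← Real.rpow_mul hv0.le]
    nth_rewrite 2 [← Real.rpow_one v]
    rw [← Real.rpow_add hv0]
    congr 1
    have : p₁ - 1 ≠ 0 := by linarith
    field_simp
    ring
  have hα2 : 1 / 2 ≤ α := hv2.trans (by
    nth_rewrite 1 [← Real.rpow_one v]
    exact Real.rpow_le_rpow_of_exponent_ge hv0 hv1.le (by norm_num))
  obtain ⟨C, hC0, hC⟩ := exists_fluct_le c (q := 1 - 1 / p₁) (by
    have : 1 / p₁ < 1 / 2 := one_div_lt_one_div_of_lt (by norm_num) hp₁2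
    linarith)
  set C₁ : ℝ := C ^ p₁ * ((1 - ρ) / 8) ^ (1 - p₁) with hC₁
  have h1ρ : 0 < 1 - ρ := by linarith
  have hC₁0 : 0 < C₁ := by positivity
  -- Chosen so that `A (j + 1) - A j = (C₁ + 1) α ^ j`: the part `C₁` pays for `R`, the part `1` for
  -- the `1/4` in `WaitBound.glue`.
  set C₂ : ℝ := (C₁ + 1) / (1 - α) with hC₂
  have hC₂0 : 0 < C₂ := div_pos (by linarith) (by linarith)
  have hC₂α : C₂ * (1 - α) = C₁ + 1 := div_mul_cancel₀ _ (by linarith)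
  refine ⟨C₂ + (1 + 2 * c), by positivity, fun j => (1 + ρ ^ j) / 8, fun j => ?_,
    fun j => C₂ + (1 + 2 * c) - C₂ * α ^ j, fun j => ?_, ?_⟩
  · have : 0 < ρ ^ j := by positivity
    linarith
  · have : 0 < C₂ * α ^ j := by positivity
    linarith
  intro f hf N _ hN j
  induction j with
  | zero =>
    intro a
    have hS := edgeSum_pos (p := p) hf (show a < a + 2 ^ 0 by omega)
    have he := edgeSum_rpow_le hf hp0 le_rfl (show a < a + 2 ^ 0 by omega)
    simp only [pow_zero, mul_one] at hS he ⊢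
    set S := edgeSum c p f a (a + 1)
    norm_num only
    refine waitBound_edge hN hc.le (fun x => (hf x).le) he (by positivity) ?_
    have h1 : 2 * c / S ^ (-1 / p) = 2 * c * S ^ (1 / p) := by
      rw [neg_div, Real.rpow_neg hS.le]
      field_simp
    have h2 : S ^ (1 / p) ≤ 1 ^ (1 / p - 1) * (S + 1) :=
      rpow_le_mul_add hS.le one_pos (by positivity) ((div_lt_one hp0).2 (by linarith))
    rw [Real.one_rpow, one_mul] at h2
    rw [h1]
    have h3 := mul_le_mul_of_nonneg_left h2 (by positivity : 0 ≤ 2 * c)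
    linarith
  | succ j ih =>
    intro a
    have ha1 : a < a + 2 ^ j := by linarith [pow_pos (zero_lt_two (α := ℤ)) j]
    have hab : a + 2 ^ (j + 1) = a + 2 ^ j + 2 ^ j := by ring
    have hmb : a + 2 ^ j < a + 2 ^ (j + 1) := by rw [hab]; linarith
    have h₁ := ih a
    have h₂ := ih (a + 2 ^ j)
    rw [← hab] at h₂
    have hadd := edgeSum_add (c := c) (p := p) (f := f) ha1.le hmb.le
    have hS₁ := edgeSum_pos (p := p) hf ha1
    have hS₂ := edgeSum_pos (p := p) hf hmb
    have hS := edgeSum_pos (p := p) hf (ha1.trans hmb)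
    have hedge : ∀ x, a ≤ x → x < a + 2 ^ (j + 1) →
        edgeSum c p f a (a + 2 ^ (j + 1)) ^ (-1 / p) ≤ 2 * c - |f x - f (x + 1)| :=
      fun x hx hx' => edgeSum_rpow_le hf hp0 hx hx'
    set S₁ := edgeSum c p f a (a + 2 ^ j)
    set S₂ := edgeSum c p f (a + 2 ^ j) (a + 2 ^ (j + 1))
    set S := edgeSum c p f a (a + 2 ^ (j + 1))
    have hneg : -1 / p ≤ 0 := div_nonpos_of_nonpos_of_nonneg (by norm_num) hp0.le
    set e := S ^ (-1 / p) with he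
    have he0 : 0 < e := by positivity
    have hρj : ρ ^ j ≤ 1 := pow_le_one₀ hρ0.le hρ1.le
    have hρj0 : 0 < ρ ^ j := by positivity
    set η : ℝ := ρ ^ j * ((1 - ρ) / 8) with hη
    have hη0 : 0 < η := by positivity
    have hh0 : (0 : ℝ) < 2 ^ (j + 1) := by positivity
    -- The relation `e ^ (-p₁) = S ^ (p₁ / p)` turns the smallness of `e` into a sublinear power of
    -- `S`.
    have hR1 : η ^ (1 - p₁) * e ^ (-p₁) * C ^ p₁ ≤ C₁ * α ^ j * (2 ^ (j + 1) + S) := by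
      have h3 : e ^ (-p₁) = S ^ r := by
        rw [he, ← Real.rpow_mul hS.le]
        congr 1
        rw [hr]
        field_simp
      have h4 : S ^ r ≤ v ^ j * (2 ^ (j + 1) + S) := by
        refine (rpow_le_mul_add hS.le hh0 hr0 hr1).trans ?_
        rw [add_comm S]
        refine mul_le_mul_of_nonneg_right ?_ (by positivity)
        have : ((2 : ℝ) ^ (j + 1)) ^ (r - 1) = v ^ (j + 1) := by
          rw [hv, ← Real.rpow_natCast, ← Real.rpow_mul (by norm_num), mul_comm,
            Real.rpow_mul (by norm_num), Real.rpow_natCast]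
        rw [this]
        exact pow_le_pow_of_le_one hv0.le hv1.le (Nat.le_succ j)
      have h5 : η ^ (1 - p₁) = (ρ ^ (1 - p₁)) ^ j * ((1 - ρ) / 8) ^ (1 - p₁) := by
        rw [hη, Real.mul_rpow hρj0.le (by positivity)]
        congr 1
        rw [← Real.rpow_natCast, ← Real.rpow_mul hρ0.le, mul_comm, Real.rpow_mul hρ0.le,
          Real.rpow_natCast]
      rw [h3, ← hαv, mul_pow, h5]
      calc (ρ ^ (1 - p₁)) ^ j * ((1 - ρ) / 8) ^ (1 - p₁) * S ^ r * C ^ p₁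
          ≤ (ρ ^ (1 - p₁)) ^ j * ((1 - ρ) / 8) ^ (1 - p₁) * (v ^ j * (2 ^ (j + 1) + S)) *
              C ^ p₁ := by gcongr
        _ = C₁ * ((ρ ^ (1 - p₁)) ^ j * v ^ j) * (2 ^ (j + 1) + S) := by rw [hC₁]; ring
    refine h₁.glue h₂ hN hc.le (fun x => (hf x).le) ha1 hmb.le he0.le hedge ?_
      (Real.rpow_le_rpow_of_nonpos hS₁ (by linarith) hneg)
      (Real.rpow_le_rpow_of_nonpos hS₂ (by linarith) hneg) ?_ ?_
      (R := η ^ (1 - p₁) * e ^ (-p₁) * C ^ p₁) ?_ (by positivity) ?_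
    · exact (hedge a le_rfl (ha1.trans hmb)).trans (by linarith [abs_nonneg (f a - f (a + 1))])
    · beta_reduce
      rw [pow_succ]
      have : ρ ^ j * ρ ≤ ρ ^ j * 1 := by gcongr
      linarith
    · linarith
    · intro t ht
      have ht0 : (0 : ℝ) < t := by exact_mod_cast ht
      refine (hC t ht).trans ((mul_rpow_le_add hC0 (by positivity : 0 < η * e) ht0
        (by linarith)).trans (le_of_eq ?_))
      rw [Real.mul_rpow hη0.le he0.le, show 1 - p₁ = 1 + -p₁ by ring, Real.rpow_add he0,
        Real.rpow_one]
      beta_reduce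
      rw [pow_succ, hη]
      ring
    · have h6 : 1 / 4 ≤ α ^ j * (2 ^ (j + 1) + S) := by
        have h7 : (1 / 2 : ℝ) ^ j ≤ α ^ j := pow_le_pow_left₀ (by norm_num) hα2 j
        have h8 : (1 / 2 : ℝ) ^ j * 2 ^ (j + 1) = 2 := by
          rw [pow_succ, ← mul_assoc, ← mul_pow]; norm_num
        have h9 := mul_le_mul_of_nonneg_right h7 hh0.le
        have h10 : 0 < α ^ j * S := by positivity
        linarith
      have h11 : C₂ * α ^ (j + 1) = C₂ * α ^ j - (C₁ + 1) * α ^ j := by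
        rw [← hC₂α, pow_succ]; ring
      have h12 : (2 : ℝ) ^ (j + 1) = 2 ^ j + 2 ^ j := by ring
      beta_reduce
      rw [h11, ← hadd]
      rw [← hadd] at hR1 h6
      rw [h12] at hR1 h6 ⊢
      linarith

/-- Up to a fluctuation term, a walk from `0` to `2 ^ j` does not profit from more time than a
multiple of `2 ^ j` plus the sum over the edges in between. -/
theorem exists_signMean_minCost_le (hc : 0 < c) (hp : 2 < p) :
    ∃ K > 0, ∀ f : ℤ → ℝ, (∀ x, |f x| < c) → ∀ (N : ℕ) [NeZero N], 1 < N → ∀ j t : ℕ,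
      2 ^ j ≤ t → t ≤ N → ∃ u : ℕ, 2 ^ j ≤ u ∧ u ≤ t ∧
        u ≤ K * (2 ^ j + edgeSum c p f 0 (2 ^ j)) ∧
        signMean (fun σ : ZMod N → ℤˣ =>
            minCost (weight c (signEnv σ) f) Set.univ 0 u 0 (2 ^ j)) ≤
          signMean (fun σ : ZMod N → ℤˣ =>
            minCost (weight c (signEnv σ) f) Set.univ 0 t 0 (2 ^ j)) + fluct c t := by
  obtain ⟨K, hK, θ, hθ, A, hA, h⟩ := exists_waitBound hc hp
  -- The factor `8` is due to `θ j ≥ 1/8`.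
  refine ⟨8 * K, by positivity, fun f hf N _ hN j t hjt htN => ?_⟩
  have hj : (0 : ℕ) < 2 ^ j := by positivity
  have hjz : (0 : ℤ) < 2 ^ j := by positivity
  obtain ⟨v, hv, hvt, hv'⟩ := exists_meanCost_le_signMean_minCost (N := N) (f := f) hc.le
    (k := 2 ^ j) hjz.le (hj.trans_le hjt) htN (by exact_mod_cast hjt)
  obtain ⟨u, hu, huv, hθu, hu'⟩ := h f hf N hN j 0 v (by simpa using hv) (hvt.trans htN)
  simp only [zero_add, sub_zero] at hu hθu hu'
  have hS := edgeSum_pos (p := p) hf hjz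
  refine ⟨u, by exact_mod_cast hu, huv.trans hvt, ?_, ?_⟩
  · have h1 : 1 / 8 * (u : ℝ) ≤ θ j * u := by gcongr; exact hθ j
    have h2 : A j * (2 ^ j + edgeSum c p f 0 (2 ^ j)) ≤ K * (2 ^ j + edgeSum c p f 0 (2 ^ j)) := by
      gcongr
      exact hA j
    linarith
  · have h1 : 0 ≤ edgeSum c p f 0 (2 ^ j) ^ (-1 / p) *
        max (θ j * v - A j * (2 ^ j + edgeSum c p f 0 (2 ^ j))) 0 :=
      mul_nonneg (Real.rpow_nonneg hS.le _) (le_max_right _ _)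
    have h2 : signMean (fun σ : ZMod N → ℤˣ =>
        minCost (weight c (signEnv σ) f) Set.univ 0 u 0 (2 ^ j)) ≤
        meanCost N c f 0 (2 ^ j) u := by
      obtain ⟨γ, hγ⟩ := isPath_Icc (a := 0) (b := 2 ^ j) (s := 0) (t := u) hjz.le (by simpa using hu)
      exact signMean_mono fun σ => le_minCost hγ fun γ hγ =>
        minCost_le weight_nonneg (hγ.mono (Set.subset_univ _))
    linarith

end WaitBound

/-! ### A subadditive ergodic theorem for finite range dependence -/

section Subadditive

variable {Ω : Type*} {θ : Ω → Ω} {X : ℕ → Ω → ℝ} {C : ℝ}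

theorem div_natCast_mem_Icc (h0 : ∀ m ω, 0 ≤ X m ω) (hC : ∀ m ω, X m ω ≤ C * m) (m : ℕ) (ω : Ω) :
    X m ω / m ∈ Set.Icc 0 (max C 0) := by
  refine ⟨div_nonneg (h0 m ω) (Nat.cast_nonneg m), ?_⟩
  rcases m.eq_zero_or_pos with rfl | hm
  · simp
  · have : (0 : ℝ) < m := by exact_mod_cast hm
    exact ((div_le_iff₀ this).2 (hC m ω)).trans (le_max_left _ _)

theorem isBoundedUnder_le_div (h0 : ∀ m ω, 0 ≤ X m ω) (hC : ∀ m ω, X m ω ≤ C * m) (ω : Ω) :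
    IsBoundedUnder (· ≤ ·) atTop fun m => X m ω / m :=
  isBoundedUnder_of ⟨max C 0, fun m => (div_natCast_mem_Icc h0 hC m ω).2⟩

theorem isBoundedUnder_ge_div (h0 : ∀ m ω, 0 ≤ X m ω) (hC : ∀ m ω, X m ω ≤ C * m) (ω : Ω) :
    IsBoundedUnder (· ≥ ·) atTop fun m => X m ω / m :=
  isBoundedUnder_of ⟨0, fun m => (div_natCast_mem_Icc h0 hC m ω).1⟩

theorem liminf_div_mem_Icc (h0 : ∀ m ω, 0 ≤ X m ω) (hC : ∀ m ω, X m ω ≤ C * m) (ω : Ω) :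
    liminf (fun m => X m ω / m) atTop ∈ Set.Icc 0 (max C 0) := by
  constructor
  · exact le_liminf_of_le (isBoundedUnder_le_div h0 hC ω).isCoboundedUnder_ge
      (Eventually.of_forall fun m => (div_natCast_mem_Icc h0 hC m ω).1)
  · exact liminf_le_of_frequently_le (Frequently.of_forall fun m =>
      (div_natCast_mem_Icc h0 hC m ω).2) (isBoundedUnder_ge_div h0 hC ω)

/-- One step of `θ` costs `X 1 ω`, which is negligible after division by `m`. As `θ` preserves the
measure, this inequality forces the lower limit to be almost surely invariant. -/
theorem liminf_div_le_comp (h0 : ∀ m ω, 0 ≤ X m ω) (hC : ∀ m ω, X m ω ≤ C * m)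
    (hsub : ∀ m l ω, X (m + l) ω ≤ X m ω + X l (θ^[m] ω)) (ω : Ω) :
    liminf (fun m => X m ω / m) atTop ≤ liminf (fun m => X m (θ ω) / m) atTop := by
  refine le_of_forall_gt_imp_ge_of_dense fun a' ha' => ?_
  obtain ⟨a, ha, haa'⟩ := exists_between ha'
  have hfreq := frequently_lt_of_liminf_lt
    (isBoundedUnder_le_div h0 hC (θ ω)).isCoboundedUnder_ge ha
  have hev : ∀ᶠ m : ℕ in atTop, X 1 ω + a * m ≤ a' * (m + 1) := by
    have : Tendsto (fun m : ℕ => (a' - a) * (m : ℝ)) atTop atTop :=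
      tendsto_natCast_atTop_atTop.const_mul_atTop (by linarith)
    filter_upwards [this.eventually_ge_atTop (X 1 ω - a')] with m hm
    linarith
  refine liminf_le_of_frequently_le ?_ (isBoundedUnder_ge_div h0 hC ω)
  refine (tendsto_add_atTop_nat 1).frequently ?_
  refine (hfreq.and_eventually (hev.and (eventually_gt_atTop 0))).mono fun m ⟨h1, h2, h3⟩ => ?_
  have hm : (0 : ℝ) < m := by exact_mod_cast h3
  rw [div_lt_iff₀ hm] at h1
  have h4 := hsub 1 m ω
  rw [add_comm 1 m, Function.iterate_one] at h4
  push_cast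
  rw [div_le_iff₀ (by positivity)]
  linarith

variable [MeasurableSpace Ω] {P : Measure Ω} [IsProbabilityMeasure P]

theorem integrable_of_mem_Icc {f : Ω → ℝ} (hf : Measurable f) {a b : ℝ}
    (h : ∀ ω, f ω ∈ Set.Icc a b) : Integrable f P :=
  Integrable.of_mem_Icc a b hf.aemeasurable (Eventually.of_forall h)

/-- The lower bound in the subadditive ergodic theorem. -/
theorem le_integral_liminf_div (hθ : MeasurePreserving θ P P) (hX : ∀ m, Measurable (X m))
    (h0 : ∀ m ω, 0 ≤ X m ω) (hC : ∀ m ω, X m ω ≤ C * m)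
    (hsub : ∀ m l ω, X (m + l) ω ≤ X m ω + X l (θ^[m] ω)) {γ : ℝ}
    (hγ : ∀ m : ℕ, γ * m ≤ ∫ ω, X m ω ∂P) :
    γ ≤ ∫ ω, liminf (fun m => X m ω / m) atTop ∂P := by
  set g : Ω → ℝ := fun ω => liminf (fun m => X m ω / m) atTop with hg
  have hgm : Measurable g := Measurable.liminf fun m => (hX m).div_const _
  have hgI : ∀ ω, g ω ∈ Set.Icc 0 (max C 0) := liminf_div_mem_Icc h0 hC
  have hgint : Integrable g P := integrable_of_mem_Icc hgm hgI
  have hginv : ∀ᵐ ω ∂P, g (θ ω) = g ω := by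
    have h1 : g =ᵐ[P] g ∘ θ := by
      rw [← integral_eq_iff_of_ae_le hgint ((hθ.integrable_comp hgm.aestronglyMeasurable).2 hgint)
        (Eventually.of_forall (liminf_div_le_comp h0 hC hsub))]
      have := integral_map (μ := P) hθ.measurable.aemeasurable (f := g)
        hgm.aestronglyMeasurable
      rw [hθ.map_eq] at this
      exact this
    filter_upwards [h1] with ω h using h.symm
  have hginv' : ∀ᵐ ω ∂P, ∀ j, g (θ^[j] ω) = g ω := by
    have h1 : ∀ᵐ ω ∂P, ∀ j, g (θ (θ^[j] ω)) = g (θ^[j] ω) :=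
      ae_all_iff.2 fun j => (hθ.iterate j).quasiMeasurePreserving.ae hginv
    filter_upwards [h1] with ω h j
    induction j with
    | zero => rfl
    | succ j ih => rw [Function.iterate_succ_apply', h, ih]
  have hC0 : 0 ≤ C := by
    obtain ⟨ω⟩ : Nonempty Ω := P.nonempty_of_neZero
    simpa using (h0 1 ω).trans (hC 1 ω)
  refine le_of_forall_pos_le_add fun ε hε => ?_
  -- The points from which no block of length at most `L` is nearly as cheap as the lower limit
  -- predicts. Their probability tends to `0` as `L` grows.
  set bad : ℕ → Set Ω := fun L => {ω | ∀ m : ℕ, 1 ≤ m → m ≤ L → m * (g ω + ε) < X m ω} with hbad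
  have hbadm : ∀ L, MeasurableSet (bad L) := fun L => by
    simp only [hbad, Set.ofPred_forall]
    exact MeasurableSet.iInter fun m => MeasurableSet.iInter fun _ => MeasurableSet.iInter fun _ =>
      measurableSet_lt ((hgm.add_const _).const_mul _) (hX m)
  have hbadlim : Tendsto (fun L => P.real (bad L)) atTop (𝓝 0) := by
    have h1 : ⋂ L, bad L = ∅ := by
      rw [Set.eq_empty_iff_forall_notMem]
      intro ω hω
      rw [Set.mem_iInter] at hω
      have hlt : liminf (fun m => X m ω / m) atTop < g ω + ε := by
        change g ω < g ω + ε
        linarith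
      obtain ⟨m, hm1, hm⟩ := ((frequently_lt_of_liminf_lt
        (isBoundedUnder_le_div h0 hC ω).isCoboundedUnder_ge hlt).and_eventually
        (eventually_ge_atTop 1)).exists
      have h2 := hω m m hm le_rfl
      have hm' : (0 : ℝ) < m := by exact_mod_cast hm
      rw [div_lt_iff₀ hm'] at hm1
      linarith
    have h2 := tendsto_measure_iInter_atTop (μ := P) (s := bad)
      (fun L => (hbadm L).nullMeasurableSet)
      (fun L L' h ω hω m h1 h2 => hω m h1 (h2.trans h)) ⟨0, measure_ne_top _ _⟩
    rw [h1, measure_empty] at h2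
    exact (ENNReal.tendsto_toReal ENNReal.zero_ne_top).comp h2
  -- The orbit is covered greedily: from a good point by a cheap block of length at most `L`, from a
  -- bad point by a single step of cost at most `C`. The final incomplete block costs at most `C *
  -- L`.
  have hkey : ∀ L, 1 ≤ L → ∀ M ω, (∀ j, g (θ^[j] ω) = g ω) →
      X M ω ≤ (g ω + ε) * M +
        C * ∑ j ∈ Finset.range M, (bad L).indicator (fun _ => (1 : ℝ)) (θ^[j] ω) + C * L := by
    intro L hL M
    induction M using Nat.strong_induction_on with
    | _ M ih =>
      intro ω hω
      have hind : ∀ ω, 0 ≤ (bad L).indicator (fun _ => (1 : ℝ)) ω := fun ω =>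
        Set.indicator_nonneg (fun _ _ => zero_le_one) ω
      have hω' : ∀ m j, g (θ^[j] (θ^[m] ω)) = g (θ^[m] ω) := fun m j => by
        rw [← Function.iterate_add_apply, hω, hω]
      have hg0 := (hgI ω).1
      rcases le_or_gt M L with hML | hML
      · have h1 : C * (M : ℝ) ≤ C * L := by gcongr
        have h2 : 0 ≤ C * ∑ j ∈ Finset.range M, (bad L).indicator (fun _ => (1 : ℝ)) (θ^[j] ω) :=
          mul_nonneg hC0 (Finset.sum_nonneg fun j _ => hind _)
        have h3 : 0 ≤ (g ω + ε) * M := by positivity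
        linarith [hC M ω]
      · have hstep : ∀ m, 1 ≤ m → m ≤ M → X M ω ≤ X m ω + ((g ω + ε) * (M - m : ℕ) +
            C * ∑ j ∈ Finset.Ico m M, (bad L).indicator (fun _ => (1 : ℝ)) (θ^[j] ω) + C * L) := by
          intro m hm hmM
          have h1 := ih (M - m) (by omega) (θ^[m] ω) (hω' m)
          rw [hω m] at h1
          have h2 := hsub m (M - m) ω
          rw [Nat.add_sub_cancel' hmM] at h2
          rw [Finset.sum_Ico_eq_sum_range]
          simp only [← Function.iterate_add_apply] at h1
          simp only [add_comm m]
          linarith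
        by_cases hb : ω ∈ bad L
        · have h1 := hstep 1 le_rfl (by omega)
          rw [Finset.range_eq_Ico, Finset.sum_eq_sum_Ico_succ_bot (by omega : 0 < M),
            Function.iterate_zero, id_eq, Set.indicator_of_mem hb, zero_add]
          rw [Nat.cast_sub (by omega)] at h1
          have h2 := hC 1 ω
          push_cast at h1 h2
          nlinarith
        · simp only [hbad, Set.mem_ofPred_eq, not_forall, not_lt] at hb
          obtain ⟨m, hm1, hmL, hm⟩ := hb
          have h1 := hstep m hm1 (by omega)
          have h2 : ∑ j ∈ Finset.Ico m M, (bad L).indicator (fun _ => (1 : ℝ)) (θ^[j] ω) ≤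
              ∑ j ∈ Finset.range M, (bad L).indicator (fun _ => (1 : ℝ)) (θ^[j] ω) :=
            Finset.sum_le_sum_of_subset_of_nonneg (fun j hj => by
              simp only [Finset.mem_Ico, Finset.mem_range] at hj ⊢; omega) fun j _ _ => hind _
          have h3 := mul_le_mul_of_nonneg_left h2 hC0
          rw [Nat.cast_sub (by omega)] at h1
          linarith
  have hint : ∀ L, 1 ≤ L → ∀ M : ℕ, 0 < M →
      γ ≤ ∫ ω, g ω ∂P + ε + C * P.real (bad L) + C * L / M := by
    intro L hL M hM
    have hM' : (0 : ℝ) < M := by exact_mod_cast hM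
    have hXint : Integrable (X M) P :=
      integrable_of_mem_Icc (hX M) fun ω => ⟨h0 M ω, hC M ω⟩
    have hiint : ∀ j, Integrable (fun ω => (bad L).indicator (fun _ => (1 : ℝ)) (θ^[j] ω)) P :=
      fun j => (hθ.iterate j).integrable_comp_of_integrable
        ((integrable_const (1 : ℝ)).indicator (hbadm L))
    have hi : ∀ j, ∫ ω, (bad L).indicator (fun _ => (1 : ℝ)) (θ^[j] ω) ∂P = P.real (bad L) := by
      intro j
      have := integral_map (μ := P) (hθ.iterate j).measurable.aemeasurable
        (f := (bad L).indicator fun _ => (1 : ℝ))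
        (measurable_const.indicator (hbadm L)).aestronglyMeasurable
      rw [(hθ.iterate j).map_eq] at this
      rw [← this, integral_indicator_const _ (hbadm L)]
      simp
    have hgε : Integrable (fun ω => g ω + ε) P := hgint.add (integrable_const _)
    have hA : Integrable (fun ω => (g ω + ε) * M) P := hgε.mul_const _
    have hB : Integrable (fun ω =>
        C * ∑ j ∈ Finset.range M, (bad L).indicator (fun _ => (1 : ℝ)) (θ^[j] ω)) P :=
      (integrable_finsetSum _ fun j _ => hiint j).const_mul _
    have hAB : Integrable (fun ω => (g ω + ε) * M +
        C * ∑ j ∈ Finset.range M, (bad L).indicator (fun _ => (1 : ℝ)) (θ^[j] ω)) P := hA.add hB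
    have h1 : ∫ ω, X M ω ∂P ≤ ∫ ω, ((g ω + ε) * M +
        C * ∑ j ∈ Finset.range M, (bad L).indicator (fun _ => (1 : ℝ)) (θ^[j] ω) + C * L) ∂P := by
      refine integral_mono_ae hXint (hAB.add (integrable_const _)) ?_
      filter_upwards [hginv'] with ω hω using hkey L hL M ω hω
    rw [integral_add hAB (integrable_const _), integral_add hA hB, integral_mul_const,
      integral_add hgint (integrable_const _), integral_const_mul,
      integral_finsetSum _ fun j _ => hiint j, Finset.sum_congr rfl fun j _ => hi j] at h1
    simp only [Finset.sum_const, Finset.card_range, nsmul_eq_mul, integral_const, probReal_univ,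
      smul_eq_mul, one_mul] at h1
    have h2 := (hγ M).trans h1
    have h3 : γ ≤ ((∫ ω, g ω ∂P + ε) * M + C * (M * P.real (bad L)) + C * L) / M := by
      rw [le_div_iff₀ hM']; exact h2
    refine h3.trans (le_of_eq ?_)
    field_simp
  have hint' : ∀ L, 1 ≤ L → γ ≤ ∫ ω, g ω ∂P + ε + C * P.real (bad L) := by
    intro L hL
    have h1 : Tendsto (fun M : ℕ => ∫ ω, g ω ∂P + ε + C * P.real (bad L) + C * L / M) atTop
        (𝓝 (∫ ω, g ω ∂P + ε + C * P.real (bad L) + 0)) :=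
      tendsto_const_nhds.add (tendsto_const_div_atTop_nhds_zero_nat _)
    rw [add_zero] at h1
    exact ge_of_tendsto h1 ((eventually_gt_atTop 0).mono fun M hM => hint L hL M hM)
  have h1 : Tendsto (fun L : ℕ => ∫ ω, g ω ∂P + ε + C * P.real (bad L)) atTop
      (𝓝 (∫ ω, g ω ∂P + ε + C * 0)) := tendsto_const_nhds.add (hbadlim.const_mul C)
  rw [mul_zero, add_zero] at h1
  exact ge_of_tendsto h1 ((eventually_ge_atTop 1).mono hint')

/-- The upper bound in the subadditive ergodic theorem, in the case of finite range dependence. -/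
theorem eventually_le_mul_of_indepFun (hθ : MeasurePreserving θ P P)
    (hX : ∀ m, Measurable (X m)) (h0 : ∀ m ω, 0 ≤ X m ω) (hC : ∀ m ω, X m ω ≤ C * m)
    (hsub : ∀ m l ω, X (m + l) ω ≤ X m ω + X l (θ^[m] ω)) {r q : ℕ} (hr : 0 < r) (hq : 0 < q)
    (hind : Pairwise fun l l' : ℕ =>
      IndepFun (fun ω => X r (θ^[r * q * l] ω)) (fun ω => X r (θ^[r * q * l'] ω)) P) :
    ∀ᵐ ω ∂P, ∀ a, (∫ ω, X r ω ∂P) / r < a → ∀ᶠ M : ℕ in atTop, X M ω ≤ a * M := by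
  have hC0 : 0 ≤ C := by
    obtain ⟨ω⟩ : Nonempty Ω := P.nonempty_of_neZero
    simpa using (h0 1 ω).trans (hC 1 ω)
  have hint : Integrable (X r) P := integrable_of_mem_Icc (hX r) fun ω => ⟨h0 r ω, hC r ω⟩
  have hlln := strong_law_ae_real (μ := P) (fun l ω => X r (θ^[r * q * l] ω))
    (by simpa using hint) hind fun l => by
      have h1 : ∀ l, IdentDistrib (fun ω => X r (θ^[r * q * l] ω)) (X r) P P := fun l =>
        ⟨((hX r).comp (hθ.iterate _).measurable).aemeasurable, (hX r).aemeasurable, by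
          change Measure.map (X r ∘ θ^[r * q * l]) P = _
          rw [← Measure.map_map (hX r) (hθ.iterate _).measurable, (hθ.iterate _).map_eq]⟩
      exact (h1 l).trans (h1 0).symm
  simp only [mul_zero, Function.iterate_zero, id_eq] at hlln
  -- Blocks of length `r` are sorted by index modulo `q`. Within a class they are pairwise
  -- independent, and the strong law applies to every class.
  have hlln' : ∀ᵐ ω ∂P, ∀ i, Tendsto (fun n : ℕ =>
      (∑ l ∈ Finset.range n, X r (θ^[r * q * l] (θ^[r * i] ω))) / n) atTop
        (𝓝 (∫ ω, X r ω ∂P)) :=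
    ae_all_iff.2 fun i => (hθ.iterate (r * i)).quasiMeasurePreserving.ae hlln
  filter_upwards [hlln'] with ω hω a ha
  set E := ∫ ω, X r ω ∂P
  have hr' : (0 : ℝ) < r := by exact_mod_cast hr
  have hq' : (0 : ℝ) < q := by exact_mod_cast hq
  obtain ⟨a₁, ha₁, ha₁a⟩ := exists_between ha
  rw [div_lt_iff₀ hr'] at ha₁
  have hE0 : 0 ≤ E := integral_nonneg (h0 r)
  have ha₁0 : 0 ≤ a₁ := by
    by_contra! h
    nlinarith
  have hrow : ∀ k n ω, X (r * (k + n)) ω ≤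
      X (r * k) ω + ∑ i ∈ Finset.range n, X r (θ^[r * i] (θ^[r * k] ω)) := by
    intro k n
    induction n with
    | zero => simp
    | succ n ih =>
      intro ω
      rw [Finset.sum_range_succ, ← add_assoc, mul_add, mul_one]
      refine (hsub _ _ _).trans ?_
      have := ih ω
      rw [← Function.iterate_add_apply, ← mul_add, add_comm n k]
      linarith
  have hblock : ∀ m, X (r * q * m) ω ≤ ∑ i ∈ Finset.range q, ∑ l ∈ Finset.range m,
      X r (θ^[r * q * l] (θ^[r * i] ω)) := by
    intro m
    rw [Finset.sum_comm]
    induction m with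
    | zero => simpa using hC 0 ω
    | succ m ih =>
      rw [Finset.sum_range_succ]
      have h1 := hrow (q * m) q ω
      rw [← mul_assoc] at h1
      rw [show r * q * (m + 1) = r * (q * m + q) by ring]
      refine h1.trans (add_le_add ih (le_of_eq (Finset.sum_congr rfl fun i _ => ?_)))
      rw [← Function.iterate_add_apply, ← Function.iterate_add_apply, add_comm]
  have hevm : ∀ᶠ m : ℕ in atTop, X (r * q * m) ω ≤ q * (m * (a₁ * r)) := by
    have h1 : ∀ᶠ m : ℕ in atTop, ∀ i ∈ Finset.range q,
        (∑ l ∈ Finset.range m, X r (θ^[r * q * l] (θ^[r * i] ω))) / m < a₁ * r :=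
      (Finset.eventually_all _).2 fun i _ => (hω i).eventually_lt_const ha₁
    filter_upwards [h1, eventually_gt_atTop 0] with m hm hm0
    have hm' : (0 : ℝ) < m := by exact_mod_cast hm0
    refine (hblock m).trans ((Finset.sum_le_card_nsmul _ _ (m * (a₁ * r)) fun i hi => ?_).trans
      (le_of_eq (by rw [Finset.card_range, nsmul_eq_mul])))
    have := hm i hi
    rw [div_lt_iff₀ hm'] at this
    linarith
  have hdiv : Tendsto (fun M : ℕ => M / (r * q)) atTop atTop :=
    Nat.tendsto_div_const_atTop (Nat.mul_pos hr hq).ne'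
  have hbig : ∀ᶠ M : ℕ in atTop, C * (r * q) ≤ (a - a₁) * M :=
    (tendsto_natCast_atTop_atTop.const_mul_atTop (by linarith : 0 < a - a₁)).eventually_ge_atTop _
  filter_upwards [hdiv.eventually hevm, hbig] with M h1 h2
  have h3 := hsub (r * q * (M / (r * q))) (M % (r * q)) ω
  rw [Nat.div_add_mod] at h3
  have h4 := hC (M % (r * q)) (θ^[r * q * (M / (r * q))] ω)
  have h5 : ((M % (r * q) : ℕ) : ℝ) ≤ r * q := by
    exact_mod_cast (Nat.mod_lt M (Nat.mul_pos hr hq)).le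
  have h6 : ((r * q * (M / (r * q)) : ℕ) : ℝ) ≤ M := by
    exact_mod_cast Nat.mul_div_le M (r * q)
  push_cast at h6
  have h7 := mul_le_mul_of_nonneg_left h5 hC0
  have h8 := mul_le_mul_of_nonneg_left h6 ha₁0
  linarith

/-- The subadditive ergodic theorem in the case of finite range dependence. -/
theorem tendsto_div_of_indepFun (hθ : MeasurePreserving θ P P)
    (hX : ∀ m, Measurable (X m)) (h0 : ∀ m ω, 0 ≤ X m ω) (hC : ∀ m ω, X m ω ≤ C * m)
    (hsub : ∀ m l ω, X (m + l) ω ≤ X m ω + X l (θ^[m] ω))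
    (hind : ∀ r, 0 < r → ∃ q, 0 < q ∧ Pairwise fun l l' : ℕ =>
      IndepFun (fun ω => X r (θ^[r * q * l] ω)) (fun ω => X r (θ^[r * q * l'] ω)) P) :
    ∃ γ : ℝ, ∀ᵐ ω ∂P, Tendsto (fun m : ℕ => X m ω / m) atTop (𝓝 γ) := by
  -- The index is shifted to avoid division by zero. The limit is the infimum of the normalized
  -- means: almost surely the upper limit is at most this infimum, while the mean of the lower limit
  -- is at least it.
  set E : ℕ → ℝ := fun r => (∫ ω, X (r + 1) ω ∂P) / (r + 1 : ℕ) with hE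
  have hE0 : ∀ r, 0 ≤ E r := fun r => div_nonneg (integral_nonneg (h0 _)) (Nat.cast_nonneg _)
  have hEb : BddBelow (Set.range E) := ⟨0, by rintro _ ⟨r, rfl⟩; exact hE0 r⟩
  refine ⟨⨅ r, E r, ?_⟩
  set γ := ⨅ r, E r with hγ
  have hγm : ∀ m : ℕ, γ * m ≤ ∫ ω, X m ω ∂P := by
    intro m
    rcases m with _ | m
    · simpa using integral_nonneg (h0 0)
    · have h1 : γ ≤ E m := ciInf_le hEb m
      exact (le_div_iff₀ (by positivity)).1 h1
  have hlow := le_integral_liminf_div hθ hX h0 hC hsub hγm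
  have hup : ∀ᵐ ω ∂P, ∀ r a, E r < a → ∀ᶠ M : ℕ in atTop, X M ω ≤ a * M := by
    refine ae_all_iff.2 fun r => ?_
    obtain ⟨q, hq, hq'⟩ := hind (r + 1) r.succ_pos
    exact eventually_le_mul_of_indepFun hθ hX h0 hC hsub r.succ_pos hq hq'
  have hup' : ∀ᵐ ω ∂P, ∀ a, γ < a → ∀ᶠ M : ℕ in atTop, X M ω / M ≤ a := by
    filter_upwards [hup] with ω hω a ha
    obtain ⟨r, hr⟩ := exists_lt_of_ciInf_lt ha
    filter_upwards [hω r a hr, eventually_gt_atTop 0] with M h1 h2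
    rwa [div_le_iff₀ (by exact_mod_cast h2)]
  set g : Ω → ℝ := fun ω => liminf (fun m => X m ω / m) atTop with hg
  have hgm : Measurable g := Measurable.liminf fun m => (hX m).div_const _
  have hgint : Integrable g P := integrable_of_mem_Icc hgm (liminf_div_mem_Icc h0 hC)
  have hgle : ∀ᵐ ω ∂P, g ω ≤ γ := by
    filter_upwards [hup'] with ω hω
    exact le_of_forall_gt_imp_ge_of_dense fun a ha =>
      liminf_le_of_frequently_le (hω a ha).frequently (isBoundedUnder_ge_div h0 hC ω)
  have hgeq : g =ᵐ[P] fun _ => γ := by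
    rw [← integral_eq_iff_of_ae_le hgint (integrable_const _) hgle]
    refine le_antisymm (integral_mono_ae hgint (integrable_const _) hgle) ?_
    simpa using hlow
  filter_upwards [hgeq, hup'] with ω h1 h2
  rw [tendsto_order]
  constructor
  · intro a ha
    exact eventually_lt_of_lt_liminf (by change a < g ω; rwa [h1]) (isBoundedUnder_ge_div h0 hC ω)
  · intro a ha
    obtain ⟨a', ha', ha'a⟩ := exists_between ha
    exact (h2 a' ha').mono fun M hM => hM.trans_lt ha'a

end Subadditive

/-! ### Independence and measurability -/

section Independence

theorem indepFun_of_dependsOn {ι Ω : Type*} [MeasurableSpace Ω] {P : Measure Ω}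
    {G : ι → Ω → ℝ} (hG : iIndepFun G P) (hGm : ∀ i, Measurable (G i)) {S T : Finset ι}
    (hST : Disjoint S T) {Y Z : (ι → ℝ) → ℝ} (hY : Measurable Y) (hZ : Measurable Z)
    (hYS : DependsOn Y (S : Set ι)) (hZT : DependsOn Z (T : Set ι)) :
    IndepFun (fun ω => Y fun i => G i ω) (fun ω => Z fun i => G i ω) P := by
  classical
  let ext (S : Finset ι) (x : S → ℝ) (i : ι) : ℝ := if h : i ∈ S then x ⟨i, h⟩ else 0
  have hext : ∀ S, Measurable (ext S) := fun S => measurable_pi_lambda _ fun i => by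
    by_cases h : i ∈ S
    · simpa [ext, h] using measurable_pi_apply _
    · simp [ext, h]
  have h := (hG.indepFun_finset S T hST hGm).comp (hY.comp (hext S)) (hZ.comp (hext T))
  convert h using 1
  · ext ω
    exact hYS fun i hi => by simp [ext, Finset.mem_coe.1 hi]
  · ext ω
    exact hZT fun i hi => by simp [ext, Finset.mem_coe.1 hi]

end Independence

section Measurability

variable {w w' : ℕ → ℤ → ℝ} {I : Set ℤ} {s t : ℕ} {x y : ℤ}

/-- The cost only involves finitely many values of a walk, so finitely supported walks suffice.
There are countably many of them, which gives measurability of the infimum. -/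
theorem minCost_eq_iInf :
    minCost w I s t x y = ⨅ γ : {g : ℕ →₀ ℤ // IsPath I s t x y g}, pathCost w s t γ.1 := by
  classical
  unfold minCost iInf
  congr 1
  ext a
  constructor
  · rintro ⟨γ, hγ, rfl⟩
    by_cases hst : s ≤ t
    · let g : ℕ →₀ ℤ := Finsupp.onFinset (Finset.range (t + 1)) (fun i => if i ≤ t then γ i else 0)
        fun i hi => by
          by_contra h
          simp only [Finset.mem_range, not_lt] at h
          simp [show ¬ i ≤ t by omega] at hi
      have hg : ∀ i, i ≤ t → g i = γ i := fun i hi => by simp [g, hi]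
      refine ⟨⟨g, ?_, ?_, fun i hi hi' => ?_, fun i hi hi' => ?_⟩, ?_⟩
      · rw [hg _ hst, hγ.1]
      · rw [hg _ le_rfl, hγ.2.1]
      · rw [hg _ hi'.le, hg _ hi']
        exact hγ.2.2.1 i hi hi'
      · rw [hg _ hi']
        exact hγ.2.2.2 i hi hi'
      · exact pathCost_congr fun i _ hi => by rw [hg _ hi]
    · let g : ℕ →₀ ℤ := Finsupp.single s x + Finsupp.single t y
      have hts : t ≠ s := by omega
      refine ⟨⟨g, ?_, ?_, fun i _ _ => by omega, fun i _ _ => by omega⟩, ?_⟩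
      · simp [g, Finsupp.single_eq_of_ne hts.symm]
      · simp [g, Finsupp.single_eq_of_ne hts]
      · exact pathCost_congr fun i _ _ => by omega
  · rintro ⟨⟨g, hg⟩, rfl⟩
    exact ⟨g, hg, rfl⟩

theorem measurable_minCost {Ω : Type*} [MeasurableSpace Ω] {w : Ω → ℕ → ℤ → ℝ}
    (hw : ∀ i x, Measurable fun ω => w ω i x) :
    Measurable fun ω => minCost (w ω) I s t x y := by
  simp only [minCost_eq_iInf]
  exact Measurable.iInf fun γ => Finset.measurable_sum _ fun i _ => hw i _

theorem minCost_congr_of_abs_le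
    (h : ∀ i z, s < i → i ≤ t → |z - x| ≤ t - s → w i z = w' i z) :
    minCost w I s t x y = minCost w' I s t x y := by
  unfold minCost
  congr 1
  refine Set.image_congr fun γ hγ => pathCost_congr fun i h1 h2 => h i _ h1 h2 ?_
  have := IsPath.abs_sub_le hγ h1.le h2
  have h3 : (i : ℤ) ≤ t := by exact_mod_cast h2
  omega

end Measurability

/-! ### The law of the environment and rational directions -/

/-- Environments: the signs `B`, indexed by times, and the potential `F`, indexed by sites. -/
abbrev Env : Type := ℤ ⊕ ℤ → ℝ

/-- The least cost of a walk from `0` to `k` during a time `n`. -/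
noncomputable def envCost (c : ℝ) (ω : Env) (n : ℕ) (k : ℤ) : ℝ :=
  minCost (weight c (fun i => ω (Sum.inl i)) fun x => ω (Sum.inr x)) Set.univ 0 n 0 k

/-- The space-time shift of environments. -/
def envShift (n k : ℤ) (ω : Env) : Env := fun i => ω (Sum.map (· + n) (· + k) i)

/-- The law of a fair sign. -/
noncomputable def coinLaw : Measure ℝ :=
  (1 / 2 : ENNReal) • Measure.dirac 1 + (1 / 2 : ENNReal) • Measure.dirac (-1)

instance : IsProbabilityMeasure coinLaw := ⟨by simp [coinLaw, ENNReal.inv_two_add_inv_two]⟩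

/-- The marginals of the law of the environment. -/
noncomputable def envMarginal (ν : Measure ℝ) : ℤ ⊕ ℤ → Measure ℝ :=
  Sum.elim (fun _ => coinLaw) fun _ => ν

instance (ν : Measure ℝ) [IsProbabilityMeasure ν] (i : ℤ ⊕ ℤ) :
    IsProbabilityMeasure (envMarginal ν i) := by
  rcases i with i | i
  · exact inferInstanceAs (IsProbabilityMeasure coinLaw)
  · exact inferInstanceAs (IsProbabilityMeasure ν)

/-- The law of the environment. -/
noncomputable def envLaw (ν : Measure ℝ) [IsProbabilityMeasure ν] : Measure Env :=
  Measure.infinitePi (envMarginal ν)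

section EnvCost

variable {c : ℝ} {ω ω' : Env} {n m : ℕ} {k l : ℤ}

theorem envCost_nonneg : 0 ≤ envCost c ω n k := minCost_nonneg weight_nonneg

theorem envCost_le (hc : 0 ≤ c) (hk : |k| ≤ n) : envCost c ω n k ≤ 2 * c * n := by
  obtain ⟨γ, hγ⟩ := isPath_univ (s := 0) (t := n) (x := 0) (y := k) (by simpa using hk)
  simpa [envCost] using minCost_le_mul weight_nonneg (weight_le hc) hγ (Nat.zero_le n)

theorem minCost_weight_eq_envCost (n m : ℕ) (k l : ℤ) :
    minCost (weight c (fun i => ω (Sum.inl i)) fun x => ω (Sum.inr x)) Set.univ n (n + m) k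
      (k + l) = envCost c (envShift n k ω) m l := by
  have h := minCost_shift (w := weight c (fun i => ω (Sum.inl i)) fun x => ω (Sum.inr x))
    (I := Set.univ) (I₁ := Set.univ) (s := 0) (t := m) (x := 0) (y := l) n k (by simp)
  rw [zero_add, zero_add, add_comm m n, add_comm l k] at h
  rw [← h, envCost]
  rfl

theorem envCost_add_le (hk : |k| ≤ n) (hl : |l| ≤ m) :
    envCost c ω (n + m) (k + l) ≤ envCost c ω n k + envCost c (envShift n k ω) m l := by
  rw [← minCost_weight_eq_envCost]
  obtain ⟨γ, hγ⟩ := isPath_univ (s := 0) (t := n) (x := 0) (y := k) (by simpa using hk)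
  obtain ⟨γ', hγ'⟩ := isPath_univ (s := n) (t := n + m) (x := k) (y := k + l) (by simpa using hl)
  exact minCost_triangle weight_nonneg (Nat.zero_le _) (Nat.le_add_right _ _) hγ hγ' le_rfl le_rfl

theorem envCost_le_add (hc : 0 ≤ c) (hk : |k| ≤ n) (hnm : n ≤ m) (hl : |l - k| ≤ (m : ℤ) - n) :
    envCost c ω m l ≤ envCost c ω n k + 2 * c * (m - n) := by
  have h := envCost_add_le (c := c) (ω := ω) (n := n) (m := m - n) (k := k) (l := l - k) hk
    (by rw [Nat.cast_sub hnm]; exact hl)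
  rw [Nat.add_sub_cancel' hnm, add_sub_cancel] at h
  have h2 := envCost_le (c := c) (ω := envShift n k ω) (n := m - n) (k := l - k) hc
    (by rw [Nat.cast_sub hnm]; exact hl)
  rw [Nat.cast_sub hnm] at h2
  linarith

theorem measurable_envCost (c : ℝ) (n : ℕ) (k : ℤ) : Measurable fun ω => envCost c ω n k :=
  measurable_minCost fun i x => by unfold weight; fun_prop

/-- The times and sites on which `envCost c ω n k` depends. -/
noncomputable def envBox (n : ℕ) : Finset (ℤ ⊕ ℤ) :=
  (Finset.Icc 1 (n : ℤ)).disjSum (Finset.Icc (-(n : ℤ)) n)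

theorem envCost_congr (h : ∀ i ∈ envBox n, ω i = ω' i) : envCost c ω n k = envCost c ω' n k := by
  refine minCost_congr_of_abs_le fun i z hi hi' hz => ?_
  have h1 : ω (Sum.inl i) = ω' (Sum.inl i) := h _ (by simp [envBox]; omega)
  have h2 : ω (Sum.inr z) = ω' (Sum.inr z) := h _ (by
    simp only [sub_zero, Nat.cast_zero] at hz
    simpa [envBox] using abs_le.1 hz)
  simp [weight, h1, h2]

end EnvCost

section EnvLaw

variable {ν : Measure ℝ} [IsProbabilityMeasure ν]

instance : IsProbabilityMeasure (envLaw ν) :=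
  inferInstanceAs (IsProbabilityMeasure (Measure.infinitePi _))

theorem measurePreserving_reindex (e : ℤ ⊕ ℤ → ℤ ⊕ ℤ) (he : Function.Injective e)
    (hν : ∀ i, envMarginal ν (e i) = envMarginal ν i) :
    MeasurePreserving (fun (ω : Env) i => ω (e i)) (envLaw ν) (envLaw ν) := by
  refine ⟨by fun_prop, ?_⟩
  rw [envLaw, Measure.map_infinitePi_infinitePi_of_inj he]
  congr 1
  funext i
  exact hν i

theorem measurePreserving_envShift (n k : ℤ) :
    MeasurePreserving (envShift n k) (envLaw ν) (envLaw ν) :=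
  measurePreserving_reindex _ (Function.Injective.sumMap (add_left_injective n)
    (add_left_injective k)) fun i => by rcases i with i | i <;> rfl

theorem measurePreserving_envReflect :
    MeasurePreserving (fun (ω : Env) i => ω (Sum.map id Neg.neg i)) (envLaw ν) (envLaw ν) :=
  measurePreserving_reindex _ (Function.injective_id.sumMap neg_injective)
    fun i => by rcases i with i | i <;> rfl

theorem measurePreserving_envFlip (s : ℤ → ℝ) (hs : ∀ i, s i = 1 ∨ s i = -1) :
    MeasurePreserving (fun (ω : Env) i => Sum.elim s (fun _ => 1) i * ω i) (envLaw ν)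
      (envLaw ν) := by
  refine ⟨by fun_prop, ?_⟩
  have h := Measure.infinitePi_map_pi (μ := envMarginal ν)
    (f := fun i (x : ℝ) => Sum.elim s (fun _ => 1) i * x) fun i => measurable_const_mul _
  rw [envLaw, h]
  congr 1
  funext i
  rcases i with i | i
  · change coinLaw.map (fun x => s i * x) = coinLaw
    rcases hs i with h1 | h1
    · rw [h1]; simp
    · rw [h1, coinLaw, Measure.map_add _ _ (measurable_const_mul _), Measure.map_smul,
        Measure.map_smul, Measure.map_dirac' (measurable_const_mul _),
        Measure.map_dirac' (measurable_const_mul _), add_comm]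
      norm_num
  · change ν.map (fun x => 1 * x) = ν
    simp

theorem iIndepFun_env : iIndepFun (fun i (ω : Env) => ω i) (envLaw ν) :=
  iIndepFun_infinitePi (X := fun _ x => x) fun _ => measurable_id

theorem iterate_envShift (n k : ℤ) (j : ℕ) : (envShift n k)^[j] = envShift (j * n) (j * k) := by
  induction j with
  | zero => ext ω i; rcases i with i | i <;> simp [envShift]
  | succ j ih =>
    ext ω i
    rw [Function.iterate_succ_apply', ih]
    rcases i with i | i <;> simp only [envShift, Sum.map_inl, Sum.map_inr] <;> congr 2 <;>
      push_cast <;> ring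

/-- Almost sure linear growth of the least cost in rational directions. -/
theorem exists_tendsto_envCost {c : ℝ} (hc : 0 ≤ c) {n : ℕ} {k : ℤ} (hk : k ≠ 0) (hkn : |k| ≤ n) :
    ∃ γ : ℝ, ∀ᵐ ω ∂envLaw ν,
      Tendsto (fun m : ℕ => envCost c ω (m * n) (m * k) / m) atTop (𝓝 γ) := by
  have hmk : ∀ m : ℕ, |(m : ℤ) * k| ≤ (m * n : ℕ) := fun m => by
    rw [abs_mul, Nat.abs_cast]
    push_cast
    gcongr
  refine tendsto_div_of_indepFun (C := 2 * c * n) (measurePreserving_envShift (ν := ν) n k)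
    (fun m => measurable_envCost c _ _) (fun m ω => envCost_nonneg) (fun m ω => ?_)
    -- With `q = 2 n + 1` distinct blocks in a class use disjoint times and disjoint sites: a block
    -- of duration `r n` sees sites within distance `r n` of its start, and starts are at least `r
    -- (2 n + 1) |k|` apart. This needs `k ≠ 0`, because `F` does not depend on time.
    (fun m l ω => ?_) fun r hr => ⟨2 * n + 1, by omega, fun l l' hll => ?_⟩
  · refine (envCost_le hc (hmk m)).trans (le_of_eq ?_)
    push_cast
    ring
  · rw [iterate_envShift]
    have h := envCost_add_le (c := c) (ω := ω) (hmk m) (hmk l)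
    push_cast at h
    rwa [← add_mul, ← add_mul] at h
  · simp only [iterate_envShift]
    set S : ℕ → Finset (ℤ ⊕ ℤ) := fun l => (envBox (r * n)).map
      ⟨Sum.map (· + ((r * (2 * n + 1) * l : ℕ) : ℤ) * (n : ℤ))
        (· + ((r * (2 * n + 1) * l : ℕ) : ℤ) * k),
        (add_left_injective _).sumMap (add_left_injective _)⟩ with hS
    have hdep : ∀ l : ℕ, DependsOn (fun ω : Env => envCost c
        (envShift (((r * (2 * n + 1) * l : ℕ) : ℤ) * (n : ℤ)) (((r * (2 * n + 1) * l : ℕ) : ℤ) * k)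
          ω) (r * n) (r * k)) (S l : Set (ℤ ⊕ ℤ)) := fun l ω ω' h => by
      refine envCost_congr fun i hi => h _ ?_
      exact Finset.mem_coe.2 (Finset.mem_map_of_mem _ hi)
    refine indepFun_of_dependsOn (iIndepFun_env (ν := ν)) (fun i => measurable_pi_apply i) ?_
      ((measurable_envCost c _ _).comp (measurePreserving_envShift (ν := ν) _ _).measurable)
      ((measurable_envCost c _ _).comp (measurePreserving_envShift (ν := ν) _ _).measurable)
      (hdep l) (hdep l')
    rw [Finset.disjoint_left]
    rintro _ hj hj'
    obtain ⟨i, hi, rfl⟩ := Finset.mem_map.1 hj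
    obtain ⟨i', hi', h⟩ := Finset.mem_map.1 hj'
    have hn0 : 0 < (n : ℤ) := (abs_pos.2 hk).trans_le hkn
    have hr0 : 0 < (r : ℤ) := by exact_mod_cast hr
    have hd : 1 ≤ |(l : ℤ) - l'| := Int.one_le_abs (sub_ne_zero.2 (by exact_mod_cast hll))
    rcases i with i | i <;> rcases i' with i' | i' <;>
      simp only [Function.Embedding.coeFn_mk, Sum.map_inl, Sum.map_inr, reduceCtorEq,
        Sum.inl.injEq, Sum.inr.injEq] at h
    · simp only [envBox, Finset.inl_mem_disjSum, Finset.mem_Icc] at hi hi'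
      push_cast at h hi hi'
      have h1 : i' - i = (r * n) * ((2 * n + 1) * ((l : ℤ) - l')) := by linear_combination h
      have h2 : |i' - i| < r * n := by rw [abs_lt]; constructor <;> linarith
      rw [h1, abs_mul, abs_of_pos (by positivity : 0 < (r : ℤ) * n), abs_mul,
        abs_of_pos (by positivity : 0 < 2 * (n : ℤ) + 1)] at h2
      have h3 : (r : ℤ) * n * 1 ≤ r * n * ((2 * n + 1) * |(l : ℤ) - l'|) := by
        gcongr
        nlinarith
      linarith
    · simp only [envBox, Finset.inr_mem_disjSum, Finset.mem_Icc] at hi hi'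
      push_cast at h hi hi'
      have h1 : i' - i = r * ((2 * n + 1) * (((l : ℤ) - l') * k)) := by linear_combination h
      have h2 : |i' - i| ≤ r * (2 * n) := by rw [abs_le]; constructor <;> linarith
      rw [h1, abs_mul, abs_mul, abs_mul, abs_of_pos hr0,
        abs_of_pos (by positivity : 0 < 2 * (n : ℤ) + 1)] at h2
      have h4 : 1 ≤ |k| := Int.one_le_abs hk
      have h5 := le_of_mul_le_mul_left h2 hr0
      have h6 : 1 ≤ |(l : ℤ) - l'| * |k| := by nlinarith
      nlinarith

end EnvLaw

/-! ### From rational to arbitrary directions -/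

section IntPart

theorem abs_intPart_sub_le (x : ℝ) : |(intPart x : ℝ) - x| ≤ 1 := by
  unfold intPart
  split_ifs
  · rw [abs_le]
    constructor <;> linarith [Int.floor_le x, Int.lt_floor_add_one x]
  · push_cast
    rw [abs_le]
    constructor <;> linarith [Int.floor_le (-x), Int.lt_floor_add_one (-x)]

theorem intPart_neg (x : ℝ) : intPart (-x) = -intPart x := by
  unfold intPart
  rcases lt_trichotomy x 0 with h | rfl | h
  · rw [if_pos (by linarith), if_neg (by linarith), neg_neg]
  · simp
  · rw [if_neg (by linarith), if_pos h.le, neg_neg]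

theorem intPart_of_nonneg {x : ℝ} (h : 0 ≤ x) : intPart x = ⌊x⌋ := if_pos h

theorem intPart_natCast (n : ℕ) : intPart n = n := by
  rw [intPart_of_nonneg (Nat.cast_nonneg n), Int.floor_natCast]

theorem abs_intPart_mul_le {α : ℝ} (hα : |α| ≤ 1) (n : ℕ) : |intPart (α * n)| ≤ n := by
  have key : ∀ α : ℝ, 0 ≤ α → α ≤ 1 → |intPart (α * n)| ≤ n := by
    intro α h0 h1
    have hn : 0 ≤ α * n := by positivity
    rw [intPart_of_nonneg hn, abs_of_nonneg (Int.floor_nonneg.2 hn)]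
    have : (⌊α * n⌋ : ℝ) ≤ n := (Int.floor_le _).trans (by nlinarith [(Nat.cast_nonneg n : (0:ℝ) ≤ n)])
    exact_mod_cast this
  rcases le_total 0 α with h | h
  · exact key α h (abs_le.1 hα).2
  · have := key (-α) (by linarith) (by linarith [(abs_le.1 hα).1])
    rwa [neg_mul, intPart_neg, abs_neg] at this

end IntPart

section Sandwich

/-- The factor `1 - |k / n|` is the speed left over for corrections by a walk in direction `k / n`.
Slope `0` is avoided since it lies outside the ergodic argument. -/
theorem exists_rational_slope {α η : ℝ} (hα : |α| < 1) (hη : 0 < η) (hη1 : η ≤ 1) :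
    ∃ (n : ℕ) (k : ℤ), 0 < n ∧ k ≠ 0 ∧ |(k : ℝ) / n| < 1 ∧
      |α - k / n| < η * (1 - |(k : ℝ) / n|) := by
  set δ := η * (1 - |α|) / 4 with hδ
  have h1 : 0 < 1 - |α| := by linarith
  have hδ0 : 0 < δ := by positivity
  obtain ⟨q, hq0, hq1, hq2⟩ : ∃ q : ℚ, q ≠ 0 ∧ α < q ∧ (q : ℝ) < α + δ := by
    obtain ⟨q, hq1, hq2⟩ := exists_rat_btwn (show α < α + δ by linarith)
    by_cases hq : q = 0
    · obtain ⟨q', hq1', hq2'⟩ := exists_rat_btwn hq2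
      rw [hq, Rat.cast_zero] at hq1 hq1'
      exact ⟨q', by rintro rfl; simp at hq1', by linarith, hq2'⟩
    · exact ⟨q, hq, hq1, hq2⟩
  have h5 : δ ≤ (1 - |α|) / 4 := by rw [hδ]; nlinarith
  have hqc : (q.num : ℝ) / q.den = q := (Rat.cast_def q).symm
  refine ⟨q.den, q.num, q.den_pos, by simpa using hq0, ?_, ?_⟩
  all_goals rw [hqc]
  all_goals
    have h2 : |(q : ℝ)| < |α| + δ := by
      have : |(q : ℝ) - α| < δ := by rw [abs_lt]; constructor <;> linarith
      linarith [abs_sub_abs_le_abs_sub (q : ℝ) α]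
  · linarith
  · have h3 : |α - q| < δ := by rw [abs_lt]; constructor <;> linarith
    have h4 : η * (1 - |α| - δ) ≤ η * (1 - |(q : ℝ)|) :=
      mul_le_mul_of_nonneg_left (by linarith) hη.le
    nlinarith

/-- A time difference of at least `η n` suffices to correct the position: the drift of slope `k₀ /
n₀` uses a fraction of it, and the rest covers the difference of the slopes and the rounding error
`1`. -/
theorem abs_intPart_sub_mul_le {α η : ℝ} {n₀ m N n : ℕ} {k₀ : ℤ} (hn₀ : 0 < n₀) (hη : 0 < η)
    (hα : |α - k₀ / n₀| < η * (1 - |(k₀ : ℝ) / n₀|))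
    (hn : 1 ≤ (η * (1 - |(k₀ : ℝ) / n₀|) - |α - k₀ / n₀|) * n)
    (hN : η * n ≤ |(m * n₀ : ℝ) - n|) (hd : |((m * n₀ : ℕ) : ℤ) - n| = N) :
    |intPart (α * n) - m * k₀| ≤ N := by
  set α' : ℝ := k₀ / n₀ with hα'
  have hn₀' : (0 : ℝ) < n₀ := by exact_mod_cast hn₀
  have hmk : (m * k₀ : ℝ) = α' * (m * n₀) := by rw [hα']; field_simp
  have hd' : |(m * n₀ : ℝ) - n| = N := by exact_mod_cast hd
  have h0 : 0 < 1 - |α'| := by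
    by_contra! h
    nlinarith [abs_nonneg (α - α')]
  have h1 : |(intPart (α * n) : ℝ) - m * k₀| ≤ N := by
    have h2 : (intPart (α * n) : ℝ) - m * k₀ =
        (intPart (α * n) - α * n) + (α - α') * n - α' * (m * n₀ - n) := by rw [hmk]; ring
    rw [h2]
    have h3 := abs_intPart_sub_le (α * n)
    have h4 : |(α - α') * n| = |α - α'| * n := by rw [abs_mul, Nat.abs_cast]
    have h5 : |α' * (m * n₀ - n)| = |α'| * N := by rw [abs_mul, hd']
    have h6 := abs_sub (intPart (α * n) - α * n + (α - α') * n) (α' * (m * n₀ - n))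
    have h7 := abs_add_le (intPart (α * n) - α * n) ((α - α') * n)
    rw [hd'] at hN
    have h8 : (1 - |α'|) * (η * n) ≤ (1 - |α'|) * N := by gcongr
    nlinarith
  exact_mod_cast h1

/-- The asymptotics in nearby rational directions determine the asymptotics in any direction, up to
a small error. -/
theorem eventually_abs_div_sub_le {V : ℕ → ℤ → ℝ} {D α ε η γ : ℝ} {n₀ : ℕ} {k₀ : ℤ} (hD : 0 ≤ D)
    (hV : ∀ (n m : ℕ) (k l : ℤ), |k| ≤ (n : ℤ) → n ≤ m → |l - k| ≤ (m : ℤ) - n →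
      V m l ≤ V n k + D * (m - n))
    (hα : |α| ≤ 1) (hη : 0 < η) (hη1 : η ≤ 1 / 2) (hε : 0 < ε) (hDη : D * η ≤ ε / 4)
    (hn₀ : 0 < n₀) (hk₀ : |(k₀ : ℝ) / n₀| < 1)
    (hαk : |α - k₀ / n₀| < η * (1 - |(k₀ : ℝ) / n₀|)) (hγ0 : 0 ≤ γ)
    (hγ : Tendsto (fun m : ℕ => V (m * n₀) (m * k₀) / m) atTop (𝓝 γ)) :
    ∀ᶠ n : ℕ in atTop, |V n (intPart (α * n)) / n - γ / n₀| ≤ ε := by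
  have hn₀' : (0 : ℝ) < n₀ := by exact_mod_cast hn₀
  have hk₀' : |k₀| ≤ n₀ := by
    rw [abs_div, Nat.abs_cast, div_lt_one hn₀'] at hk₀
    exact_mod_cast hk₀.le
  have hmk : ∀ m : ℕ, |(m : ℤ) * k₀| ≤ ((m * n₀ : ℕ) : ℤ) := fun m => by
    rw [abs_mul, Nat.abs_cast]
    push_cast
    gcongr
  set ε₁ := ε * n₀ / 16 with hε₁
  have hε₁0 : 0 < ε₁ := by positivity
  have hev : ∀ᶠ m : ℕ in atTop, m * (γ - ε₁) ≤ V (m * n₀) (m * k₀) ∧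
      V (m * n₀) (m * k₀) ≤ m * (γ + ε₁) := by
    filter_upwards [hγ.eventually (Icc_mem_nhds (by linarith : γ - ε₁ < γ)
      (by linarith : γ < γ + ε₁)), eventually_gt_atTop 0] with m hm hm0
    have hm0' : (0 : ℝ) < m := by exact_mod_cast hm0
    rw [le_div_iff₀ hm0', div_le_iff₀ hm0'] at hm
    constructor <;> linarith
  have htend : ∀ a : ℝ, 0 < a → Tendsto (fun n : ℕ => a * (n : ℝ) / n₀) atTop atTop := fun a ha =>
    (tendsto_natCast_atTop_atTop.const_mul_atTop ha).atTop_div_const hn₀'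
  -- The time `n` is enclosed between multiples of `n₀` near `(1 - η) n` and `(1 + η) n`.
  have hfloor := (tendsto_nat_floor_atTop.comp (htend (1 - η) (by linarith))).eventually hev
  have hceil := (tendsto_nat_ceil_atTop.comp (htend (1 + η) (by linarith))).eventually hev
  have hlarge : ∀ a b : ℝ, 0 < a → ∀ᶠ n : ℕ in atTop, b ≤ a * n := fun a b ha =>
    (tendsto_natCast_atTop_atTop.const_mul_atTop ha).eventually_ge_atTop b
  filter_upwards [hfloor, hceil, eventually_gt_atTop 0, hlarge (ε / 4) (D * n₀) (by linarith),
    hlarge (η * (1 - |(k₀ : ℝ) / n₀|) - |α - k₀ / n₀|) 1 (by linarith),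
    hlarge (1 / n₀) 1 (by positivity)]
    with n h1 h2 hn hn1 hn2 hn3
  have hn' : (0 : ℝ) < n := by exact_mod_cast hn
  simp only [Function.comp_apply] at h1 h2
  set p := ⌊(1 - η) * (n : ℝ) / n₀⌋₊
  set r := ⌈(1 + η) * (n : ℝ) / n₀⌉₊
  have hp : (p : ℝ) * n₀ ≤ (1 - η) * n := by
    rw [← le_div_iff₀ hn₀']
    exact Nat.floor_le (div_nonneg (mul_nonneg (by linarith) hn'.le) hn₀'.le)
  have hp' : (1 - η) * n ≤ p * n₀ + n₀ := by
    have : (1 - η) * (n : ℝ) / n₀ < p + 1 := Nat.lt_floor_add_one _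
    rw [div_lt_iff₀ hn₀'] at this
    linarith
  have hr : (1 + η) * n ≤ r * n₀ := by
    rw [← div_le_iff₀ hn₀']
    exact Nat.le_ceil _
  have hr' : (r : ℝ) * n₀ ≤ (1 + η) * n + n₀ := by
    have : (r : ℝ) < (1 + η) * n / n₀ + 1 :=
      Nat.ceil_lt_add_one (div_nonneg (mul_nonneg (by linarith) hn'.le) hn₀'.le)
    rw [← sub_lt_iff_lt_add, lt_div_iff₀ hn₀'] at this
    linarith
  have hηn : 0 ≤ η * n := by positivity
  have hpn : p * n₀ ≤ n := by
    have : (p : ℝ) * n₀ ≤ n := by linarith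
    exact_mod_cast this
  have hrn : n ≤ r * n₀ := by
    have : (n : ℝ) ≤ r * n₀ := by linarith
    exact_mod_cast this
  have hup := hV (p * n₀) n (p * k₀) (intPart (α * n)) (hmk p) hpn (by
    have := abs_intPart_sub_mul_le (N := n - p * n₀) hn₀ hη hαk hn2 (m := p)
      (by rw [abs_of_nonpos (by linarith)]; linarith)
      (by rw [abs_of_nonpos (sub_nonpos.2 (by exact_mod_cast hpn)),
        Nat.cast_sub hpn]; ring)
    rwa [Nat.cast_sub hpn] at this)
  have hlow := hV n (r * n₀) (intPart (α * n)) (r * k₀) (abs_intPart_mul_le hα n) hrn (by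
    have := abs_intPart_sub_mul_le (N := r * n₀ - n) hn₀ hη hαk hn2 (m := r)
      (by rw [abs_of_nonneg (by linarith)]; linarith)
      (by rw [abs_of_nonneg (sub_nonneg.2 (by exact_mod_cast hrn)),
        Nat.cast_sub hrn])
    rwa [Nat.cast_sub hrn, abs_sub_comm] at this)
  push_cast at hup hlow
  have hng : (n : ℝ) * (γ / n₀) = n / n₀ * γ := by ring
  have hne : (n : ℝ) / n₀ * ε₁ = n * ε / 16 := by rw [hε₁]; field_simp
  have hDn : D * (η * n) ≤ ε / 4 * n := by rw [← mul_assoc]; gcongr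
  have hεn : 0 ≤ ε * n := by positivity
  have hpn' : (p : ℝ) ≤ n / n₀ := by rw [le_div_iff₀ hn₀']; linarith
  have hrn' : (n : ℝ) / n₀ ≤ r := by rw [div_le_iff₀ hn₀']; linarith
  have hrn'' : (r : ℝ) ≤ 3 * (n / n₀) := by
    have : (r : ℝ) ≤ (1 + η) * n / n₀ + 1 := by
      rw [← sub_le_iff_le_add, le_div_iff₀ hn₀']; linarith
    have h3 : (1 + η) * n / n₀ = (1 + η) * (n / n₀) := by ring
    have h4 : 1 / (n₀ : ℝ) * n = n / n₀ := by ring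
    rw [h3] at this
    rw [h4] at hn3
    nlinarith
  rw [abs_le, sub_le_iff_le_add, le_sub_iff_add_le, div_le_iff₀ hn', le_div_iff₀ hn']
  constructor
  · have h3 : (n : ℝ) / n₀ * γ ≤ r * γ := by gcongr
    have h4 : (r : ℝ) * ε₁ ≤ 3 * (n / n₀) * ε₁ := by gcongr
    have h5 : D * (r * n₀ - n) ≤ D * (η * n + n₀) := by gcongr; linarith
    have h6 : D * (η * n + n₀) = D * (η * n) + D * n₀ := by ring
    linarith [h2.1]
  · have h3 : (p : ℝ) * (γ + ε₁) ≤ n / n₀ * (γ + ε₁) := by gcongr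
    have h5 : D * (n - p * n₀) ≤ D * (η * n + n₀) := by gcongr; linarith
    have h6 : D * (η * n + n₀) = D * (η * n) + D * n₀ := by ring
    linarith [h1.2]

end Sandwich

section Shape

variable {ν : Measure ℝ} [IsProbabilityMeasure ν]

/-- The linear growth rate of the least cost exists in all directions simultaneously. -/
theorem exists_envCost_shape {c : ℝ} (hc : 0 ≤ c) :
    ∃ h : ℝ → ℝ, ∀ᵐ ω ∂envLaw ν, ∀ α ∈ Set.Icc (-1 : ℝ) 1,
      Tendsto (fun n : ℕ => envCost c ω n (intPart (α * n)) / n) atTop (𝓝 (h α)) := by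
  have hγ : ∀ (n : ℕ) (k : ℤ), ∃ γ : ℝ, k ≠ 0 → |k| ≤ n → ∀ᵐ ω ∂envLaw ν,
      Tendsto (fun m : ℕ => envCost c ω (m * n) (m * k) / m) atTop (𝓝 γ) := fun n k => by
    by_cases h : k ≠ 0 ∧ |k| ≤ n
    · obtain ⟨γ, hγ⟩ := exists_tendsto_envCost (ν := ν) hc h.1 h.2
      exact ⟨γ, fun _ _ => hγ⟩
    · exact ⟨0, fun h1 h2 => absurd ⟨h1, h2⟩ h⟩
  choose γ hγ using hγ
  have hgood : ∀ᵐ ω ∂envLaw ν, ∀ (n : ℕ) (k : ℤ), k ≠ 0 → |k| ≤ n →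
      Tendsto (fun m : ℕ => envCost c ω (m * n) (m * k) / m) atTop (𝓝 (γ n k)) := by
    simp only [ae_all_iff]
    exact hγ
  obtain ⟨ω₀, hω₀⟩ := hgood.exists
  have happrox : ∀ α, |α| < 1 → ∀ ε > 0, ∃ a : ℝ, ∀ ω, (∀ (n : ℕ) (k : ℤ), k ≠ 0 → |k| ≤ n →
      Tendsto (fun m : ℕ => envCost c ω (m * n) (m * k) / m) atTop (𝓝 (γ n k))) →
      ∀ᶠ n : ℕ in atTop, |envCost c ω n (intPart (α * n)) / n - a| ≤ ε := by
    intro α hα ε hε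
    set η := min (1 / 2) (ε / (4 * (2 * c + 1))) with hη
    have hη0 : 0 < η := lt_min (by norm_num) (by positivity)
    have hη1 : η ≤ 1 / 2 := min_le_left _ _
    have hη2 : 2 * c * η ≤ ε / 4 := by
      have h1 : η ≤ ε / (4 * (2 * c + 1)) := min_le_right _ _
      rw [le_div_iff₀ (by positivity)] at h1
      nlinarith
    obtain ⟨n, k, hn, hk, hkn, hαk⟩ := exists_rational_slope hα hη0 (by linarith)
    refine ⟨γ n k / n, fun ω hω => ?_⟩
    have hkn' : |k| ≤ n := by
      rw [abs_div, Nat.abs_cast, div_lt_one (by exact_mod_cast hn)] at hkn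
      exact_mod_cast hkn.le
    refine eventually_abs_div_sub_le (V := envCost c ω) (D := 2 * c) (by positivity)
      (fun n m k l h1 h2 h3 => envCost_le_add hc h1 h2 h3) hα.le hη0 hη1 hε hη2 hn hkn hαk ?_
      (hω n k hk hkn')
    exact ge_of_tendsto' (hω n k hk hkn') fun m => div_nonneg envCost_nonneg (Nat.cast_nonneg m)
  have hconv : ∀ α ∈ Set.Icc (-1 : ℝ) 1, ∃ a : ℝ, ∀ ω, (∀ (n : ℕ) (k : ℤ), k ≠ 0 → |k| ≤ n →
      Tendsto (fun m : ℕ => envCost c ω (m * n) (m * k) / m) atTop (𝓝 (γ n k))) →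
      Tendsto (fun n : ℕ => envCost c ω n (intPart (α * n)) / n) atTop (𝓝 a) := by
    intro α hα
    rcases hα.1.eq_or_lt with rfl | h1
    -- At slope `±1` no speed is left for corrections, but these directions are themselves rational.
    · refine ⟨γ 1 (-1), fun ω hω => (hω 1 (-1) (by simp) (by simp)).congr fun n => ?_⟩
      rw [neg_one_mul, intPart_neg, intPart_natCast, mul_one, mul_neg_one]
    rcases hα.2.eq_or_lt with rfl | h2
    · refine ⟨γ 1 1, fun ω hω => (hω 1 1 (by simp) (by simp)).congr fun n => ?_⟩
      rw [one_mul, intPart_natCast, mul_one, mul_one]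
    have hα' : |α| < 1 := abs_lt.2 ⟨h1, h2⟩
    -- The limit is read off from one reference environment `ω₀`; the approximants do not depend on
    -- the environment, so all good environments share it.
    have hcauchy : CauchySeq fun n : ℕ => envCost c ω₀ n (intPart (α * n)) / n := by
      rw [Metric.cauchySeq_iff']
      intro ε hε
      obtain ⟨a, ha⟩ := happrox α hα' (ε / 3) (by positivity)
      obtain ⟨N, hN⟩ := eventually_atTop.1 (ha ω₀ hω₀)
      refine ⟨N, fun n hn => ?_⟩
      have h3 := hN n hn
      have h4 := hN N le_rfl
      rw [abs_sub_comm] at h4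
      rw [Real.dist_eq]
      refine (abs_sub_le _ a _).trans_lt ?_
      linarith
    obtain ⟨a, ha⟩ := cauchySeq_tendsto_of_complete hcauchy
    refine ⟨a, fun ω hω => ?_⟩
    rw [Metric.tendsto_nhds]
    intro ε hε
    obtain ⟨b, hb⟩ := happrox α hα' (ε / 4) (by positivity)
    filter_upwards [hb ω hω, hb ω₀ hω₀, Metric.tendsto_nhds.1 ha (ε / 4) (by positivity)]
      with n h3 h4 h5
    rw [Real.dist_eq] at h5 ⊢
    rw [abs_sub_comm] at h4
    have h6 := abs_sub_le (envCost c ω n (intPart (α * n)) / n) b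
      (envCost c ω₀ n (intPart (α * n)) / n)
    have h7 := abs_sub_le (envCost c ω n (intPart (α * n)) / n)
      (envCost c ω₀ n (intPart (α * n)) / n) a
    linarith
  choose! h hh using hconv
  exact ⟨h, hgood.mono fun ω hω α hα => hh α hα ω hω⟩

end Shape

/-! ### Properties of the growth rate -/

/-- `h` gives the linear growth rate of the least cost in all directions. -/
def IsEnvShape (ν : Measure ℝ) [IsProbabilityMeasure ν] (c : ℝ) (h : ℝ → ℝ) : Prop :=
  ∀ᵐ ω ∂envLaw ν, ∀ α ∈ Set.Icc (-1 : ℝ) 1,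
    Tendsto (fun n : ℕ => envCost c ω n (intPart (α * n)) / n) atTop (𝓝 (h α))

section Marginals

variable {ν : Measure ℝ} [IsProbabilityMeasure ν]

theorem map_eval_envLaw (i : ℤ ⊕ ℤ) : (envLaw ν).map (fun ω => ω i) = envMarginal ν i :=
  Measure.infinitePi_map_eval _ i

theorem ae_envLaw_inl : ∀ᵐ ω ∂envLaw ν, ∀ i, ω (Sum.inl i) = 1 ∨ ω (Sum.inl i) = -1 := by
  rw [ae_all_iff]
  intro i
  refine ae_of_ae_map (f := fun ω : Env => ω (Sum.inl i)) (p := fun x => x = 1 ∨ x = -1)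
    (measurable_pi_apply _).aemeasurable ?_
  rw [map_eval_envLaw]
  change ∀ᵐ x ∂coinLaw, x = 1 ∨ x = -1
  rw [coinLaw, ae_add_measure_iff]
  constructor <;> refine Measure.ae_smul_measure ?_ _ <;>
    rw [ae_dirac_iff (by measurability)] <;> simp

theorem ae_envLaw_inr {p : ℝ → Prop} (hp : ∀ᵐ x ∂ν, p x) :
    ∀ᵐ ω ∂envLaw ν, ∀ x, p (ω (Sum.inr x)) := by
  rw [ae_all_iff]
  intro i
  refine ae_of_ae_map (f := fun ω : Env => ω (Sum.inr i)) (p := p)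
    (measurable_pi_apply _).aemeasurable ?_
  rw [map_eval_envLaw]
  exact hp

theorem map_pair_envLaw {x y : ℤ} (hxy : x ≠ y) :
    (envLaw ν).map (fun ω => (ω (Sum.inr x), ω (Sum.inr y))) = ν.prod ν := by
  have h := (iIndepFun_env (ν := ν)).indepFun (i := Sum.inr x) (j := Sum.inr y) (by simpa)
  rw [indepFun_iff_map_prod_eq_prod_map_map (measurable_pi_apply _).aemeasurable
    (measurable_pi_apply _).aemeasurable] at h
  rw [h, map_eval_envLaw, map_eval_envLaw]
  rfl

end Marginals

theorem minCost_neg {w : ℕ → ℤ → ℝ} {s t : ℕ} {x y : ℤ} :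
    minCost (fun i z => w i (-z)) Set.univ s t (-x) (-y) = minCost w Set.univ s t x y := by
  unfold minCost
  congr 1
  have key : ∀ (w : ℕ → ℤ → ℝ) (x y : ℤ),
      pathCost w s t '' {γ | IsPath Set.univ s t x y γ} ⊆
        pathCost (fun i z => w i (-z)) s t '' {γ | IsPath Set.univ s t (-x) (-y) γ} := by
    rintro w x y _ ⟨γ, hγ, rfl⟩
    refine ⟨fun i => -γ i, ⟨congrArg _ hγ.1, congrArg _ hγ.2.1, fun i h1 h2 => ?_, fun _ _ _ => trivial⟩,
      pathCost_congr fun i _ _ => by rw [neg_neg]⟩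
    rw [show -γ (i + 1) - -γ i = -(γ (i + 1) - γ i) by ring, abs_neg]
    exact hγ.2.2.1 i h1 h2
  refine Set.Subset.antisymm ?_ (key w x y)
  have := key (fun i z => w i (-z)) (-x) (-y)
  simpa only [neg_neg] using this

section Expectation

variable {ν : Measure ℝ} [IsProbabilityMeasure ν] {c : ℝ} {h : ℝ → ℝ}

theorem integrable_envCost (hc : 0 ≤ c) {n : ℕ} {k : ℤ} (hk : |k| ≤ n) :
    Integrable (fun ω => envCost c ω n k) (envLaw ν) :=
  integrable_of_mem_Icc (measurable_envCost c n k) fun _ =>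
    ⟨envCost_nonneg, envCost_le hc hk⟩

theorem integral_envCost_le (hc : 0 ≤ c) {n : ℕ} {k : ℤ} (hk : |k| ≤ n) :
    ∫ ω, envCost c ω n k ∂envLaw ν ≤ 2 * c * n := by
  have := integral_mono (integrable_envCost (ν := ν) hc hk) (integrable_const (2 * c * n))
    fun ω => envCost_le hc hk
  simpa using this

theorem integral_envCost_add_le (hc : 0 ≤ c) {n m : ℕ} {k l : ℤ} (hk : |k| ≤ n) (hl : |l| ≤ m) :
    ∫ ω, envCost c ω (n + m) (k + l) ∂envLaw ν ≤
      ∫ ω, envCost c ω n k ∂envLaw ν + ∫ ω, envCost c ω m l ∂envLaw ν := by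
  have hs := measurePreserving_envShift (ν := ν) n k
  have hint : ∫ ω, envCost c ω m l ∂envLaw ν =
      ∫ ω, envCost c (envShift n k ω) m l ∂envLaw ν := by
    conv_lhs => rw [← hs.map_eq]
    exact integral_map hs.measurable.aemeasurable (measurable_envCost c m l).aestronglyMeasurable
  have hi : Integrable (fun ω => envCost c (envShift n k ω) m l) (envLaw ν) :=
    hs.integrable_comp_of_integrable (integrable_envCost hc hl)
  rw [hint, ← integral_add (integrable_envCost hc hk) hi]
  refine integral_mono (integrable_envCost hc ?_) ((integrable_envCost hc hk).add hi)
    fun ω => envCost_add_le hk hl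
  push_cast
  exact (abs_add_le _ _).trans (add_le_add hk hl)

namespace IsEnvShape

theorem tendsto_integral (hh : IsEnvShape ν c h) (hc : 0 ≤ c) {α : ℝ} (hα : |α| ≤ 1) :
    Tendsto (fun n : ℕ => (∫ ω, envCost c ω n (intPart (α * n)) ∂envLaw ν) / n) atTop
      (𝓝 (h α)) := by
  have key : Tendsto (fun n : ℕ => ∫ ω, envCost c ω n (intPart (α * n)) / n ∂envLaw ν) atTop
      (𝓝 (∫ _, h α ∂envLaw ν)) := by
    refine tendsto_integral_of_dominated_convergence (fun _ => 2 * c)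
      (fun n => ((measurable_envCost c _ _).div_const _).aestronglyMeasurable)
      (integrable_const _) (fun n => ae_of_all _ fun ω => ?_)
      (hh.mono fun ω hω => hω α (abs_le.1 hα))
    rw [Real.norm_of_nonneg (div_nonneg envCost_nonneg (Nat.cast_nonneg n))]
    rcases n.eq_zero_or_pos with rfl | hn
    · simpa using hc
    · rw [div_le_iff₀ (by exact_mod_cast hn)]
      exact envCost_le hc (abs_intPart_mul_le hα n)
  simpa [integral_div] using key

/-- Reflecting space preserves the law, and the rounding of `intPart` is symmetric. -/
theorem neg (hh : IsEnvShape ν c h) {α : ℝ} (hα : |α| ≤ 1) : h (-α) = h α := by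
  have h1 := (measurePreserving_envReflect (ν := ν)).quasiMeasurePreserving.ae hh
  obtain ⟨ω, hω, hω'⟩ := (hh.and h1).exists
  refine tendsto_nhds_unique (hω (-α) ?_) ((hω' α (abs_le.1 hα)).congr fun n => ?_)
  · rwa [← abs_neg, abs_le] at hα
  · have hrefl : ∀ k : ℤ, envCost c (fun i => ω (Sum.map id Neg.neg i)) n k =
        envCost c ω n (-k) := fun k => by
      have := minCost_neg (w := weight c (fun i => ω (Sum.inl i)) fun x => ω (Sum.inr x)) (s := 0)
        (t := n) (x := 0) (y := -k)
      rw [neg_zero, neg_neg] at this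
      exact this
    rw [hrefl, neg_mul, intPart_neg]

theorem nonneg (hh : IsEnvShape ν c h) {α : ℝ} (hα : |α| ≤ 1) : 0 ≤ h α := by
  obtain ⟨ω, hω⟩ := hh.exists
  exact ge_of_tendsto' (hω α (abs_le.1 hα)) fun n => div_nonneg envCost_nonneg (Nat.cast_nonneg n)

/-- With positive probability `F 0 < -c + ε` and `F 1 > c - ε`. A walk sitting at `0` when the sign
is `1` and at `1` when it is `-1` then pays at most `ε` per step. Positive probability is enough
because the limit is deterministic. -/
theorem zero (hh : IsEnvShape ν c h) (hc : 0 ≤ c) (hν₀ : ∀ ε > 0, ν (Set.Iio (-c + ε)) ≠ 0)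
    (hν₁ : ∀ ε > 0, ν (Set.Ioi (c - ε)) ≠ 0) : h 0 = 0 := by
  refine le_antisymm (le_of_forall_pos_le_add fun ε hε => ?_) (hh.nonneg (by simp))
  have hpos : ∃ᵐ ω ∂envLaw ν, ω (Sum.inr 0) < -c + ε ∧ c - ε < ω (Sum.inr 1) := by
    rw [frequently_ae_iff]
    have h1 := Measure.map_apply (μ := envLaw ν)
      (f := fun ω : Env => (ω (Sum.inr 0), ω (Sum.inr 1)))
      ((measurable_pi_apply _).prodMk (measurable_pi_apply _))
      ((measurableSet_Iio (a := -c + ε)).prod (measurableSet_Ioi (a := c - ε)))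
    rw [map_pair_envLaw zero_ne_one, Measure.prod_prod] at h1
    change envLaw ν ((fun ω : Env => (ω (Sum.inr 0), ω (Sum.inr 1))) ⁻¹'
      (Set.Iio (-c + ε) ×ˢ Set.Ioi (c - ε))) ≠ 0
    rw [← h1]
    exact mul_ne_zero (hν₀ ε hε) (hν₁ ε hε)
  obtain ⟨ω, ⟨h0, h1⟩, hω, hb⟩ := (hpos.and_eventually (hh.and ae_envLaw_inl)).exists
  have hcost : ∀ n : ℕ, envCost c ω n 0 ≤ ε * n + 2 * c := by
    intro n
    rcases n.eq_zero_or_pos with rfl | hn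
    · exact (envCost_le hc (by simp)).trans (by simp [hc])
    let γ : ℕ → ℤ := fun i =>
      if 0 < i ∧ i < n then if ω (Sum.inl i) = 1 then 0 else 1 else 0
    have h2 : ∀ i, γ i = 0 ∨ γ i = 1 := fun i => by
      simp only [γ]
      split_ifs <;> simp
    have hγ : IsPath Set.univ 0 n 0 0 γ := by
      refine ⟨by simp [γ], by simp [γ], fun i _ _ => ?_, fun _ _ _ => trivial⟩
      rcases h2 i with h3 | h3 <;> rcases h2 (i + 1) with h4 | h4 <;> simp [h3, h4]
    refine (minCost_le weight_nonneg hγ).trans ?_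
    rw [pathCost, ← Finset.Ioo_insert_right hn, Finset.sum_insert (by simp)]
    have h3 : ∑ i ∈ Finset.Ioo 0 n, weight c (fun i => ω (Sum.inl i)) (fun x => ω (Sum.inr x)) i
        (γ i) ≤ (Finset.Ioo 0 n).card • ε := by
      refine Finset.sum_le_card_nsmul _ _ _ fun i hi => ?_
      rw [Finset.mem_Ioo] at hi
      simp only [γ, hi, and_self, if_true, weight]
      refine max_le hε.le ((min_le_right _ _).trans ?_)
      rcases hb i with h4 | h4
      · simp only [h4, if_true]
        linarith
      · rw [h4, if_neg (by norm_num)]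
        linarith
    have h4 : ((Finset.Ioo 0 n).card : ℝ) ≤ n := by
      simp only [Nat.card_Ioo, Nat.sub_zero]
      exact_mod_cast Nat.sub_le n 1
    have h5 := weight_le (b := fun i => ω (Sum.inl i)) (f := fun x => ω (Sum.inr x)) hc n (γ n)
    rw [nsmul_eq_mul] at h3
    nlinarith
  have hlim : Tendsto (fun n : ℕ => ε + 2 * c / (n : ℝ)) atTop (𝓝 (ε + 0)) :=
    tendsto_const_nhds.add (tendsto_const_div_atTop_nhds_zero_nat _)
  rw [zero_add, ← add_zero ε]
  refine le_of_tendsto_of_tendsto (hω 0 (by simp)) hlim ?_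
  filter_upwards [eventually_gt_atTop 0] with n hn
  have hn' : (0 : ℝ) < n := by exact_mod_cast hn
  rw [zero_mul, show intPart 0 = 0 by simp [intPart], div_le_iff₀ hn', add_mul,
    div_mul_cancel₀ _ hn'.ne']
  exact hcost n

/-- Walks may wait near the origin at no cost. -/
theorem mul_le_mul (hh : IsEnvShape ν c h) (hc : 0 ≤ c) (h0 : h 0 = 0) {α β : ℝ} (hβ : 0 < β)
    (hβα : β ≤ α) (hα : α ≤ 1) : α * h β ≤ β * h α := by
  have hα0 : 0 < α := hβ.trans_le hβα
  -- The walk waits at `0` for time `n - n₂` and then proceeds in direction `α`, where `n₂` is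
  -- chosen so that both directions lead to the same site `⌊β n⌋`. Means are compared because the
  -- second part sees an environment shifted by an amount depending on `n`.
  set n₂ : ℕ → ℕ := fun n => ⌈(⌊β * n⌋ : ℝ) / α⌉₊ with hn₂
  have hk0 : ∀ n : ℕ, 0 ≤ ⌊β * n⌋ := fun n => Int.floor_nonneg.2 (by positivity)
  have hk0' : ∀ n : ℕ, (0 : ℝ) ≤ ⌊β * n⌋ := fun n => by exact_mod_cast hk0 n
  have hlow : ∀ n : ℕ, (⌊β * n⌋ : ℝ) ≤ α * n₂ n := fun n => by
    rw [← div_le_iff₀' hα0]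
    exact Nat.le_ceil _
  have hup : ∀ n : ℕ, α * n₂ n < ⌊β * n⌋ + α := fun n => by
    have := Nat.ceil_lt_add_one (div_nonneg (hk0' n) hα0.le)
    rw [← sub_lt_iff_lt_add, lt_div_iff₀ hα0] at this
    linarith
  have hfloor : ∀ n, intPart (α * n₂ n) = ⌊β * n⌋ := fun n => by
    rw [intPart_of_nonneg (by positivity), Int.floor_eq_iff]
    exact ⟨hlow n, (hup n).trans_le (by linarith)⟩
  have hn₂n : ∀ n, n₂ n ≤ n := fun n => by
    refine Nat.ceil_le.2 ?_
    rw [div_le_iff₀ hα0]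
    refine (Int.floor_le _).trans ?_
    rw [mul_comm]
    gcongr
  have hratio : Tendsto (fun n : ℕ => (n₂ n : ℝ) / n) atTop (𝓝 (β / α)) := by
    refine tendsto_of_tendsto_of_tendsto_of_le_of_le'
      (g := fun n : ℕ => β / α - 1 / α / (n : ℝ)) (h := fun n : ℕ => β / α + 1 / (n : ℝ)) ?_ ?_ ?_ ?_
    · simpa using tendsto_const_nhds.sub (tendsto_const_div_atTop_nhds_zero_nat (1 / α))
    · simpa using tendsto_const_nhds.add (tendsto_const_div_atTop_nhds_zero_nat (1 : ℝ))
    all_goals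
      filter_upwards [eventually_gt_atTop 0] with n hn
      have hn' : (0 : ℝ) < n := by exact_mod_cast hn
    · have h1 := hlow n
      have h2 := Int.lt_floor_add_one (β * n)
      rw [le_div_iff₀ hn', sub_mul, div_mul_cancel₀ _ hn'.ne', ← sub_nonneg]
      have : (n₂ n : ℝ) - (β / α * n - 1 / α) = (α * n₂ n - (β * n - 1)) / α := by field_simp
      rw [this]
      exact div_nonneg (by linarith) hα0.le
    · have h1 := hup n
      have h2 := Int.floor_le (β * n)
      rw [div_le_iff₀ hn', add_mul, div_mul_cancel₀ _ hn'.ne', ← sub_nonneg]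
      have : β / α * n + 1 - n₂ n = (β * n + α - α * n₂ n) / α := by field_simp
      rw [this]
      exact div_nonneg (by linarith) hα0.le
  have hn₂top : Tendsto n₂ atTop atTop := by
    rw [← tendsto_natCast_atTop_iff (R := ℝ)]
    have h1 := hratio.pos_mul_atTop (div_pos hβ hα0) (tendsto_natCast_atTop_atTop (R := ℝ))
    refine h1.congr' ?_
    filter_upwards [eventually_gt_atTop 0] with n hn
    exact div_mul_cancel₀ _ (by exact_mod_cast hn.ne')
  set a : ℕ → ℝ := fun m => ∫ ω, envCost c ω m 0 ∂envLaw ν with ha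
  have ha0 : Tendsto (fun n : ℕ => a n / n) atTop (𝓝 0) := by
    have := hh.tendsto_integral hc (α := 0) (by simp)
    simpa [h0, ha, intPart] using this
  have ha1 : ∀ m, a m ≤ 2 * c * m := fun m => integral_envCost_le hc (by simp)
  have hV : Tendsto (fun n : ℕ => (∫ ω, envCost c ω (n₂ n) ⌊β * n⌋ ∂envLaw ν) / n) atTop
      (𝓝 (h α * (β / α))) := by
    have h1 := ((hh.tendsto_integral hc (α := α) (by rwa [abs_of_pos hα0])).comp hn₂top).mul hratio
    refine h1.congr' ?_
    filter_upwards [hn₂top.eventually (eventually_gt_atTop 0)] with n hn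
    simp only [Function.comp_apply, hfloor]
    have : (n₂ n : ℝ) ≠ 0 := by exact_mod_cast hn.ne'
    field_simp
  have hβ1 : |β| ≤ 1 := by rw [abs_of_pos hβ]; linarith
  suffices h β ≤ h α * (β / α) by
    rw [← mul_div_assoc, le_div_iff₀ hα0] at this
    linarith
  refine le_of_forall_pos_le_add fun ε hε => ?_
  obtain ⟨M, hM⟩ := eventually_atTop.1 (ha0.eventually (ge_mem_nhds hε))
  -- A bound valid for all `m` is needed, since `n - n₂ n` may stay bounded when `α = β`.
  have ha2 : ∀ m, a m ≤ ε * m + 2 * c * M := fun m => by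
    rcases le_or_gt M m with h1 | h1
    · have h2 := hM m h1
      rcases m.eq_zero_or_pos with rfl | hm
      · exact (ha1 0).trans (by simp; positivity)
      · rw [div_le_iff₀ (by exact_mod_cast hm)] at h2
        have : 0 ≤ 2 * c * M := by positivity
        linarith
    · have h2 : (m : ℝ) ≤ M := by exact_mod_cast h1.le
      have h3 : 2 * c * m ≤ 2 * c * M := by gcongr
      have h4 : 0 ≤ ε * m := by positivity
      linarith [ha1 m]
  have hlim : Tendsto (fun n : ℕ => (∫ ω, envCost c ω (n₂ n) ⌊β * n⌋ ∂envLaw ν) / n +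
      (ε + 2 * c * M / (n : ℝ))) atTop (𝓝 (h α * (β / α) + (ε + 0))) :=
    hV.add (tendsto_const_nhds.add (tendsto_const_div_atTop_nhds_zero_nat _))
  rw [add_zero] at hlim
  refine le_of_tendsto_of_tendsto (hh.tendsto_integral hc hβ1) hlim ?_
  filter_upwards [eventually_gt_atTop 0] with n hn
  have hn' : (0 : ℝ) < n := by exact_mod_cast hn
  have hadd := integral_envCost_add_le (ν := ν) hc (n := n - n₂ n) (m := n₂ n) (k := 0)
    (l := ⌊β * n⌋) (by simp) (by
      rw [← hfloor]
      exact abs_intPart_mul_le (by rwa [abs_of_pos hα0]) _)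
  rw [Nat.sub_add_cancel (hn₂n n), zero_add] at hadd
  rw [intPart_of_nonneg (by positivity)]
  have h1 := ha2 (n - n₂ n)
  have h2 : ((n - n₂ n : ℕ) : ℝ) ≤ n := by exact_mod_cast Nat.sub_le _ _
  have h3 : ε * ((n - n₂ n : ℕ) : ℝ) ≤ ε * n := by gcongr
  have h4 : ε + 2 * c * M / (n : ℝ) = (ε * n + 2 * c * M) / n := by field_simp
  rw [h4, ← add_div]
  refine div_le_div_of_nonneg_right ?_ hn'.le
  linarith

end IsEnvShape

end Expectation

/-! ### Averaging over the signs with the potential frozen -/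

section Averaging

/-- The environment whose signs are multiplied by `s`. -/
def signFlip (s : ℤ → ℝ) (ω : Env) : Env := fun i => Sum.elim s (fun _ => 1) i * ω i

theorem signFlip_inr (s : ℤ → ℝ) (ω : Env) (x : ℤ) :
    signFlip s ω (Sum.inr x) = ω (Sum.inr x) := by simp [signFlip]

variable {ν : Measure ℝ} [IsProbabilityMeasure ν] {c : ℝ}

theorem measurePreserving_signFlip_signEnv {N : ℕ} (σ : ZMod N → ℤˣ) :
    MeasurePreserving (signFlip (signEnv σ)) (envLaw ν) (envLaw ν) :=
  measurePreserving_envFlip _ fun i => by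
    rcases Int.units_eq_one_or (σ (i : ZMod N)) with h | h <;> simp [signEnv, h]

/-- The law is invariant under every deterministic flip of signs, so the integral equals that of the
average over all periodic flips. -/
theorem integral_nonneg_of_signMean (N : ℕ) [NeZero N] {Φ : Env → ℝ}
    (hΦ : Integrable Φ (envLaw ν))
    (h : ∀ᵐ ω ∂envLaw ν, 0 ≤ signMean fun σ : ZMod N → ℤˣ => Φ (signFlip (signEnv σ) ω)) :
    0 ≤ ∫ ω, Φ ω ∂envLaw ν := by
  have hint : ∀ σ : ZMod N → ℤˣ,
      ∫ ω, Φ (signFlip (signEnv σ) ω) ∂envLaw ν = ∫ ω, Φ ω ∂envLaw ν := fun σ => by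
    have hs := measurePreserving_signFlip_signEnv (ν := ν) σ
    conv_rhs => rw [← hs.map_eq]
    refine (integral_map hs.measurable.aemeasurable ?_).symm
    rw [hs.map_eq]
    exact hΦ.aestronglyMeasurable
  have hi : ∀ σ : ZMod N → ℤˣ, Integrable (fun ω => Φ (signFlip (signEnv σ) ω)) (envLaw ν) :=
    fun σ => (measurePreserving_signFlip_signEnv (ν := ν) σ).integrable_comp_of_integrable hΦ
  rw [← signMean_const (ι := ZMod N) (∫ ω, Φ ω ∂envLaw ν)]
  rw [show (fun _ : ZMod N → ℤˣ => ∫ ω, Φ ω ∂envLaw ν) =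
    fun σ => ∫ ω, Φ (signFlip (signEnv σ) ω) ∂envLaw ν from funext fun σ => (hint σ).symm]
  unfold signMean
  rw [← integral_finsetSum _ fun σ _ => hi σ, ← integral_div]
  exact integral_nonneg_of_ae h

/-- With period `n + 1` the times up to `n` are distinct residues. The signs of `ω` then amount to a
translation by `τ` in the group of sign patterns, which does not affect the mean. -/
theorem exists_envCost_signFlip {ω : Env} (hω : ∀ i, ω (Sum.inl i) = 1 ∨ ω (Sum.inl i) = -1)
    (n : ℕ) :
    ∃ τ : ZMod (n + 1) → ℤˣ, ∀ (σ : ZMod (n + 1) → ℤˣ) (t : ℕ) (k : ℤ), t ≤ n →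
      envCost c (signFlip (signEnv σ) ω) t k =
        minCost (weight c (signEnv (σ * τ)) fun x => ω (Sum.inr x)) Set.univ 0 t 0 k := by
  classical
  refine ⟨fun z => if ω (Sum.inl z.val) = 1 then 1 else -1, fun σ t k ht => ?_⟩
  refine minCost_congr fun i h1 h2 => funext fun x => ?_
  have hv : (((i : ℤ) : ZMod (n + 1))).val = i := by
    rw [Int.cast_natCast, ZMod.val_cast_of_lt (by omega)]
  have hs : signFlip (signEnv σ) ω (Sum.inl (i : ℤ)) =
      signEnv (σ * fun z => if ω (Sum.inl z.val) = 1 then 1 else -1) i := by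
    simp only [signFlip, Sum.elim_inl, signEnv, Pi.mul_apply, hv]
    rcases hω i with h3 | h3
    · simp [h3]
    · rw [h3, if_neg (by norm_num)]
      simp
  simp only [weight, hs, signFlip_inr]

end Averaging

/-! ### Restricting the duration to a multiple of the distance -/

section Wait

variable {ν : Measure ℝ} [IsProbabilityMeasure ν] {c : ℝ}

/-- The least cost of a walk from `0` to `2 ^ j` which takes a time between `2 ^ j` and
`C * 2 ^ j`. -/
noncomputable def waitCost (c : ℝ) (C j : ℕ) (ω : Env) : ℝ :=
  ⨅ t : Set.Icc (2 ^ j) (C * 2 ^ j), envCost c ω t (2 ^ j)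

theorem waitCost_le {C j t : ℕ} {ω : Env} (h1 : 2 ^ j ≤ t) (h2 : t ≤ C * 2 ^ j) :
    waitCost c C j ω ≤ envCost c ω t (2 ^ j) :=
  ciInf_le (f := fun t : Set.Icc (2 ^ j) (C * 2 ^ j) => envCost c ω t (2 ^ j))
    (Set.finite_range _).bddBelow ⟨t, h1, h2⟩

theorem le_waitCost {C j : ℕ} {ω : Env} {a : ℝ} (hC : 0 < C)
    (h : ∀ t, 2 ^ j ≤ t → t ≤ C * 2 ^ j → a ≤ envCost c ω t (2 ^ j)) : a ≤ waitCost c C j ω := by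
  have : Nonempty (Set.Icc (2 ^ j) (C * 2 ^ j)) := ⟨2 ^ j, le_rfl, Nat.le_mul_of_pos_left _ hC⟩
  exact le_ciInf fun t => h t t.2.1 t.2.2

theorem measurable_waitCost (c : ℝ) (C j : ℕ) : Measurable (waitCost c C j) :=
  Measurable.iInf fun t => measurable_envCost c t (2 ^ j)

/-- The event that the edges between `0` and `2 ^ j` are not too close to perfect. -/
def edgeEvent (c p K : ℝ) (C j : ℕ) : Set Env :=
  {ω | K * (2 ^ j + edgeSum c p (fun x => ω (Sum.inr x)) 0 (2 ^ j)) ≤ C * 2 ^ j}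

theorem measurable_edgeSum (c p : ℝ) (a b : ℤ) :
    Measurable fun ω : Env => edgeSum c p (fun x => ω (Sum.inr x)) a b := by
  unfold edgeSum
  fun_prop

theorem measurableSet_edgeEvent (c p K : ℝ) (C j : ℕ) : MeasurableSet (edgeEvent c p K C j) :=
  measurableSet_le ((measurable_edgeSum c p _ _).const_add _ |>.const_mul _) measurable_const

/-- On `edgeEvent` the duration `u` given by `exists_signMean_minCost_le` is at most `C * 2 ^ j`, so
its cost dominates `waitCost`. The event depends only on the potential and is therefore preserved by
sign flips. -/
theorem exists_setIntegral_nonneg (hc : 0 < c) {p : ℝ} (hp : 2 < p) (hν : ∀ᵐ x ∂ν, |x| < c) :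
    ∃ K > 0, ∀ C n j : ℕ, 0 < C → 0 < n → 2 ^ j ≤ n →
      0 ≤ ∫ ω in edgeEvent c p K C j,
        (envCost c ω n (2 ^ j) - waitCost c C j ω + fluct c n) ∂envLaw ν := by
  obtain ⟨K, hK, h⟩ := exists_signMean_minCost_le hc hp
  refine ⟨K, hK, fun C n j hC hn hjn => ?_⟩
  have hjn' : |(2 ^ j : ℤ)| ≤ n := by
    rw [abs_of_pos (by positivity)]
    exact_mod_cast hjn
  have hW0 : ∀ ω, 0 ≤ waitCost c C j ω := fun ω => le_waitCost hC fun _ _ _ => envCost_nonneg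
  have hW1 : ∀ ω, waitCost c C j ω ≤ 2 * c * (2 ^ j : ℕ) := fun ω =>
    (waitCost_le le_rfl (Nat.le_mul_of_pos_left _ hC)).trans
      (envCost_le hc.le (by rw [abs_of_pos (by positivity)]; push_cast; rfl))
  have hWint : Integrable (waitCost c C j) (envLaw ν) :=
    integrable_of_mem_Icc (measurable_waitCost c C j) fun ω => ⟨hW0 ω, hW1 ω⟩
  rw [← integral_indicator (measurableSet_edgeEvent c p K C j)]
  refine integral_nonneg_of_signMean (n + 1)
    ((((integrable_envCost hc.le hjn').sub hWint).add (integrable_const _)).indicator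
      (measurableSet_edgeEvent c p K C j)) ?_
  filter_upwards [ae_envLaw_inl, ae_envLaw_inr hν] with ω hω hω'
  by_cases hG : ω ∈ edgeEvent c p K C j
  · obtain ⟨u, hu1, hu2, hu3, hu4⟩ := h _ hω' (n + 1) (by omega) j n hjn (by omega)
    have hu5 : u ≤ C * 2 ^ j := by
      have : (u : ℝ) ≤ C * 2 ^ j := hu3.trans hG
      exact_mod_cast this
    obtain ⟨τ, hτ⟩ := exists_envCost_signFlip (c := c) hω n
    rw [← signMean_equiv (Equiv.mulRight τ), ← signMean_equiv (Equiv.mulRight τ)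
      fun σ : ZMod (n + 1) → ℤˣ => minCost (weight c (signEnv σ) fun x => ω (Sum.inr x)) Set.univ 0
        n 0 (2 ^ j), ← sub_nonneg, add_sub_right_comm, ← signMean_sub] at hu4
    rw [← signMean_const (ι := ZMod (n + 1)) (fluct c n), ← signMean_add] at hu4
    refine hu4.trans (signMean_mono fun σ => ?_)
    have hG' : signFlip (signEnv σ) ω ∈ edgeEvent c p K C j := by
      simpa only [edgeEvent, Set.mem_ofPred_eq, signFlip_inr] using hG
    rw [Set.indicator_of_mem hG', Equiv.coe_mulRight, ← hτ _ _ _ le_rfl, ← hτ _ _ _ hu2]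
    linarith [waitCost_le (c := c) (ω := signFlip (signEnv σ) ω) hu1 hu5]
  · have hG' : ∀ σ : ZMod (n + 1) → ℤˣ, signFlip (signEnv σ) ω ∉ edgeEvent c p K C j := fun σ => by
      simpa only [edgeEvent, Set.mem_ofPred_eq, signFlip_inr] using hG
    simp only [Set.indicator_of_notMem (hG' _), signMean_const, le_refl]

/-- Markov's inequality: the mean of the left side in `edgeEvent` is `K (1 + M) 2 ^ j`, at most half
of `C * 2 ^ j`. -/
theorem half_le_measureReal_edgeEvent {p K : ℝ} (hK : 0 < K)
    (hν : ∀ᵐ x ∂ν, |x| < c)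
    (hp : Integrable (fun z : ℝ × ℝ => (2 * c - |z.1 - z.2|) ^ (-p)) (ν.prod ν)) {C : ℕ} (hC0 : 0 < C)
    (hC : 2 * K * (1 + ∫ z, (2 * c - |z.1 - z.2|) ^ (-p) ∂ν.prod ν) ≤ C) (j : ℕ) :
    1 / 2 ≤ (envLaw ν).real (edgeEvent c p K C j) := by
  set M := ∫ z, (2 * c - |z.1 - z.2|) ^ (-p) ∂ν.prod ν with hM
  have hpair : ∀ x : ℤ, MeasurePreserving (fun ω : Env => (ω (Sum.inr x), ω (Sum.inr (x + 1))))
      (envLaw ν) (ν.prod ν) := fun x =>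
    ⟨(measurable_pi_apply _).prodMk (measurable_pi_apply _), map_pair_envLaw (by simp)⟩
  have hint : ∀ x : ℤ, Integrable
      (fun ω : Env => (2 * c - |ω (Sum.inr x) - ω (Sum.inr (x + 1))|) ^ (-p)) (envLaw ν) :=
    fun x => (hpair x).integrable_comp_of_integrable hp
  have hval : ∀ x : ℤ,
      ∫ ω : Env, (2 * c - |ω (Sum.inr x) - ω (Sum.inr (x + 1))|) ^ (-p) ∂envLaw ν = M :=
    fun x => by
      rw [hM, ← (hpair x).map_eq]
      refine (integral_map (f := fun z : ℝ × ℝ => (2 * c - |z.1 - z.2|) ^ (-p))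
        (hpair x).measurable.aemeasurable ?_).symm
      rw [(hpair x).map_eq]
      exact hp.aestronglyMeasurable
  set S : Env → ℝ := fun ω => edgeSum c p (fun x => ω (Sum.inr x)) 0 (2 ^ j) with hS
  have hSint : Integrable S (envLaw ν) := integrable_finsetSum _ fun x _ => hint x
  have hSval : ∫ ω, S ω ∂envLaw ν = 2 ^ j * M := by
    simp only [hS, edgeSum]
    rw [integral_finsetSum _ fun x _ => hint x]
    have : ((2 ^ j : ℤ).toNat : ℝ) = 2 ^ j := by
      rw [← Int.cast_natCast, Int.toNat_of_nonneg (by positivity)]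
      simp
    simp [hval, this]
  set T : Env → ℝ := fun ω => K * (2 ^ j + S ω) with hT
  have hT0 : 0 ≤ᵐ[envLaw ν] T := by
    filter_upwards [ae_envLaw_inr hν] with ω hω
    have := edgeSum_nonneg (p := p) hω 0 (2 ^ j)
    simp only [hT, hS, Pi.zero_apply]
    positivity
  have hTint : Integrable T (envLaw ν) := ((integrable_const _).add hSint).const_mul K
  have hTval : ∫ ω, T ω ∂envLaw ν = K * (1 + M) * 2 ^ j := by
    simp only [hT]
    rw [integral_const_mul, integral_add (integrable_const _) hSint, hSval]
    simp
    ring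
  have hMk := mul_meas_ge_le_integral_of_nonneg hT0 hTint (C * 2 ^ j)
  rw [hTval] at hMk
  have hpow : (0 : ℝ) < 2 ^ j := by positivity
  have hsub : (edgeEvent c p K C j)ᶜ ⊆ {ω | C * 2 ^ j ≤ T ω} := fun ω hω => by
    simp only [edgeEvent, Set.mem_compl_iff, Set.mem_ofPred_eq, not_le] at hω ⊢
    exact hω.le
  have h1 := measureReal_mono (μ := envLaw ν) hsub
  rw [probReal_compl_eq_one_sub (measurableSet_edgeEvent c p K C j)] at h1
  have hC0' : (0 : ℝ) < C := by exact_mod_cast hC0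
  have h2 : C * 2 ^ j * (1 - (envLaw ν).real (edgeEvent c p K C j)) ≤ C * 2 ^ j * (1 / 2) := by
    refine (mul_le_mul_of_nonneg_left h1 (by positivity)).trans (hMk.trans ?_)
    nlinarith
  linarith [le_of_mul_le_mul_left h2 (by positivity)]

end Wait

/-- The parts of `X j` above `-δ` are bounded and tend to `0` almost surely, hence in mean. They
cannot compensate for `-δ` on events of probability at least `1/2`. -/
theorem not_forall_setIntegral_nonneg {Ω : Type*} [MeasurableSpace Ω] {P : Measure Ω}
    [IsProbabilityMeasure P] {X : ℕ → Ω → ℝ} {G : ℕ → Set Ω} {D δ : ℝ} (hδ : 0 < δ)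
    (hX : ∀ j, Measurable (X j)) (hD : ∀ j ω, |X j ω| ≤ D)
    (hG' : ∀ j, 1 / 2 ≤ P.real (G j)) (h : ∀ᵐ ω ∂P, ∀ᶠ j in atTop, X j ω ≤ -δ) :
    ¬ ∀ j, 0 ≤ ∫ ω in G j, X j ω ∂P := by
  intro hpos
  set Y : ℕ → Ω → ℝ := fun j ω => max (X j ω) (-δ) + δ with hY
  have hY0 : ∀ j ω, 0 ≤ Y j ω := fun j ω => by
    have := le_max_right (X j ω) (-δ)
    simp only [hY]
    linarith
  have hYD : ∀ j ω, Y j ω ≤ D + δ := fun j ω => by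
    have h1 := abs_le.1 (hD j ω)
    have : max (X j ω) (-δ) ≤ D := max_le h1.2 (by linarith [abs_nonneg (X j ω), hD j ω])
    simp only [hY]
    linarith
  have hYm : ∀ j, Measurable (Y j) := fun j => ((hX j).max measurable_const).add_const _
  have hYint : ∀ j, Integrable (Y j) P := fun j =>
    integrable_of_mem_Icc (hYm j) fun ω => ⟨hY0 j ω, hYD j ω⟩
  have hXint : ∀ j, Integrable (X j) P := fun j =>
    integrable_of_mem_Icc (hX j) fun ω => abs_le.1 (hD j ω)
  have hlim : Tendsto (fun j => ∫ ω, Y j ω ∂P) atTop (𝓝 (∫ _, (0 : ℝ) ∂P)) := by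
    refine tendsto_integral_of_dominated_convergence (fun _ => D + δ)
      (fun j => (hYm j).aestronglyMeasurable) (integrable_const _) (fun j => ae_of_all _ fun ω => ?_)
      (h.mono fun ω hω => ?_)
    · rw [Real.norm_of_nonneg (hY0 j ω)]
      exact hYD j ω
    · refine tendsto_const_nhds.congr' (hω.mono fun j hj => ?_)
      simp only [hY]
      rw [max_eq_right hj]
      ring
  rw [integral_zero] at hlim
  have hle : ∀ j, δ / 2 ≤ ∫ ω, Y j ω ∂P := fun j => by
    have h1 : ∫ ω in G j, X j ω ∂P ≤ ∫ ω in G j, (Y j ω - δ) ∂P :=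
      integral_mono (hXint j).integrableOn ((hYint j).sub (integrable_const _)).integrableOn
        fun ω => by simp only [hY]; linarith [le_max_left (X j ω) (-δ)]
    rw [integral_sub (hYint j).integrableOn (integrable_const _), setIntegral_const,
      smul_eq_mul] at h1
    have h2 := setIntegral_le_integral (s := G j) (hYint j) (ae_of_all _ (hY0 j))
    have h3 := mul_le_mul_of_nonneg_right (hG' j) hδ.le
    linarith [hpos j]
  linarith [ge_of_tendsto' hlim hle]

/-! ### Linearity of the growth rate near zero -/

section FlatEdge

variable {ν : Measure ℝ} [IsProbabilityMeasure ν] {c : ℝ} {h : ℝ → ℝ}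

theorem tendsto_fluct_div (c : ℝ) : Tendsto (fun n : ℕ => fluct c n / n) atTop (𝓝 0) := by
  obtain ⟨C, hC, hfl⟩ := exists_fluct_le c (q := 3 / 4) (by norm_num)
  have h1 : Tendsto (fun n : ℕ => C * (n : ℝ) ^ (-(1 / 4) : ℝ)) atTop (𝓝 (C * 0)) :=
    ((tendsto_rpow_neg_atTop (by norm_num)).comp tendsto_natCast_atTop_atTop).const_mul C
  rw [mul_zero] at h1
  refine squeeze_zero' (Eventually.of_forall fun n => ?_) ?_ h1
  · have : 0 ≤ fluct c n := by
      have : 0 ≤ Real.log ((n : ℝ) + 1) := Real.log_nonneg (by simp)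
      unfold fluct
      positivity
    positivity
  · filter_upwards [eventually_gt_atTop 0] with n hn
    have hn' : (0 : ℝ) < n := by exact_mod_cast hn
    rw [div_le_iff₀ hn', mul_assoc, ← Real.rpow_add_one hn'.ne']
    rw [show (-(1 / 4) : ℝ) + 1 = 3 / 4 by norm_num]
    exact hfl n hn

namespace IsEnvShape

/-- The least cost to reach `2 ^ j` in a time of order `2 ^ j`. -/
theorem eventually_le_waitCost (hh : IsEnvShape ν c h) (hc : 0 < c) (h0 : h 0 = 0) {C : ℕ}
    (hC : 0 < C) {δ : ℝ} (hδ : 0 < δ) :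
    ∀ᵐ ω ∂envLaw ν, ∀ᶠ j : ℕ in atTop,
      (C * h (1 / C) - δ) * 2 ^ j ≤ waitCost c C j ω := by
  have hC' : (0 : ℝ) < C := by exact_mod_cast hC
  -- Durations are rounded up to multiples of `2 ^ r` with `j = s + r`. This changes the cost by at
  -- most `2c * 2 ^ r`, less than `δ / 2 * 2 ^ j` by the choice of `s`, and leaves finitely many
  -- slopes `2 ^ s / l`.
  obtain ⟨s, hs⟩ : ∃ s : ℕ, 4 * c / δ < 2 ^ s := pow_unbounded_of_one_lt _ one_lt_two
  rw [div_lt_iff₀ hδ] at hs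
  have h2s : (0 : ℝ) < 2 ^ s := by positivity
  filter_upwards [hh] with ω hω
  have hgrid : ∀ l ∈ Finset.Icc (2 ^ s) (C * 2 ^ s), ∀ᶠ r : ℕ in atTop,
      (C * h (1 / C) - δ / 2) * 2 ^ (s + r) ≤ envCost c ω (l * 2 ^ r) (2 ^ (s + r)) := by
    intro l hl
    rw [Finset.mem_Icc] at hl
    have hl1 : (2 : ℝ) ^ s ≤ l := by exact_mod_cast hl.1
    have hl2 : (l : ℝ) ≤ C * 2 ^ s := by exact_mod_cast hl.2
    have hl0 : (0 : ℝ) < l := h2s.trans_le hl1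
    set α : ℝ := 2 ^ s / l with hα
    have hα0 : 0 < α := by positivity
    have hα1 : α ≤ 1 := (div_le_one hl0).2 hl1
    -- All slopes on the grid are at least `1 / C`, so the monotonicity of `h α / α` bounds the cost
    -- per distance below by `C h(1/C)`.
    have hstar := hh.mul_le_mul hc.le h0 (α := α) (β := 1 / C) (by positivity)
      (by rw [hα, div_le_div_iff₀ hC' hl0]; linarith) hα1
    have htop : Tendsto (fun r : ℕ => l * 2 ^ r) atTop atTop :=
      (tendsto_pow_atTop_atTop_of_one_lt one_lt_two).const_mul_atTop' (by exact_mod_cast hl0)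
    have hlim := (hω α ⟨by linarith, hα1⟩).comp htop
    have hlt : α * (C * h (1 / C) - δ / 2) < h α := by
      have : α * h (1 / C) * C ≤ 1 / C * h α * C := by gcongr
      have h3 : 1 / C * h α * C = h α := by field_simp
      nlinarith
    filter_upwards [hlim.eventually (le_mem_nhds hlt)] with r hr
    have h4 : α * ((l * 2 ^ r : ℕ) : ℝ) = ((2 ^ (s + r) : ℕ) : ℝ) := by
      rw [hα]
      push_cast
      rw [pow_add]
      field_simp
    have h5 : (0 : ℝ) < ((l * 2 ^ r : ℕ) : ℝ) := by push_cast; positivity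
    simp only [Function.comp_apply] at hr
    rw [h4, intPart_natCast, le_div_iff₀ h5] at hr
    have h6 : α * (C * h (1 / C) - δ / 2) * ((l * 2 ^ r : ℕ) : ℝ) =
        (C * h (1 / C) - δ / 2) * 2 ^ (s + r) := by
      rw [mul_right_comm, h4]
      push_cast
      ring
    rw [h6] at hr
    exact_mod_cast hr
  rw [← Finset.eventually_all] at hgrid
  obtain ⟨R, hR⟩ := eventually_atTop.1 hgrid
  filter_upwards [eventually_ge_atTop (s + R)] with j hj
  obtain ⟨r, rfl⟩ : ∃ r, j = s + r := ⟨j - s, by omega⟩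
  refine le_waitCost hC fun t ht1 ht2 => ?_
  set l := (t + 2 ^ r - 1) / 2 ^ r with hl
  have hr0 : 0 < 2 ^ r := by positivity
  have hlt : t ≤ l * 2 ^ r := by
    have := Nat.lt_div_mul_add (a := t + 2 ^ r - 1) hr0
    rw [← hl] at this
    omega
  have hlt' : l * 2 ^ r ≤ t + 2 ^ r := (Nat.div_mul_le_self _ _).trans (Nat.sub_le _ _)
  have hl1 : 2 ^ s ≤ l := by
    refine Nat.le_of_mul_le_mul_right (c := 2 ^ r) ?_ hr0
    rw [← pow_add]
    exact ht1.trans hlt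
  have hl2 : l ≤ C * 2 ^ s := by
    refine Nat.le_of_lt_succ (Nat.div_lt_of_lt_mul ?_)
    rw [pow_add] at ht2
    have : 2 ^ r * (C * 2 ^ s).succ = C * (2 ^ s * 2 ^ r) + 2 ^ r := by
      rw [Nat.succ_eq_add_one]; ring
    omega
  have h1 := hR r (by omega) l (Finset.mem_Icc.2 ⟨hl1, hl2⟩)
  have h2 := envCost_le_add (c := c) (ω := ω) (k := 2 ^ (s + r)) (l := 2 ^ (s + r)) hc.le
    (by rw [abs_of_pos (by positivity)]; exact_mod_cast ht1) hlt (by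
      rw [sub_self, abs_zero, sub_nonneg]; exact_mod_cast hlt)
  have h3 : ((l * 2 ^ r : ℕ) : ℝ) - t ≤ 2 ^ r := by
    rw [sub_le_iff_le_add']
    exact_mod_cast hlt'
  have h4 : 2 * c * (((l * 2 ^ r : ℕ) : ℝ) - t) ≤ 2 * c * 2 ^ r := by gcongr
  have h5 : (2 : ℝ) ^ (s + r) = 2 ^ s * 2 ^ r := pow_add _ _ _
  have h6 : 4 * c * 2 ^ r ≤ 2 ^ s * δ * 2 ^ r := by gcongr
  rw [h5] at h1 ⊢
  nlinarith

/-- The growth rate is linear near `0`. -/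
theorem exists_eq_mul (hh : IsEnvShape ν c h) (hc : 0 < c) (h0 : h 0 = 0) (hν : ∀ᵐ x ∂ν, |x| < c)
    {p : ℝ} (hp : 2 < p)
    (hint : Integrable (fun z : ℝ × ℝ => (2 * c - |z.1 - z.2|) ^ (-p)) (ν.prod ν)) :
    ∃ α₀ ∈ Set.Ioo (0 : ℝ) 1, ∀ α ∈ Set.Icc 0 α₀, h α = α / α₀ * h α₀ := by
  obtain ⟨K, hK, hmain⟩ := exists_setIntegral_nonneg hc hp hν
  set M := ∫ z, (2 * c - |z.1 - z.2|) ^ (-p) ∂ν.prod ν with hM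
  obtain ⟨C, hCK⟩ := exists_nat_ge (max 2 (2 * K * (1 + M)))
  have hC2 : (2 : ℝ) ≤ C := (le_max_left _ _).trans hCK
  have hC' : (0 : ℝ) < C := by linarith
  have hC : 0 < C := by exact_mod_cast hC'
  have hG := half_le_measureReal_edgeEvent hK hν hint hC ((le_max_right _ _).trans hCK)
  refine ⟨1 / C, ⟨by positivity, by rw [div_lt_one hC']; linarith⟩, fun β hβ => ?_⟩
  have hC1 : 1 / (C : ℝ) ≤ 1 := by rw [div_le_one hC']; linarith
  rcases hβ.1.eq_or_lt with rfl | hβ0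
  · simp [h0]
  have hβ1 : β ≤ 1 := hβ.2.trans hC1
  have hup := hh.mul_le_mul hc.le h0 hβ0 hβ.2 hC1
  have hup' : h β ≤ β * C * h (1 / C) := by
    have : C * (1 / C * h β) ≤ C * (β * h (1 / C)) := by gcongr
    have h3 : C * (1 / C * h β) = h β := by field_simp
    linarith
  have hdiv : β / (1 / C) * h (1 / C) = β * C * h (1 / C) := by rw [div_div_eq_mul_div, div_one]
  rw [hdiv]
  refine le_antisymm hup' (not_lt.1 fun hlt => ?_)
  -- A quarter of the gap: one part each is spent on the limit of the cost, on `waitCost` and on the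
  -- fluctuation, and one is left for the contradiction.
  set δ := (β * C * h (1 / C) - h β) / β / 4 with hδ
  have hδ0 : 0 < δ := by
    have : 0 < β * C * h (1 / C) - h β := by linarith
    positivity
  have hgap : h β / β = C * h (1 / C) - 4 * δ := by
    rw [hδ]
    field_simp
    ring
  -- The duration for which slope `β` leads exactly to `2 ^ j`.
  set n : ℕ → ℕ := fun j => ⌈(2 : ℝ) ^ j / β⌉₊ with hn
  have hnlow : ∀ j, (2 : ℝ) ^ j ≤ β * n j := fun j => by
    rw [← div_le_iff₀' hβ0]
    exact Nat.le_ceil _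
  have hnup : ∀ j, β * n j < 2 ^ j + β := fun j => by
    have : (n j : ℝ) < 2 ^ j / β + 1 := Nat.ceil_lt_add_one (by positivity)
    rw [← sub_lt_iff_lt_add, lt_div_iff₀ hβ0] at this
    linarith
  have hn1 : ∀ j, 2 ^ j ≤ n j := fun j => by
    have h1 : (2 : ℝ) ^ j ≤ n j := (hnlow j).trans
      (mul_le_of_le_one_left (Nat.cast_nonneg _) hβ1)
    exact_mod_cast h1
  have hn0 : ∀ j, 0 < n j := fun j => (by positivity : 0 < 2 ^ j).trans_le (hn1 j)
  have hfloor : ∀ j, intPart (β * n j) = 2 ^ j := fun j => by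
    rw [intPart_of_nonneg (by positivity), Int.floor_eq_iff]
    push_cast
    exact ⟨hnlow j, (hnup j).trans_le (by linarith)⟩
  have hntop : Tendsto n atTop atTop :=
    tendsto_atTop_mono hn1 (tendsto_pow_atTop_atTop_of_one_lt one_lt_two)
  have h2top : Tendsto (fun j : ℕ => (2 : ℝ) ^ j) atTop atTop :=
    tendsto_pow_atTop_atTop_of_one_lt one_lt_two
  have hratio : Tendsto (fun j : ℕ => (n j : ℝ) / 2 ^ j) atTop (𝓝 (1 / β)) := by
    refine tendsto_of_tendsto_of_tendsto_of_le_of_le (g := fun _ => 1 / β)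
      (h := fun j : ℕ => 1 / β + 1 / (2 : ℝ) ^ j) tendsto_const_nhds ?_ (fun j => ?_) fun j => ?_
    · have h1 : Tendsto (fun j : ℕ => 1 / β + 1 / (2 : ℝ) ^ j) atTop (𝓝 (1 / β + 0)) :=
        tendsto_const_nhds.add (tendsto_const_nhds.div_atTop h2top)
      rwa [add_zero] at h1
    · rw [div_le_div_iff₀ hβ0 (by positivity), one_mul, mul_comm]
      exact hnlow j
    · have h1 : 1 / β + 1 / (2 : ℝ) ^ j = (2 ^ j + β) / β / 2 ^ j := by field_simp
      refine (div_le_div_of_nonneg_right ?_ (by positivity)).trans_eq h1.symm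
      rw [le_div_iff₀ hβ0, mul_comm]
      exact (hnup j).le
  have hfluct : Tendsto (fun j : ℕ => fluct c (n j) / 2 ^ j) atTop (𝓝 0) := by
    have h1 := ((tendsto_fluct_div c).comp hntop).mul hratio
    rw [zero_mul] at h1
    refine h1.congr fun j => ?_
    have : (n j : ℝ) ≠ 0 := by exact_mod_cast (hn0 j).ne'
    simp only [Function.comp_apply]
    field_simp
  set X : ℕ → Env → ℝ := fun j ω =>
    (envCost c ω (n j) (2 ^ j) - waitCost c C j ω + fluct c (n j)) / 2 ^ j with hX
  obtain ⟨D, hD⟩ := hfluct.norm.bddAbove_range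
  have hnratio : ∀ j, (n j : ℝ) / 2 ^ j ≤ 1 / β + 1 := fun j => by
    rw [div_le_iff₀ (by positivity)]
    have h1 := (hnup j).le
    have h2 : (1 : ℝ) ≤ 2 ^ j := one_le_pow₀ one_le_two
    have h3 : β * n j ≤ β * ((1 / β + 1) * 2 ^ j) := by
      have : β * ((1 / β + 1) * 2 ^ j) = 2 ^ j + β * 2 ^ j := by field_simp
      rw [this]
      nlinarith
    exact le_of_mul_le_mul_left h3 hβ0
  have hpos : ∀ j, (0 : ℝ) < 2 ^ j := fun j => by positivity
  have hk : ∀ j, |(2 ^ j : ℤ)| ≤ n j := fun j => by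
    rw [abs_of_pos (by positivity)]
    exact_mod_cast hn1 j
  refine not_forall_setIntegral_nonneg (P := envLaw ν) (X := X)
    (G := fun j => edgeEvent c p K C j) (D := 2 * c * (1 / β + 1) + 2 * c + D) hδ0 (fun j => ?_)
    (fun j ω => ?_) hG ?_ fun j => ?_
  · exact (((measurable_envCost c _ _).sub (measurable_waitCost c C j)).add_const _).div_const _
  · have h1 : |fluct c (n j) / 2 ^ j| ≤ D := hD ⟨j, rfl⟩
    have h2 : 0 ≤ envCost c ω (n j) (2 ^ j) / 2 ^ j := div_nonneg envCost_nonneg (hpos j).le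
    have h3 : envCost c ω (n j) (2 ^ j) / 2 ^ j ≤ 2 * c * (1 / β + 1) := by
      refine (div_le_div_of_nonneg_right (envCost_le hc.le (hk j)) (hpos j).le).trans ?_
      rw [mul_div_assoc]
      exact mul_le_mul_of_nonneg_left (hnratio j) (by positivity)
    have h4 : 0 ≤ waitCost c C j ω / 2 ^ j :=
      div_nonneg (le_waitCost hC fun _ _ _ => envCost_nonneg) (hpos j).le
    have h5 : waitCost c C j ω / 2 ^ j ≤ 2 * c := by
      rw [div_le_iff₀ (hpos j)]
      refine (waitCost_le le_rfl (Nat.le_mul_of_pos_left _ hC)).trans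
        ((envCost_le hc.le ?_).trans (le_of_eq ?_))
      · rw [abs_of_pos (by positivity)]
        push_cast
        rfl
      · push_cast
        rfl
    have h6 : X j ω = envCost c ω (n j) (2 ^ j) / 2 ^ j - waitCost c C j ω / 2 ^ j +
        fluct c (n j) / 2 ^ j := by simp only [hX]; ring
    have h7 : 0 ≤ 2 * c * (1 / β + 1) := by positivity
    have h8 := abs_le.1 h1
    rw [h6, abs_le]
    constructor <;> linarith
  · filter_upwards [hh, hh.eventually_le_waitCost hc h0 hC hδ0] with ω hω hω'
    have hlim := ((hω β ⟨by linarith, hβ1⟩).comp hntop).mul hratio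
    rw [mul_one_div, hgap] at hlim
    filter_upwards [hω', hlim.eventually (gt_mem_nhds (show C * h (1 / C) - 4 * δ <
      C * h (1 / C) - 3 * δ by linarith)), hfluct.eventually (gt_mem_nhds hδ0)] with j h1 h2 h3
    simp only [Function.comp_apply, hfloor] at h2
    have h4 : (n j : ℝ) ≠ 0 := by exact_mod_cast (hn0 j).ne'
    rw [div_mul_div_cancel₀ h4, div_lt_iff₀ (hpos j)] at h2
    rw [div_lt_iff₀ (hpos j)] at h3
    simp only [hX]
    rw [div_le_iff₀ (hpos j)]
    linarith
  · simp only [hX]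
    rw [integral_div]
    exact div_nonneg (hmain C (n j) j hC (hn0 j) (hn1 j)) (hpos j).le

end IsEnvShape

end FlatEdge

/-! ### Negative moments of the edge deficits -/

/-- The measure with density `ϱ`. -/
noncomputable def densityLaw (ϱ : ℝ → ℝ) : Measure ℝ :=
  volume.withDensity fun y => ENNReal.ofReal (ϱ y)

namespace IsEdgeDensity

variable {ϱ : ℝ → ℝ} {c κ q : ℝ}

theorem nonneg (h : IsEdgeDensity ϱ c κ q) (x : ℝ) : 0 ≤ ϱ x := by
  by_cases hx : x ∈ Set.Ioo (-c) c
  · exact (h.pos x hx).le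
  · exact (h.eq_zero x hx).ge

theorem measurable (h : IsEdgeDensity ϱ c κ q) : Measurable ϱ := by
  classical
  have h1 := h.continuousOn.measurable_piecewise (continuousOn_const (c := (0 : ℝ)))
    measurableSet_Ioo
  convert h1 using 1
  ext x
  by_cases hx : x ∈ Set.Ioo (-c) c
  · rw [Set.piecewise_eq_of_mem _ _ _ hx]
  · rw [Set.piecewise_eq_of_notMem _ _ _ hx, h.eq_zero x hx]

theorem ae_abs_lt (h : IsEdgeDensity ϱ c κ q) : ∀ᵐ x ∂densityLaw ϱ, |x| < c := by
  rw [densityLaw, ae_withDensity_iff h.measurable.ennreal_ofReal]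
  refine ae_of_all _ fun x hx => ?_
  by_contra hxc
  exact hx (by rw [h.eq_zero x fun h' => hxc (abs_lt.2 h'), ENNReal.ofReal_zero])

theorem densityLaw_ne_zero (h : IsEdgeDensity ϱ c κ q) {a b : ℝ} {s : Set ℝ} (hab : a < b)
    (ha : -c ≤ a) (hb : b ≤ c) (hs : Set.Ioo a b ⊆ s) : densityLaw ϱ s ≠ 0 := by
  refine fun h0 => ?_
  rw [densityLaw, withDensity_apply_eq_zero h.measurable.ennreal_ofReal] at h0
  have h1 := measure_mono_null (s := Set.Ioo a b)
    (t := {x | ENNReal.ofReal (ϱ x) ≠ 0} ∩ s) (fun x hx => ⟨(ENNReal.ofReal_pos.2 (h.pos x ⟨ha.trans_lt hx.1, hx.2.trans_le hb⟩)).ne', hs hx⟩) h0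
  rw [Real.volume_Ioo, ENNReal.ofReal_eq_zero] at h1
  linarith

variable [IsProbabilityMeasure (densityLaw ϱ)]

theorem integrable (h : IsEdgeDensity ϱ c κ q) : Integrable ϱ := by
  have h1 := (integrable_withDensity_iff (μ := volume) h.measurable.ennreal_ofReal (by simp)
    (g := fun _ => (1 : ℝ))).1 (integrable_const (μ := densityLaw ϱ) 1)
  simpa [ENNReal.toReal_ofReal (h.nonneg _)] using h1

/-- Near `c` the integrand is bounded by a multiple of `(c - x) ^ (κ / 2 - 1)`, which is integrable
because `κ > 0`. Away from `c` the power is bounded. -/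
theorem integrable_rpow_mul (h : IsEdgeDensity ϱ c κ q) (hκ : 0 < κ) :
    Integrable fun x => (c - x) ^ (-(1 + κ / 2)) * ϱ x := by
  obtain ⟨δ, hδ, hle⟩ : ∃ δ > 0, ∀ x, c - δ < x → x < c → ϱ x ≤ 2 * q * (c - x) ^ κ := by
    have h1 := h.edge.eventually (ge_mem_nhds (show q < 2 * q by linarith [h.q_pos]))
    obtain ⟨l, hl, hl'⟩ := (mem_nhdsLT_iff_exists_Ioo_subset' (sub_one_lt c)).1 h1
    refine ⟨c - l, sub_pos.2 hl, fun x hx hxc => ?_⟩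
    have h2 : ϱ x / |c - x| ^ κ ≤ 2 * q := hl' ⟨by linarith, hxc⟩
    rwa [abs_of_pos (by linarith), div_le_iff₀ (Real.rpow_pos_of_pos (by linarith) _)] at h2
  have hi : Integrable ((Set.Ioc (c - δ) c).indicator fun x => 2 * q * (c - x) ^ (κ / 2 - 1)) := by
    have h1 := (intervalIntegral.intervalIntegrable_rpow' (a := δ) (b := 0)
      (show -1 < κ / 2 - 1 by linarith)).comp_sub_left c
    rw [sub_zero, intervalIntegrable_iff_integrableOn_Ioc_of_le (by linarith)] at h1
    exact (integrable_indicator_iff measurableSet_Ioc).2 (h1.const_mul (2 * q))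
  refine (hi.add (h.integrable.const_mul (δ ^ (-(1 + κ / 2))))).mono'
    (((measurable_const.sub measurable_id).pow_const _).mul h.measurable).aestronglyMeasurable
    (ae_of_all _ fun x => ?_)
  have hq := h.q_pos
  have hδ' : 0 ≤ δ ^ (-(1 + κ / 2)) * ϱ x :=
    mul_nonneg (Real.rpow_nonneg hδ.le _) (h.nonneg x)
  have hind : 0 ≤ (Set.Ioc (c - δ) c).indicator
      (fun x => 2 * q * (c - x) ^ (κ / 2 - 1)) x :=
    Set.indicator_nonneg (fun y hy => by
      have : 0 ≤ c - y := by linarith [hy.2]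
      positivity) x
  rw [Pi.add_apply]
  rcases le_or_gt c x with hx | hx
  · rw [h.eq_zero x fun h' => absurd h'.2 (not_lt.2 hx), mul_zero, mul_zero, norm_zero, add_zero]
    exact hind
  have hcx : 0 < c - x := by linarith
  rw [Real.norm_of_nonneg (mul_nonneg (Real.rpow_nonneg hcx.le _) (h.nonneg x))]
  rcases lt_or_ge (c - δ) x with hx' | hx'
  · rw [Set.indicator_of_mem (show x ∈ Set.Ioc (c - δ) c from ⟨hx', hx.le⟩)]
    have h2 : (c - x) ^ (-(1 + κ / 2)) * ϱ x ≤
        (c - x) ^ (-(1 + κ / 2)) * (2 * q * (c - x) ^ κ) :=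
      mul_le_mul_of_nonneg_left (hle x hx' hx) (Real.rpow_nonneg hcx.le _)
    have h3 : (c - x) ^ (-(1 + κ / 2)) * (2 * q * (c - x) ^ κ) =
        2 * q * (c - x) ^ (κ / 2 - 1) := by
      rw [mul_left_comm, ← Real.rpow_add hcx]
      ring_nf
    linarith
  · have h2 : (c - x) ^ (-(1 + κ / 2)) * ϱ x ≤ δ ^ (-(1 + κ / 2)) * ϱ x :=
      mul_le_mul_of_nonneg_right
        (Real.rpow_le_rpow_of_nonpos hδ (by linarith) (by linarith)) (h.nonneg x)
    linarith

theorem integrable_sub_rpow (h : IsEdgeDensity ϱ c κ q) (hκ : 0 < κ) :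
    Integrable (fun x => (c - x) ^ (-(1 + κ / 2))) (densityLaw ϱ) := by
  rw [densityLaw, integrable_withDensity_iff h.measurable.ennreal_ofReal (by simp)]
  simpa only [ENNReal.toReal_ofReal (h.nonneg _)] using h.integrable_rpow_mul hκ

theorem integrable_add_rpow (h : IsEdgeDensity ϱ c κ q) (hκ : 0 < κ) :
    Integrable (fun x => (c + x) ^ (-(1 + κ / 2))) (densityLaw ϱ) := by
  rw [densityLaw, integrable_withDensity_iff h.measurable.ennreal_ofReal (by simp)]
  have h1 := (h.integrable_rpow_mul hκ).comp_neg
  simpa only [ENNReal.toReal_ofReal (h.nonneg _), h.even, sub_neg_eq_add] using h1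

/-- The deficit is a sum of the distances of one value to `c` and of the other to `-c`. By `(a + b)
^ 2 ≥ a b` its power is bounded by a product of negative powers of these independent distances, each
of order `1 + κ / 2`. -/
theorem integrable_edge (h : IsEdgeDensity ϱ c κ q) (hκ : 0 < κ) :
    Integrable (fun z : ℝ × ℝ => (2 * c - |z.1 - z.2|) ^ (-(2 + κ)))
      ((densityLaw ϱ).prod (densityLaw ϱ)) := by
  have hkey : ∀ a b : ℝ, 0 < a → 0 < b →
      (a + b) ^ (-(2 + κ)) ≤ a ^ (-(1 + κ / 2)) * b ^ (-(1 + κ / 2)) := fun a b ha hb => by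
    have h1 : (a + b) ^ (-(2 + κ)) = ((a + b) ^ 2) ^ (-(1 + κ / 2)) := by
      rw [← Real.rpow_natCast_mul (by positivity)]
      congr 1
      push_cast
      ring
    rw [h1, ← Real.mul_rpow ha.le hb.le]
    exact Real.rpow_le_rpow_of_nonpos (by positivity) (by nlinarith) (by linarith)
  refine (((h.integrable_sub_rpow hκ).mul_prod (h.integrable_add_rpow hκ)).add
    ((h.integrable_add_rpow hκ).mul_prod (h.integrable_sub_rpow hκ))).mono'
    (Measurable.aestronglyMeasurable (by fun_prop)) ?_
  have h1 : ∀ᵐ z ∂(densityLaw ϱ).prod (densityLaw ϱ), |z.1| < c :=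
    Measure.quasiMeasurePreserving_fst.ae h.ae_abs_lt
  have h2 : ∀ᵐ z ∂(densityLaw ϱ).prod (densityLaw ϱ), |z.2| < c :=
    Measure.quasiMeasurePreserving_snd.ae h.ae_abs_lt
  filter_upwards [h1, h2] with z hz1 hz2
  rw [abs_lt] at hz1 hz2
  have hm : 0 < c - z.1 := by linarith
  have hm' : 0 < c + z.1 := by linarith
  have hn : 0 < c - z.2 := by linarith
  have hn' : 0 < c + z.2 := by linarith
  have h3 : 0 ≤ (c - z.1) ^ (-(1 + κ / 2)) * (c + z.2) ^ (-(1 + κ / 2)) := by positivity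
  have h4 : 0 ≤ (c + z.1) ^ (-(1 + κ / 2)) * (c - z.2) ^ (-(1 + κ / 2)) := by positivity
  rw [Pi.add_apply]
  rcases abs_cases (z.1 - z.2) with ⟨h5, -⟩ | ⟨h5, -⟩
  · rw [h5, show 2 * c - (z.1 - z.2) = (c - z.1) + (c + z.2) by ring,
      Real.norm_of_nonneg (by positivity)]
    linarith [hkey _ _ hm hn']
  · rw [h5, show 2 * c - -(z.1 - z.2) = (c + z.1) + (c - z.2) by ring,
      Real.norm_of_nonneg (by positivity)]
    linarith [hkey _ _ hm' hn]

end IsEdgeDensity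

/-! ### Transfer to the given probability space -/

namespace IsEnvironment

variable {Ω : Type*} [MeasurableSpace Ω] {μ : Measure Ω} [IsProbabilityMeasure μ]
  {B F : ℤ → Ω → ℝ} {ϱ : ℝ → ℝ} {c κ q : ℝ}

theorem isProbabilityMeasure_densityLaw (h : IsEnvironment μ B F ϱ) :
    IsProbabilityMeasure (densityLaw ϱ) := by
  rw [densityLaw, ← h.law_F 0]
  exact Measure.isProbabilityMeasure_map (h.measurable_F 0).aemeasurable

theorem map_B (h : IsEnvironment μ B F ϱ) (i : ℤ) : μ.map (B i) = coinLaw := by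
  have := Measure.isProbabilityMeasure_map (μ := μ) (h.measurable_B i).aemeasurable
  have h1 : μ.map (B i) {1} = 1 / 2 := by
    rw [Measure.map_apply (h.measurable_B i) (measurableSet_singleton _)]
    exact h.law_B_one i
  have h2 : μ.map (B i) {-1} = 1 / 2 := by
    rw [Measure.map_apply (h.measurable_B i) (measurableSet_singleton _)]
    exact h.law_B_neg_one i
  have hd : Disjoint ({1} : Set ℝ) {-1} := by norm_num
  have h3 : ∀ᵐ x ∂μ.map (B i), x ∈ ({1} ∪ {-1} : Set ℝ) := by
    refine (mem_ae_iff_prob_eq_one (by measurability)).2 ?_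
    change μ.map (B i) ({1} ∪ {-1}) = 1
    rw [measure_union hd (measurableSet_singleton _),
      h1, h2, one_div, ENNReal.inv_two_add_inv_two]
  rw [← Measure.restrict_eq_self_of_ae_mem h3,
    Measure.restrict_union hd (measurableSet_singleton _), Measure.restrict_singleton,
    Measure.restrict_singleton, h1, h2]
  rfl

/-- The product measure is determined by its values on finite-dimensional boxes, which factor first
between `F` and `B` and then over the coordinates. -/
theorem map_eq_envLaw (h : IsEnvironment μ B F ϱ) [IsProbabilityMeasure (densityLaw ϱ)] :
    μ.map (fun ω i => Sum.elim B F i ω) = envLaw (densityLaw ϱ) := by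
  have hm : ∀ i, Measurable (Sum.elim B F i) := fun i => by
    rcases i with i | i
    · exact h.measurable_B i
    · exact h.measurable_F i
  refine Measure.eq_infinitePi _ fun s t ht => ?_
  rw [Measure.map_apply (measurable_pi_lambda _ hm)
    (MeasurableSet.pi s.countable_toSet fun i _ => ht i)]
  have hset : (fun ω i => Sum.elim B F i ω) ⁻¹' (Set.pi s t) =
      (fun ω x => F x ω) ⁻¹' (Set.pi s.toRight fun x => t (Sum.inr x)) ∩
        (fun ω i => B i ω) ⁻¹' (Set.pi s.toLeft fun i => t (Sum.inl i)) := by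
    ext ω
    simp only [Set.mem_preimage, Set.mem_pi, Finset.mem_coe, Set.mem_inter_iff,
      Finset.mem_toRight, Finset.mem_toLeft, Sum.forall, Sum.elim_inl, Sum.elim_inr]
    tauto
  have hpi : ∀ (X : ℤ → Ω → ℝ) (u : Finset ℤ) (t : ℤ → Set ℝ), iIndepFun X μ →
      (∀ i, MeasurableSet (t i)) →
      μ ((fun ω x => X x ω) ⁻¹' (Set.pi u t)) = ∏ x ∈ u, μ (X x ⁻¹' t x) :=
    fun X u t hX ht => by
      rw [← hX.measure_inter_preimage_eq_mul u fun i _ => ht i]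
      congr 1
      ext ω
      simp
  rw [hset, h.indep_F_B.measure_inter_preimage_eq_mul _ _
    (MeasurableSet.pi (Finset.countable_toSet _) fun i _ => ht _)
    (MeasurableSet.pi (Finset.countable_toSet _) fun i _ => ht _),
    hpi F _ _ h.indep_F fun _ => ht _, hpi B _ _ h.indep_B fun _ => ht _,
    Finset.prod_sum_eq_prod_toLeft_mul_prod_toRight, mul_comm]
  congr 1
  · refine Finset.prod_congr rfl fun i _ => ?_
    rw [← Measure.map_apply (h.measurable_B i) (ht _), h.map_B]
    rfl
  · refine Finset.prod_congr rfl fun i _ => ?_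
    rw [← Measure.map_apply (h.measurable_F i) (ht _), h.law_F]
    rfl

end IsEnvironment

/-- Adding a constant to the action turns it into the cost. -/
theorem minAction_add_mul {c : ℝ} {ω : Env} (hB : ∀ i, ω (Sum.inl i) = 1 ∨ ω (Sum.inl i) = -1)
    (hF : ∀ x, |ω (Sum.inr x)| < c) {n : ℕ} {k : ℤ} (hk : |k| ≤ n) :
    minAction (fun i => ω (Sum.inl i)) (fun x => ω (Sum.inr x)) n k + c * n = envCost c ω n k := by
  have hact : ∀ γ, action (fun i => ω (Sum.inl i)) (fun x => ω (Sum.inr x)) n γ + c * n =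
      pathCost (weight c (fun i => ω (Sum.inl i)) fun x => ω (Sum.inr x)) 0 n γ := fun γ => by
    have h1 : ∀ i : ℕ, weight c (fun i => ω (Sum.inl i)) (fun x => ω (Sum.inr x)) i (γ i) =
        c + ω (Sum.inl i) * ω (Sum.inr (γ i)) := fun i => by
      refine weight_eq ?_
      rcases hB i with h | h <;> simp [h, (hF (γ i)).le]
    simp only [pathCost, h1, action, Finset.sum_add_distrib]
    rw [Finset.sum_const, Nat.card_Ioc, nsmul_eq_mul, Nat.sub_zero, add_comm, mul_comm]
    rfl
  have hwalk : ∀ γ, IsLazyWalk n k γ ↔ IsPath Set.univ 0 n 0 k γ := fun γ => by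
    simp [IsLazyWalk, IsPath, and_comm, and_left_comm]
  obtain ⟨⟨γ, hγ, hγ'⟩, hmin⟩ := isLeast_minAction (fun i => ω (Sum.inl i))
    (fun x => ω (Sum.inr x)) n k hk
  refine le_antisymm (le_minCost ((hwalk γ).1 hγ) fun γ' h' => ?_) ?_
  · rw [← hact]
    have := hmin ⟨γ', (hwalk γ').2 h', rfl⟩
    linarith
  · rw [← hγ', hact]
    exact minCost_le weight_nonneg ((hwalk γ).1 hγ)

theorem mainTheorem4 {Ω : Type*} [MeasurableSpace Ω] (μ : Measure Ω) [IsProbabilityMeasure μ]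
    (B F : ℤ → Ω → ℝ) (ϱ : ℝ → ℝ) (c κ q : ℝ)
    (hϱ : IsEdgeDensity ϱ c κ q) (henv : IsEnvironment μ B F ϱ) (hκ : 0 < κ) :
    ∃ Λ : ℝ → ℝ, IsShapeFunction μ B F Λ ∧
      ∃ α₀ ∈ Set.Ioo (0 : ℝ) 1, ∀ α ∈ Set.Icc (-α₀) α₀,
        Λ α = c - (c - Λ α₀) / α₀ * |α| := by
  have hc := hϱ.c_pos
  have hprob := henv.isProbabilityMeasure_densityLaw
  obtain ⟨h, hh⟩ := exists_envCost_shape (ν := densityLaw ϱ) hc.le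
  have hh : IsEnvShape (densityLaw ϱ) c h := hh
  have h0 : h 0 = 0 := hh.zero hc.le
    (fun ε hε => hϱ.densityLaw_ne_zero (a := -c) (b := min c (-c + ε))
      (lt_min (by linarith) (by linarith)) le_rfl (min_le_left _ _)
      fun x hx => hx.2.trans_le (min_le_right _ _))
    (fun ε hε => hϱ.densityLaw_ne_zero (a := max (-c) (c - ε)) (b := c)
      (max_lt (by linarith) (by linarith)) (le_max_left _ _) le_rfl
      fun x hx => (le_max_right _ _).trans_lt hx.1)
  obtain ⟨α₀, hα₀, hlin⟩ := hh.exists_eq_mul hc h0 hϱ.ae_abs_lt (p := 2 + κ) (by linarith)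
    (hϱ.integrable_edge hκ)
  refine ⟨fun α => c - h α, ?_, α₀, hα₀, fun α hα => ?_⟩
  · have hae := hh.and (ae_envLaw_inl.and (ae_envLaw_inr hϱ.ae_abs_lt))
    rw [← henv.map_eq_envLaw] at hae
    have hm : AEMeasurable (fun ω i => Sum.elim B F i ω) μ :=
      (measurable_pi_lambda _ fun i => by
        rcases i with i | i
        · exact henv.measurable_B i
        · exact henv.measurable_F i).aemeasurable
    filter_upwards [ae_of_ae_map hm hae] with ω ⟨hω, hB, hF⟩ α hα
    have h1 := (hω α hα).sub_const c
    rw [neg_sub]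
    refine h1.congr' ?_
    filter_upwards [eventually_gt_atTop 0] with n hn
    have hn' : (n : ℝ) ≠ 0 := by exact_mod_cast hn.ne'
    rw [← minAction_add_mul hB hF (abs_intPart_mul_le (abs_le.2 hα) n), add_div,
      mul_div_cancel_right₀ _ hn', add_sub_cancel_right]
    rfl
  · have hα' : |α| ≤ α₀ := abs_le.2 hα
    have h1 : h α = h |α| := by
      rcases abs_choice α with h2 | h2
      · rw [h2]
      · rw [h2, hh.neg (hα'.trans hα₀.2.le)]
    have h3 := hlin |α| ⟨abs_nonneg _, hα'⟩
    have h4 := hα₀.1.ne'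
    simp only
    rw [h1, h3]
    field_simp
    ring
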